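/- Let $N\ge 2$, let $F$ be an arbitrary norm on $\mathbb R^N$ (no smoothness or strict convexity is assumed) with subdifferential $\partial F$, let $1<p<\infty$, and let $\Omega\subset\mathbb R^N$ be a nonempty bounded open set with Lipschitz boundary (for instance a bounded Lipschitz domain). Put $\Omega^e=\mathbb R^N\setminus\overline\Omega$, and let $\varphi\in W^{1-1/p,p}(\partial\Omega)$. For $D=\Omega$ or $D=\Omega^e$ consider $$\operatorname{div}\big(F^{p-1}(\nabla u)\,\partial F(\nabla u)\big)=0\ \text{ in } D,\qquad u=\varphi\ \text{ on }\partial\Omega,\qquad u(x)\to0\ \text{ as } |x|\to\infty\ \text{ if } D=\Omega^e \text{ and } p<N. \tag{1}$$ A weak solution of (1) is a function $u$ on $D$ with distributional gradient $\nabla u\in L^p(D;\mathbb R^N)$ such that * $u\in L^p(\Omega)$ if $D=\Omega$; $u\in L^{pN/(N-p)}(\Omega^e)$ if $D=\Omega^e$ and $p<N$; $u\in L^p(\Omega^e\cap B_R)$ for every $R>0$ if $D=\Omega^e$ and $p\ge N$; * the trace of $u$ on $\partial\Omega$ is $\varphi$, and, if $D=\Omega^e$ and $p<N$, $u(x)\to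 0$ as $|x|\to\infty$ (outside a null set); * there is a measurable $\mathbf z:D\to\mathbb R^N$ with $\mathbf z(x)\in\partial F(\nabla u(x))$ for a.e. $x\in D$ and $$\int_D F^{p-1}(\nabla u)\,\mathbf z\cdot\nabla\eta\,dx=0\qquad\text{for every }\eta\in W^{1,p}_0(D).$$ Then the weak solution of (1) is unique: both for $D=\Omega$ and for $D=\Omega^e$, any two weak solutions of (1) with the same datum $\varphi$ coincide a.e. in $D$. Moreover, if $1<p<N$, then $p$-capacitary potentials are unique. Namely, let $$\mathcal K=\{u\in L^{pN/(N-p)}(\mathbb R^N):\ \nabla u\in L^p(\mathbb R^N),\ u\ge1\text{ a.e. in }\Omega\},$$ $$\operatorname{Cap}^F_p(\overline\Omega)=\inf\Big\{\int_{\mathbb R^N}F^p(\nabla u)\,dx:\ u\in C_c^\infty(\mathbb R^N),\ u\ge1\text{ in }\overline\Omega\Big\}.$$ Any two functions $u\in\mathcal K$ with $\int_{\mathbb R^N}F^p(\nabla u)\,dx=\operatorname{Cap}^F_p(\overline\Omega)$ coincide a.e. in $\mathbb R^N$, and any two minimizers of $\int_{\mathbb R^N}F^p(\nabla u)\,dx$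 over $\mathcal K$ coincide a.e. in $\mathbb R^N$. -/

import Mathlib

open Set Filter Topology MeasureTheory
open scoped ENNReal ContDiff

noncomputable section

namespace AnisoPLaplace

/-- The Euclidean space `ℝ^N`. -/
abbrev Eucl (N : ℕ) : Type := EuclideanSpace ℝ (Fin N)

variable {N : ℕ}

/-- The exterior domain `ℝ^N \ closure Ω`. -/
def exteriorDomain (Ω : Set (Eucl N)) : Set (Eucl N) := (closure Ω)ᶜ

/-- `Ω` has Lipschitz boundary: near each boundary point, for a suitable unit vector `e`
(the last axis of a rotated coordinate system), `Ω` is the set of points lying strictly above the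
graph of a Lipschitz function of the component orthogonal to `e`. -/
def HasLipschitzBoundary (Ω : Set (Eucl N)) : Prop :=
  ∀ x ∈ frontier Ω, ∃ (e : Eucl N) (γ : Eucl N → ℝ) (K : NNReal) (r : ℝ),
    ‖e‖ = 1 ∧ LipschitzWith K γ ∧ 0 < r ∧
      ∀ y ∈ Metric.ball x r, y ∈ Ω ↔ γ (y - inner ℝ e y • e) < inner ℝ e y

/-- Smooth functions on `ℝ^N` whose support is compact and contained in `D`. -/
def IsTestFunction (D : Set (Eucl N)) (ψ : Eucl N → ℝ) : Prop :=
  ContDiff ℝ ∞ ψ ∧ HasCompactSupport ψ ∧ tsupport ψ ⊆ D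

/-- `G` is the distributional gradient of `u` in the open set `D`. -/
def HasWeakGradient (D : Set (Eucl N)) (u : Eucl N → ℝ) (G : Eucl N → Eucl N) : Prop :=
  LocallyIntegrableOn u D ∧ LocallyIntegrableOn G D ∧
    ∀ ψ : Eucl N → ℝ, IsTestFunction D ψ →
      ∫ x in D, u x • gradient ψ x = - ∫ x in D, ψ x • G x

/-- `η` belongs to `W^{1,p}_0(D)`, with gradient `H`: it is a limit in `W^{1,p}(D)` of smooth
functions compactly supported in `D`. -/
def MemSobolevZero (D : Set (Eucl N)) (p : ℝ) (η : Eucl N → ℝ) (H : Eucl N → Eucl N) : Prop :=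
  MemLp η (ENNReal.ofReal p) (volume.restrict D) ∧
  MemLp H (ENNReal.ofReal p) (volume.restrict D) ∧
  ∃ ψ : ℕ → Eucl N → ℝ, (∀ n, IsTestFunction D (ψ n)) ∧
    Tendsto (fun n => eLpNorm (fun x => ψ n x - η x) (ENNReal.ofReal p) (volume.restrict D))
      atTop (𝓝 0) ∧
    Tendsto (fun n => eLpNorm (fun x => gradient (ψ n) x - H x) (ENNReal.ofReal p)
      (volume.restrict D)) atTop (𝓝 0)

/-- The surface measure: the `(N-1)`-dimensional Hausdorff measure on the boundary of `Ω`. -/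
def surfaceMeasure (Ω : Set (Eucl N)) : Measure (Eucl N) :=
  (Measure.hausdorffMeasure ((N : ℝ) - 1)).restrict (frontier Ω)

/-- `φ ∈ W^{1-1/p,p}(∂Ω)`: `φ` is `p`-integrable on the boundary and its Gagliardo seminorm is
finite. The exponent is `(N - 1) + (1 - 1/p) p = N + p - 2`. -/
def MemBoundarySobolev (Ω : Set (Eucl N)) (p : ℝ) (φ : Eucl N → ℝ) : Prop :=
  MemLp φ (ENNReal.ofReal p) (surfaceMeasure Ω) ∧
  ∫⁻ x, ∫⁻ y, ENNReal.ofReal (|φ x - φ y| ^ p / dist x y ^ ((N : ℝ) + p - 2))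
    ∂(surfaceMeasure Ω) ∂(surfaceMeasure Ω) < ⊤

/-- `φ` is the trace on `∂Ω` of the function `u`, with gradient `G`, defined on `D`
(where `D` is `Ω` or its exterior domain). The trace operator is the continuous extension of the
restriction of smooth functions: `u` is approximated in `W^{1,p}` on bounded parts of `D` by smooth
functions on `ℝ^N` whose restrictions to `∂Ω` converge to `φ` in `L^p(∂Ω)`. -/
def HasTrace (Ω D : Set (Eucl N)) (p : ℝ) (u : Eucl N → ℝ) (G : Eucl N → Eucl N)
    (φ : Eucl N → ℝ) : Prop :=
  ∃ ψ : ℕ → Eucl N → ℝ, (∀ n, IsTestFunction univ (ψ n)) ∧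
    (∀ R : ℝ,
      Tendsto (fun n => eLpNorm (fun x => ψ n x - u x) (ENNReal.ofReal p)
        (volume.restrict (D ∩ Metric.ball 0 R))) atTop (𝓝 0) ∧
      Tendsto (fun n => eLpNorm (fun x => gradient (ψ n) x - G x) (ENNReal.ofReal p)
        (volume.restrict (D ∩ Metric.ball 0 R))) atTop (𝓝 0)) ∧
    Tendsto (fun n => eLpNorm (fun x => ψ n x - φ x) (ENNReal.ofReal p) (surfaceMeasure Ω))
      atTop (𝓝 0)

/-- The subdifferential of `F` at `ξ`. -/
def subdifferential (F : Eucl N → ℝ) (ξ : Eucl N) : Set (Eucl N) :=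
  {ζ | ∀ η, inner ℝ ζ (η - ξ) ≤ F η - F ξ}

/-- `div (F^{p-1}(∇u) ∂F(∇u)) = 0` weakly in `D`, where `∇u = G`: some measurable selection `z` of
`∂F(∇u)` satisfies the equation tested against every element of `W^{1,p}_0(D)`. -/
def SatisfiesEquation (F : Eucl N → ℝ) (p : ℝ) (D : Set (Eucl N)) (G : Eucl N → Eucl N) : Prop :=
  ∃ z : Eucl N → Eucl N, AEStronglyMeasurable z (volume.restrict D) ∧
    (∀ᵐ x ∂(volume.restrict D), z x ∈ subdifferential F (G x)) ∧
    ∀ (η : Eucl N → ℝ) (H : Eucl N → Eucl N), MemSobolevZero D p η H →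
      ∫ x in D, F (G x) ^ (p - 1) * inner ℝ (z x) (H x) = 0

/-- Weak solutions in `W^{1,p}(Ω)` of the Dirichlet problem in `Ω` with boundary datum `φ`. -/
def IsInteriorSolution (F : Eucl N → ℝ) (p : ℝ) (Ω : Set (Eucl N)) (φ u : Eucl N → ℝ) : Prop :=
  ∃ G : Eucl N → Eucl N, HasWeakGradient Ω u G ∧
    MemLp u (ENNReal.ofReal p) (volume.restrict Ω) ∧
    MemLp G (ENNReal.ofReal p) (volume.restrict Ω) ∧
    HasTrace Ω Ω p u G φ ∧ SatisfiesEquation F p Ω G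

/-- Weak solutions of the Dirichlet problem in the exterior domain with boundary datum `φ`. The
gradient is in `L^p`, and `u` is in `L^p` on bounded parts. If `p < N`, then moreover
`u ∈ L^{pN/(N-p)}` and `u` tends to `0` at infinity (outside a null set). -/
def IsExteriorSolution (F : Eucl N → ℝ) (p : ℝ) (Ω : Set (Eucl N)) (φ u : Eucl N → ℝ) : Prop :=
  ∃ G : Eucl N → Eucl N, HasWeakGradient (exteriorDomain Ω) u G ∧
    (∀ R : ℝ, MemLp u (ENNReal.ofReal p)
      (volume.restrict (exteriorDomain Ω ∩ Metric.ball 0 R))) ∧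
    MemLp G (ENNReal.ofReal p) (volume.restrict (exteriorDomain Ω)) ∧
    HasTrace Ω (exteriorDomain Ω) p u G φ ∧
    SatisfiesEquation F p (exteriorDomain Ω) G ∧
    (p < N →
      MemLp u (ENNReal.ofReal (p * N / (N - p))) (volume.restrict (exteriorDomain Ω)) ∧
      Tendsto u (cocompact (Eucl N) ⊓ ae (volume.restrict (exteriorDomain Ω))) (𝓝 0))

/-- The energy `∫ F^p(∇u)` over `ℝ^N` of a function with gradient `G`. -/
def energy (F : Eucl N → ℝ) (p : ℝ) (G : Eucl N → Eucl N) : ℝ≥0∞ :=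
  ∫⁻ x, ENNReal.ofReal (F (G x) ^ p)

/-- The anisotropic `p`-capacity of `A`. -/
def pCapacity (F : Eucl N → ℝ) (p : ℝ) (A : Set (Eucl N)) : ℝ≥0∞ :=
  ⨅ u ∈ {u : Eucl N → ℝ | IsTestFunction univ u ∧ ∀ x ∈ A, 1 ≤ u x}, energy F p (gradient u)

/-- `u`, with distributional gradient `G`, belongs to the class
`{u ∈ L^{pN/(N-p)}(ℝ^N) : ∇u ∈ L^p(ℝ^N), u ≥ 1 in Ω}`. -/
def IsCompetitor (p : ℝ) (Ω : Set (Eucl N)) (u : Eucl N → ℝ) (G : Eucl N → Eucl N) : Prop :=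
  MemLp u (ENNReal.ofReal (p * N / (N - p))) volume ∧ HasWeakGradient univ u G ∧
    MemLp G (ENNReal.ofReal p) volume ∧ ∀ᵐ x ∂(volume.restrict Ω), 1 ≤ u x

/-- `u` is a `p`-capacitary potential: a competitor whose energy is the capacity of `closure Ω`. -/
def IsCapacitaryPotential (F : Eucl N → ℝ) (p : ℝ) (Ω : Set (Eucl N)) (u : Eucl N → ℝ) : Prop :=
  ∃ G : Eucl N → Eucl N, IsCompetitor p Ω u G ∧ energy F p G = pCapacity F p (closure Ω)

/-- `u` has the least energy among all competitors. -/
def IsEnergyMinimizer (F : Eucl N → ℝ) (p : ℝ) (Ω : Set (Eucl N)) (u : Eucl N → ℝ) : Prop :=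
  ∃ G : Eucl N → Eucl N, IsCompetitor p Ω u G ∧
    ∀ (v : Eucl N → ℝ) (H : Eucl N → Eucl N), IsCompetitor p Ω v H → energy F p G ≤ energy F p H

end AnisoPLaplace

end

/-! Dirichlet problem. Let `u`, `v` be two solutions with gradients `G`, `H`, and put `w = u - v`.
Two test functions suffice. Testing both equations with `arctan w` makes the integral of a
nonnegative monotonicity expression vanish. Since `F` need not be strictly convex this does not give
`G = H`; it gives `F G = F H` and `F(G)^(p-1) z · (G - H) = 0` a.e. (`flux_monotone`). Testing the
equation of `u` with `w²/(1+w²) · arctan u` then removes every term containing `G - H` and leaves `∫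
w²/(1+w²) · F(G)^p/(1+u²) = 0`. Hence both gradients vanish where `u ≠ v`. So `arctan(w)^3` has zero
gradient, and its trace is zero. Its extension by zero to the whole space is constant, and the
constant is zero because the complement of `D` has positive measure (`SmoothApprox.ae_eq_zero`).

These test functions have to be shown admissible. They are multiplied by cutoffs `κ n` compactly
supported in `D`, and the error `∫ σ · η ∇κ n` tends to zero as soon as `min(1,|w|) ∇κ n` stays
bounded in `L^p`. Near the boundary the bound comes from `‖w‖ ≤ C ε ‖∇w‖` on strips of width `ε`, a
consequence of the zero trace and the Lipschitz charts (`stripBound_frontier`). At infinity it comes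
from the linear growth in `R` of the `L^p` norm of `min(1,|w|)` on balls of radius `R`
(`exists_eLpNorm_ball_le`).

Minimizers. Comparison with the midpoint and strict convexity of `t ↦ t^p` give `F G = F H` a.e. The
competitor `u + c S(v-u) (π/2 - arctan u)`, with `S` the smooth transition, lies above `u`, and its
gradient is `(1-a-b) G + b H` with `a, b ≥ 0` and `a + b ≤ 1`. Its energy density is at most `(1-a)
F(G)^p`, where `a > 0` on `{u < v}`, so `G = 0` there (`ae_seminorm_eq_zero_of_lt`). By symmetry
`arctan(u-v)^3` is constant, and the constant is zero by integrability.

Capacitary potentials reduce to minimizers once the capacity is known to bound the energy of each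
competitor from below (`IsCompetitor.pCapacity_le_energy`). This is an approximation by test
functions: cutoff at infinity, mollification, and small shifts along a partition of unity into the
Lipschitz set `Ω`, which keep the approximants at least `1` on its closure. -/

noncomputable section

namespace AnisoPLaplace

variable {N : ℕ}

/-! ### Convergence in `L^q`. -/

section LpConvergence

variable {α E : Type*} [MeasurableSpace α] {μ : Measure α} [NormedAddCommGroup E] {q : ℝ≥0∞}

theorem tendsto_eLpNorm_zero_of_dominated (hq0 : q ≠ 0) (hq : q ≠ ⊤) {f : ℕ → α → E} {b : α → ℝ}
    (hb : MemLp b q μ) (hf : ∀ n, AEStronglyMeasurable (f n) μ)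
    (hle : ∀ n, ∀ᵐ x ∂μ, ‖f n x‖ ≤ b x) (hlim : ∀ᵐ x ∂μ, Tendsto (fun n => f n x) atTop (𝓝 0)) :
    Tendsto (fun n => eLpNorm (f n) q μ) atTop (𝓝 0) := by
  have hpos : 0 < q.toReal := ENNReal.toReal_pos hq0 hq
  have key : Tendsto (fun n => ∫⁻ x, ‖f n x‖ₑ ^ q.toReal ∂μ) atTop (𝓝 (∫⁻ _, 0 ∂μ)) := by
    refine tendsto_lintegral_of_dominated_convergence' (fun x => ‖b x‖ₑ ^ q.toReal)
      (fun n => (hf n).enorm.pow_const _) (fun n => ?_)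
      (lintegral_rpow_enorm_lt_top_of_eLpNorm_lt_top hq0 hq hb.2).ne ?_
    · filter_upwards [hle n] with x hx
      gcongr
      exact enorm_le_iff_norm_le.2 (hx.trans (le_abs_self _))
    · filter_upwards [hlim] with x hx
      have h1 := (ENNReal.continuous_rpow_const (y := q.toReal)).tendsto 0
      rw [ENNReal.zero_rpow_of_pos hpos] at h1
      refine h1.comp ?_
      simpa using hx.enorm
  have h2 := ((ENNReal.continuous_rpow_const (y := 1 / q.toReal)).tendsto _).comp key
  simp only [lintegral_zero, ENNReal.zero_rpow_of_pos (one_div_pos.2 hpos)] at h2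
  refine h2.congr fun n => ?_
  rw [eLpNorm_eq_lintegral_rpow_enorm_toReal hq0 hq]
  rfl

theorem tendsto_eLpNorm_zero_of_le_mul {F : Type*} [NormedAddCommGroup F] {f : ℕ → α → E}
    {g : ℕ → α → F} (C : ℝ) (hle : ∀ n, ∀ᵐ x ∂μ, ‖f n x‖ ≤ C * ‖g n x‖)
    (hg : Tendsto (fun n => eLpNorm (g n) q μ) atTop (𝓝 0)) :
    Tendsto (fun n => eLpNorm (f n) q μ) atTop (𝓝 0) := by
  have h : Tendsto (fun n => ENNReal.ofReal C * eLpNorm (g n) q μ) atTop (𝓝 0) := by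
    simpa using ENNReal.Tendsto.const_mul hg (Or.inr ENNReal.ofReal_ne_top)
  exact tendsto_of_tendsto_of_tendsto_of_le_of_le tendsto_const_nhds h (fun _ => zero_le)
    fun n => eLpNorm_le_mul_eLpNorm_of_ae_le_mul (hle n) q

theorem tendsto_eLpNorm_zero_add (hq : 1 ≤ q) {f g : ℕ → α → E}
    (hfm : ∀ n, AEStronglyMeasurable (f n) μ) (hgm : ∀ n, AEStronglyMeasurable (g n) μ)
    (hf : Tendsto (fun n => eLpNorm (f n) q μ) atTop (𝓝 0))
    (hg : Tendsto (fun n => eLpNorm (g n) q μ) atTop (𝓝 0)) :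
    Tendsto (fun n => eLpNorm (fun x => f n x + g n x) q μ) atTop (𝓝 0) := by
  have h := hf.add hg
  rw [add_zero] at h
  exact tendsto_of_tendsto_of_tendsto_of_le_of_le tendsto_const_nhds h (fun _ => zero_le)
    fun n => eLpNorm_add_le (hfm n) (hgm n) hq

/-- Split as `m n • (h n - h₀) + (m n - m₀) • h₀`: bounded multipliers handle the first term and
dominated convergence the second. This is the limit needed in the chain rule. -/
theorem tendsto_eLpNorm_smul_sub [NormedSpace ℝ E] (hq : 1 ≤ q) (hqt : q ≠ ⊤) {m : ℕ → α → ℝ}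
    {m₀ : α → ℝ} {h : ℕ → α → E} {h₀ : α → E} {C : ℝ} (hm : ∀ n, AEStronglyMeasurable (m n) μ)
    (hm₀ : AEStronglyMeasurable m₀ μ)
    (hC : ∀ n x, |m n x| ≤ C) (hC₀ : ∀ x, |m₀ x| ≤ C)
    (hlim : ∀ᵐ x ∂μ, Tendsto (fun n => m n x) atTop (𝓝 (m₀ x)))
    (hh : ∀ n, AEStronglyMeasurable (h n) μ) (hh₀ : MemLp h₀ q μ)
    (hconv : Tendsto (fun n => eLpNorm (fun x => h n x - h₀ x) q μ) atTop (𝓝 0)) :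
    Tendsto (fun n => eLpNorm (fun x => m n x • h n x - m₀ x • h₀ x) q μ) atTop (𝓝 0) := by
  have h1 : Tendsto (fun n => eLpNorm (fun x => m n x • (h n x - h₀ x)) q μ) atTop (𝓝 0) := by
    refine tendsto_eLpNorm_zero_of_le_mul C (fun n => Eventually.of_forall fun x => ?_) hconv
    rw [norm_smul]
    exact mul_le_mul_of_nonneg_right (hC n x) (norm_nonneg _)
  have h2 : Tendsto (fun n => eLpNorm (fun x => (m n x - m₀ x) • h₀ x) q μ) atTop (𝓝 0) := by
    refine tendsto_eLpNorm_zero_of_dominated (zero_lt_one.trans_le hq).ne' hqt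
      (hh₀.norm.const_mul (2 * C)) (fun n => ((hm n).sub hm₀).smul hh₀.1)
      (fun n => Eventually.of_forall fun x => ?_) ?_
    · rw [norm_smul]
      refine mul_le_mul_of_nonneg_right ?_ (norm_nonneg _)
      have := abs_sub (m n x) (m₀ x)
      have h3 := hC n x
      have h4 := hC₀ x
      rw [Real.norm_eq_abs]
      linarith
    · filter_upwards [hlim] with x hx
      have h3 : Tendsto (fun n => m n x - m₀ x) atTop (𝓝 0) := by
        simpa using hx.sub_const (m₀ x)
      simpa using h3.smul_const (h₀ x)
  refine (tendsto_eLpNorm_zero_add hq (fun n => (hm n).smul ((hh n).sub hh₀.1))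
    (fun n => ((hm n).sub hm₀).smul hh₀.1) h1 h2).congr fun n => ?_
  congr 1
  ext x
  change m n x • (h n x - h₀ x) + (m n x - m₀ x) • h₀ x = _
  rw [smul_sub, sub_smul]
  abel

end LpConvergence

/-! ### Gradients and test functions. -/

theorem hasGradientAt_of_hasFDerivAt_inner {f : Eucl N → ℝ} {x G : Eucl N}
    (h : HasFDerivAt f (innerSL ℝ G) x) : HasGradientAt f G x := by
  exact hasGradientAt_iff_hasFDerivAt.2 h

theorem HasGradientAt.hasFDerivAt_inner {f : Eucl N → ℝ} {x G : Eucl N}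
    (h : HasGradientAt f G x) : HasFDerivAt f (innerSL ℝ G) x := by
  exact hasGradientAt_iff_hasFDerivAt.1 h

theorem norm_gradient_eq (f : Eucl N → ℝ) (x : Eucl N) : ‖gradient f x‖ = ‖fderiv ℝ f x‖ := by
  rw [gradient, LinearIsometryEquiv.norm_map]

theorem continuous_gradient {f : Eucl N → ℝ} (hf : ContDiff ℝ ∞ f) : Continuous (gradient f) :=
  (LinearIsometryEquiv.continuous _).comp (hf.continuous_fderiv (by simp))

theorem hasGradientAt_of_contDiff {f : Eucl N → ℝ} (hf : ContDiff ℝ ∞ f) (x : Eucl N) :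
    HasGradientAt f (gradient f x) x :=
  ((hf.differentiable (by simp)) x).hasGradientAt

theorem hasGradientAt_mul {f g : Eucl N → ℝ} {x a b : Eucl N} (hf : HasGradientAt f a x)
    (hg : HasGradientAt g b x) : HasGradientAt (fun y => f y * g y) (f x • b + g x • a) x := by
  apply hasGradientAt_of_hasFDerivAt_inner
  refine ((HasGradientAt.hasFDerivAt_inner hf).mul
    (HasGradientAt.hasFDerivAt_inner hg)).congr_fderiv ?_
  simp

theorem gradient_mul {f g : Eucl N → ℝ} (hf : ContDiff ℝ ∞ f) (hg : ContDiff ℝ ∞ g) (x : Eucl N) :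
    gradient (fun y => f y * g y) x = f x • gradient g x + g x • gradient f x :=
  (hasGradientAt_mul (hasGradientAt_of_contDiff hf x) (hasGradientAt_of_contDiff hg x)).gradient

theorem tsupport_gradient_subset (f : Eucl N → ℝ) : tsupport (gradient f) ⊆ tsupport f := by
  refine closure_minimal (fun x hx => ?_) isClosed_closure
  by_contra h
  have h1 : f =ᶠ[𝓝 x] fun _ => (0 : ℝ) := notMem_tsupport_iff_eventuallyEq.1 h
  refine hx ?_
  rw [h1.gradient_eq, gradient, fderiv_const_apply, map_zero]

theorem IsTestFunction.mono {D D' : Set (Eucl N)} {ψ : Eucl N → ℝ} (h : IsTestFunction D ψ)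
    (hD : D ⊆ D') : IsTestFunction D' ψ :=
  ⟨h.1, h.2.1, h.2.2.trans hD⟩

theorem IsTestFunction.mul {D : Set (Eucl N)} {ψ χ : Eucl N → ℝ} (h : IsTestFunction D ψ)
    (hχ : ContDiff ℝ ∞ χ) : IsTestFunction D (fun x => χ x * ψ x) :=
  ⟨hχ.mul h.1, h.2.1.mul_left, (tsupport_mul_subset_right).trans h.2.2⟩

theorem IsTestFunction.exists_bound {D : Set (Eucl N)} {ψ : Eucl N → ℝ} (h : IsTestFunction D ψ) :
    ∃ C, ∀ x, |ψ x| ≤ C ∧ ‖gradient ψ x‖ ≤ C := by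
  obtain ⟨A, hA⟩ := h.2.1.exists_bound_of_continuous h.1.continuous
  have h2 : HasCompactSupport (gradient ψ) :=
    h.2.1.of_isClosed_subset isClosed_closure (tsupport_gradient_subset ψ)
  obtain ⟨B, hB⟩ := h2.exists_bound_of_continuous (continuous_gradient h.1)
  exact ⟨max A B, fun x => ⟨(hA x).trans (le_max_left _ _), (hB x).trans (le_max_right _ _)⟩⟩

theorem IsTestFunction.exists_radius {D : Set (Eucl N)} {ψ : Eucl N → ℝ}
    (h : IsTestFunction D ψ) : ∃ R : ℝ, 0 < R ∧ tsupport ψ ⊆ D ∩ Metric.ball 0 R := by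
  obtain ⟨R, hR⟩ := h.2.1.isBounded.subset_ball 0
  refine ⟨max R 1, by positivity, subset_inter h.2.2 (hR.trans (Metric.ball_subset_ball
    (le_max_left _ _)))⟩

/-! ### Smooth approximation and the chain rule. -/

/-- A smooth function of two real variables with bounded partial derivatives `A` and `B`. -/
structure IsSmoothLipschitz (Φ A B : ℝ → ℝ → ℝ) (C : ℝ) : Prop where
  smooth : ContDiff ℝ ∞ (fun r : ℝ × ℝ => Φ r.1 r.2)
  continuous_left : Continuous (fun r : ℝ × ℝ => A r.1 r.2)
  continuous_right : Continuous (fun r : ℝ × ℝ => B r.1 r.2)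
  hasFDerivAt : ∀ s t, HasFDerivAt (fun r : ℝ × ℝ => Φ r.1 r.2)
    (A s t • ContinuousLinearMap.fst ℝ ℝ ℝ + B s t • ContinuousLinearMap.snd ℝ ℝ ℝ) (s, t)
  bound_left : ∀ s t, |A s t| ≤ C
  bound_right : ∀ s t, |B s t| ≤ C

theorem IsSmoothLipschitz.abs_sub_le {Φ A B : ℝ → ℝ → ℝ} {C : ℝ} (h : IsSmoothLipschitz Φ A B C)
    (s t s' t' : ℝ) : |Φ s t - Φ s' t'| ≤ 2 * C * (|s - s'| + |t - t'|) := by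
  have hC : 0 ≤ C := (abs_nonneg _).trans (h.bound_left 0 0)
  -- Each partial derivative is at most `C` and both projections have norm at most one, so the
  -- differential has norm at most `2 * C`.
  have key := Convex.norm_image_sub_le_of_norm_hasFDerivWithin_le (𝕜 := ℝ)
    (f := fun r : ℝ × ℝ => Φ r.1 r.2) (s := univ) (C := 2 * C) (x := (s', t')) (y := (s, t))
    (fun x _ => (h.hasFDerivAt x.1 x.2).hasFDerivWithinAt) (fun x _ => ?_) convex_univ
    (mem_univ _) (mem_univ _)
  · refine key.trans (mul_le_mul_of_nonneg_left ?_ (by positivity))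
    rw [Prod.norm_def]
    simp only [Prod.mk_sub_mk, Real.norm_eq_abs]
    exact max_le (by linarith [abs_nonneg (t - t')]) (by linarith [abs_nonneg (s - s')])
  · refine (norm_add_le _ _).trans ?_
    rw [norm_smul, norm_smul]
    have h1 := ContinuousLinearMap.norm_fst_le ℝ ℝ ℝ
    have h2 := ContinuousLinearMap.norm_snd_le ℝ ℝ ℝ
    have h3 := h.bound_left x.1 x.2
    have h4 := h.bound_right x.1 x.2
    simp only [Real.norm_eq_abs]
    have h5 := mul_le_mul h3 h1 (norm_nonneg _) hC
    have h6 := mul_le_mul h4 h2 (norm_nonneg _) hC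
    linarith

theorem IsSmoothLipschitz.hasGradientAt {Φ A B : ℝ → ℝ → ℝ} {C : ℝ} (h : IsSmoothLipschitz Φ A B C)
    {f g : Eucl N → ℝ} {x a b : Eucl N} (hf : HasGradientAt f a x) (hg : HasGradientAt g b x) :
    HasGradientAt (fun y => Φ (f y) (g y)) (A (f x) (g x) • a + B (f x) (g x) • b) x := by
  apply hasGradientAt_of_hasFDerivAt_inner
  have h1 := (HasGradientAt.hasFDerivAt_inner hf).prodMk (HasGradientAt.hasFDerivAt_inner hg)
  refine ((h.hasFDerivAt (f x) (g x)).comp x h1).congr_fderiv ?_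
  ext v
  simp

theorem IsSmoothLipschitz.contDiff_comp {Φ A B : ℝ → ℝ → ℝ} {C : ℝ}
    (h : IsSmoothLipschitz Φ A B C) {f g : Eucl N → ℝ} (hf : ContDiff ℝ ∞ f)
    (hg : ContDiff ℝ ∞ g) : ContDiff ℝ ∞ (fun x => Φ (f x) (g x)) :=
  h.smooth.comp (hf.prodMk hg)

/-- The smooth functions `φ n` approximate `u`, with gradient `G`, in `W^{1,q}` on bounded parts
of `D`. -/
structure SmoothApprox (D : Set (Eucl N)) (q : ℝ≥0∞) (u : Eucl N → ℝ) (G : Eucl N → Eucl N)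
    (φ : ℕ → Eucl N → ℝ) : Prop where
  smooth : ∀ n, ContDiff ℝ ∞ (φ n)
  memLp : ∀ R : ℝ, MemLp u q (volume.restrict (D ∩ Metric.ball 0 R))
  memLp_grad : ∀ R : ℝ, MemLp G q (volume.restrict (D ∩ Metric.ball 0 R))
  tendsto : ∀ R : ℝ, Tendsto (fun n => eLpNorm (fun x => φ n x - u x) q
    (volume.restrict (D ∩ Metric.ball 0 R))) atTop (𝓝 0)
  tendsto_grad : ∀ R : ℝ, Tendsto (fun n => eLpNorm (fun x => gradient (φ n) x - G x) q
    (volume.restrict (D ∩ Metric.ball 0 R))) atTop (𝓝 0)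

theorem volume_inter_ball_lt_top (D : Set (Eucl N)) (R : ℝ) :
    volume (D ∩ Metric.ball 0 R) < ⊤ :=
  (measure_mono inter_subset_right).trans_lt measure_ball_lt_top

instance isFiniteMeasure_restrict_inter_ball (D : Set (Eucl N)) (R : ℝ) :
    IsFiniteMeasure (volume.restrict (D ∩ Metric.ball 0 R)) :=
  isFiniteMeasure_restrict.2 (volume_inter_ball_lt_top D R).ne

section Chain

variable {D : Set (Eucl N)} {q : ℝ≥0∞} {u v : Eucl N → ℝ} {G H : Eucl N → Eucl N}
  {φ ψ : ℕ → Eucl N → ℝ}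

theorem SmoothApprox.comp_tendsto (h : SmoothApprox D q u G φ) {ns : ℕ → ℕ}
    (hns : Tendsto ns atTop atTop) : SmoothApprox D q u G (fun n => φ (ns n)) :=
  ⟨fun _ => h.smooth _, h.memLp, h.memLp_grad, fun R => (h.tendsto R).comp hns,
    fun R => (h.tendsto_grad R).comp hns⟩

theorem SmoothApprox.exists_ae_tendsto (hq : 1 ≤ q) (h : SmoothApprox D q u G φ) (R : ℝ) :
    ∃ ms : ℕ → ℕ, StrictMono ms ∧ ∀ᵐ x ∂(volume.restrict (D ∩ Metric.ball 0 R)),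
      Tendsto (fun n => φ (ms n) x) atTop (𝓝 (u x)) :=
  (tendstoInMeasure_of_tendsto_eLpNorm (zero_lt_one.trans_le hq).ne'
    (fun n => (h.smooth n).continuous.aestronglyMeasurable) (h.memLp R).1
    (h.tendsto R)).exists_seq_tendsto_ae

/-- The Sobolev chain rule for a function of two Sobolev functions. It is proved on the
approximants, so an approximating sequence for the composition comes with it; its boundary values
are the compositions of the boundary values. -/
theorem SmoothApprox.comp (hq : 1 ≤ q) (hqt : q ≠ ⊤) (hu : SmoothApprox D q u G φ)
    (hv : SmoothApprox D q v H ψ) {Φ A B : ℝ → ℝ → ℝ} {C : ℝ} (hΦ : IsSmoothLipschitz Φ A B C) :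
    SmoothApprox D q (fun x => Φ (u x) (v x))
      (fun x => A (u x) (v x) • G x + B (u x) (v x) • H x) (fun n x => Φ (φ n x) (ψ n x)) := by
  have hA : ∀ R, AEStronglyMeasurable (fun x => A (u x) (v x))
      (volume.restrict (D ∩ Metric.ball 0 R)) := fun R =>
    hΦ.continuous_left.comp_aestronglyMeasurable ((hu.memLp R).1.prodMk (hv.memLp R).1)
  have hB : ∀ R, AEStronglyMeasurable (fun x => B (u x) (v x))
      (volume.restrict (D ∩ Metric.ball 0 R)) := fun R =>
    hΦ.continuous_right.comp_aestronglyMeasurable ((hu.memLp R).1.prodMk (hv.memLp R).1)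
  refine ⟨fun n => hΦ.contDiff_comp (hu.smooth n) (hv.smooth n), fun R => ?_, fun R => ?_,
    fun R => ?_, fun R => ?_⟩
  · have h1 : MemLp (fun x => |Φ 0 0| + 2 * C * (|u x| + |v x|)) q
        (volume.restrict (D ∩ Metric.ball 0 R)) :=
      MemLp.add (f := fun _ => |Φ 0 0|) (g := fun x => 2 * C * (|u x| + |v x|)) (memLp_const _)
        (MemLp.const_mul (f := fun x => |u x| + |v x|)
          ((hu.memLp R).norm.add (hv.memLp R).norm) _)
    refine h1.mono' (hΦ.smooth.continuous.comp_aestronglyMeasurable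
      ((hu.memLp R).1.prodMk (hv.memLp R).1)) (Eventually.of_forall fun x => ?_)
    have h2 := hΦ.abs_sub_le (u x) (v x) 0 0
    have h3 := abs_sub_abs_le_abs_sub (Φ (u x) (v x)) (Φ 0 0)
    simp only [sub_zero] at h2
    rw [Real.norm_eq_abs]
    linarith
  · refine MemLp.add ?_ ?_
    · refine (hu.memLp_grad R).of_le_mul (c := C) ((hA R).smul (hu.memLp_grad R).1)
        (Eventually.of_forall fun x => ?_)
      rw [norm_smul]
      exact mul_le_mul_of_nonneg_right (hΦ.bound_left _ _) (norm_nonneg _)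
    · refine (hv.memLp_grad R).of_le_mul (c := C) ((hB R).smul (hv.memLp_grad R).1)
        (Eventually.of_forall fun x => ?_)
      rw [norm_smul]
      exact mul_le_mul_of_nonneg_right (hΦ.bound_right _ _) (norm_nonneg _)
  · have hum : ∀ n, AEStronglyMeasurable (fun x => |φ n x - u x|)
        (volume.restrict (D ∩ Metric.ball 0 R)) := fun n =>
      ((hu.smooth n).continuous.aestronglyMeasurable.sub (hu.memLp R).1).norm
    have hvm : ∀ n, AEStronglyMeasurable (fun x => |ψ n x - v x|)
        (volume.restrict (D ∩ Metric.ball 0 R)) := fun n =>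
      ((hv.smooth n).continuous.aestronglyMeasurable.sub (hv.memLp R).1).norm
    refine tendsto_eLpNorm_zero_of_le_mul (2 * C) (fun n => Eventually.of_forall fun x => ?_)
      (tendsto_eLpNorm_zero_add hq hum hvm ?_ ?_)
    · simp only [Real.norm_eq_abs]
      refine (hΦ.abs_sub_le _ _ _ _).trans_eq ?_
      rw [abs_of_nonneg (add_nonneg (abs_nonneg (φ n x - u x)) (abs_nonneg _))]
    · refine (hu.tendsto R).congr fun n => ?_
      exact (eLpNorm_norm _).symm
    · refine (hv.tendsto R).congr fun n => ?_
      exact (eLpNorm_norm _).symm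
  -- The multipliers `A (φ n) (ψ n)` converge a.e. only along subsequences, so every subsequence is
  -- shown to have a further one along which the gradients converge.
  · refine tendsto_of_subseq_tendsto fun ns hns => ?_
    obtain ⟨ms, hms, hms'⟩ := (hu.comp_tendsto hns).exists_ae_tendsto hq R
    obtain ⟨ls, hls, hls'⟩ := (hv.comp_tendsto (hns.comp hms.tendsto_atTop)).exists_ae_tendsto hq R
    have hk : Tendsto (fun n => ns (ms (ls n))) atTop atTop :=
      hns.comp (hms.tendsto_atTop.comp hls.tendsto_atTop)
    refine ⟨fun n => ms (ls n), ?_⟩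
    have hu' := hu.comp_tendsto hk
    have hv' := hv.comp_tendsto hk
    have hlim : ∀ᵐ x ∂(volume.restrict (D ∩ Metric.ball 0 R)),
        Tendsto (fun n => (φ (ns (ms (ls n))) x, ψ (ns (ms (ls n))) x)) atTop
          (𝓝 (u x, v x)) := by
      filter_upwards [hms', hls'] with x h1 h2
      exact (h1.comp hls.tendsto_atTop).prodMk_nhds h2
    have c1 := tendsto_eLpNorm_smul_sub hq hqt (μ := volume.restrict (D ∩ Metric.ball 0 R))
      (m := fun n x => A (φ (ns (ms (ls n))) x) (ψ (ns (ms (ls n))) x))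
      (m₀ := fun x => A (u x) (v x)) (h := fun n => gradient (φ (ns (ms (ls n)))))
      (h₀ := G) (C := C)
      (fun n => (hΦ.continuous_left.comp ((hu'.smooth n).continuous.prodMk
        (hv'.smooth n).continuous)).aestronglyMeasurable) (hA R)
      (fun _ _ => hΦ.bound_left _ _) (fun _ => hΦ.bound_left _ _)
      (hlim.mono fun x hx => (hΦ.continuous_left.tendsto (u x, v x)).comp hx)
      (fun n => (continuous_gradient (hu'.smooth n)).aestronglyMeasurable) (hu.memLp_grad R)
      (hu'.tendsto_grad R)
    have c2 := tendsto_eLpNorm_smul_sub hq hqt (μ := volume.restrict (D ∩ Metric.ball 0 R))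
      (m := fun n x => B (φ (ns (ms (ls n))) x) (ψ (ns (ms (ls n))) x))
      (m₀ := fun x => B (u x) (v x)) (h := fun n => gradient (ψ (ns (ms (ls n)))))
      (h₀ := H) (C := C)
      (fun n => (hΦ.continuous_right.comp ((hu'.smooth n).continuous.prodMk
        (hv'.smooth n).continuous)).aestronglyMeasurable) (hB R)
      (fun _ _ => hΦ.bound_right _ _) (fun _ => hΦ.bound_right _ _)
      (hlim.mono fun x hx => (hΦ.continuous_right.tendsto (u x, v x)).comp hx)
      (fun n => (continuous_gradient (hv'.smooth n)).aestronglyMeasurable) (hv.memLp_grad R)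
      (hv'.tendsto_grad R)
    have mA : ∀ n, AEStronglyMeasurable (fun x => A (φ (ns (ms (ls n))) x) (ψ (ns (ms (ls n))) x) •
        gradient (φ (ns (ms (ls n)))) x - A (u x) (v x) • G x)
        (volume.restrict (D ∩ Metric.ball 0 R)) := fun n =>
      (((hΦ.continuous_left.comp ((hu'.smooth n).continuous.prodMk (hv'.smooth n).continuous)).smul
        (continuous_gradient (hu'.smooth n))).aestronglyMeasurable).sub
        ((hA R).smul (hu.memLp_grad R).1)
    have mB : ∀ n, AEStronglyMeasurable (fun x => B (φ (ns (ms (ls n))) x) (ψ (ns (ms (ls n))) x) •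
        gradient (ψ (ns (ms (ls n)))) x - B (u x) (v x) • H x)
        (volume.restrict (D ∩ Metric.ball 0 R)) := fun n =>
      (((hΦ.continuous_right.comp ((hu'.smooth n).continuous.prodMk (hv'.smooth n).continuous)).smul
        (continuous_gradient (hv'.smooth n))).aestronglyMeasurable).sub
        ((hB R).smul (hv.memLp_grad R).1)
    refine (tendsto_eLpNorm_zero_add hq mA mB c1 c2).congr fun n => ?_
    congr 1
    ext1 x
    rw [(hΦ.hasGradientAt (hasGradientAt_of_contDiff (hu'.smooth n) x)
      (hasGradientAt_of_contDiff (hv'.smooth n) x)).gradient]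
    abel

end Chain

/-! ### Weak gradients and admissible test functions. -/

section WeakGradient

theorem tendsto_integral_of_tendsto_eLpNorm {α E : Type*} [MeasurableSpace α] {μ : Measure α}
    [IsFiniteMeasure μ] [NormedAddCommGroup E] [NormedSpace ℝ E] {q : ℝ≥0∞} (hq : 1 ≤ q)
    {f : ℕ → α → E} {f₀ : α → E} (hf : ∀ n, AEStronglyMeasurable (f n) μ) (hf₀ : MemLp f₀ q μ)
    (hconv : Tendsto (fun n => eLpNorm (fun x => f n x - f₀ x) q μ) atTop (𝓝 0)) :
    Tendsto (fun n => ∫ x, f n x ∂μ) atTop (𝓝 (∫ x, f₀ x ∂μ)) := by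
  have hint₀ : Integrable f₀ μ := hf₀.integrable hq
  have hint : ∀ᶠ n in atTop, Integrable (f n) μ := by
    filter_upwards [hconv.eventually (gt_mem_nhds (zero_lt_one' ℝ≥0∞))] with n hn
    have h1 : MemLp (fun x => f n x - f₀ x) q μ := ⟨(hf n).sub hf₀.1, hn.trans ENNReal.one_lt_top⟩
    refine ((h1.integrable hq).add hint₀).congr (Eventually.of_forall fun x => ?_)
    simp
  refine tendsto_integral_of_L1' f₀ hint₀.1 hint ?_
  have h1 : Tendsto (fun n => eLpNorm (fun x => f n x - f₀ x) q μ *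
      μ univ ^ (1 / (1 : ℝ≥0∞).toReal - 1 / q.toReal)) atTop (𝓝 0) := by
    have h2 : (μ univ ^ (1 / (1 : ℝ≥0∞).toReal - 1 / q.toReal)) ≠ ⊤ := by
      refine ENNReal.rpow_ne_top_of_nonneg ?_ (measure_ne_top μ _)
      rw [ENNReal.toReal_one, div_one, sub_nonneg]
      rcases eq_or_ne q ⊤ with rfl | hqt
      · simp
      · rw [div_le_one (ENNReal.toReal_pos (zero_lt_one.trans_le hq).ne' hqt)]
        simpa using ENNReal.toReal_mono hqt hq
    simpa using ENNReal.Tendsto.mul_const hconv (Or.inr h2)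
  exact tendsto_of_tendsto_of_tendsto_of_le_of_le tendsto_const_nhds h1 (fun _ => zero_le)
    fun n => eLpNorm_le_eLpNorm_mul_rpow_measure_univ hq ((hf n).sub hf₀.1)

theorem integral_smul_gradient_eq_neg {f ψ : Eucl N → ℝ} (hf : ContDiff ℝ ∞ f)
    (hψ : IsTestFunction univ ψ) :
    ∫ x, f x • gradient ψ x = - ∫ x, ψ x • gradient f x := by
  have hψ' : HasCompactSupport (gradient ψ) :=
    hψ.2.1.of_isClosed_subset isClosed_closure (tsupport_gradient_subset ψ)
  have i1 : Integrable (fun x => f x • gradient ψ x) :=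
    (hf.continuous.smul (continuous_gradient hψ.1)).integrable_of_hasCompactSupport hψ'.smul_left
  have i2 : Integrable (fun x => ψ x • gradient f x) :=
    (hψ.1.continuous.smul (continuous_gradient hf)).integrable_of_hasCompactSupport
      hψ.2.1.smul_right
  have hfψ : Integrable (fun x => f x * ψ x) :=
    (hf.continuous.mul hψ.1.continuous).integrable_of_hasCompactSupport hψ.2.1.mul_left
  refine ext_inner_left ℝ fun v => ?_
  rw [inner_neg_right, ← integral_inner i1, ← integral_inner i2]
  have e1 : ∀ x, inner ℝ v (f x • gradient ψ x) = f x * fderiv ℝ ψ x v := fun x => by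
    rw [inner_smul_right, real_inner_comm, inner_gradient_left]
  have e2 : ∀ x, inner ℝ v (ψ x • gradient f x) = fderiv ℝ f x v * ψ x := fun x => by
    rw [inner_smul_right, real_inner_comm, inner_gradient_left, mul_comm]
  simp_rw [e1, e2]
  refine integral_mul_fderiv_eq_neg_fderiv_mul_of_integrable ?_ ?_ hfψ
    (fun x _ => hf.differentiable (by simp) x) (fun x _ => hψ.1.differentiable (by simp) x)
  · exact (i2.const_inner (𝕜 := ℝ) v).congr (Eventually.of_forall e2)
  · exact (i1.const_inner (𝕜 := ℝ) v).congr (Eventually.of_forall e1)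

theorem setIntegral_eq_of_forall_notMem {E : Type*} [NormedAddCommGroup E] [NormedSpace ℝ E]
    {S T : Set (Eucl N)} {f : Eucl N → E} (hST : S ⊆ T) (hf : ∀ x ∉ S, f x = 0) :
    ∫ x in T, f x = ∫ x in S, f x := by
  rw [setIntegral_eq_integral_of_forall_compl_eq_zero fun x hx => hf x hx,
    setIntegral_eq_integral_of_forall_compl_eq_zero fun x hx => hf x (fun h => hx (hST h))]

theorem gradient_eq_zero_of_notMem {ψ : Eucl N → ℝ} {x : Eucl N} (hx : x ∉ tsupport ψ) :
    gradient ψ x = 0 :=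
  image_eq_zero_of_notMem_tsupport fun h => hx (tsupport_gradient_subset ψ h)

theorem locallyIntegrableOn_of_memLp_ball {E : Type*} [NormedAddCommGroup E]
    {D : Set (Eucl N)} {q : ℝ≥0∞} (hq : 1 ≤ q) {f : Eucl N → E}
    (hf : ∀ R : ℝ, MemLp f q (volume.restrict (D ∩ Metric.ball 0 R))) :
    LocallyIntegrableOn f D := by
  intro x _
  refine ⟨D ∩ Metric.ball 0 (‖x‖ + 1), inter_mem self_mem_nhdsWithin
    (mem_nhdsWithin_of_mem_nhds (Metric.isOpen_ball.mem_nhds ?_)), (hf _).integrable hq⟩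
  simp

/-- Integration by parts holds for the smooth approximants, and only a ball containing the support
of the test function matters, where `L^q` convergence lets the integrals pass to the limit. -/
theorem SmoothApprox.hasWeakGradient {D : Set (Eucl N)} (hD : IsOpen D) {q : ℝ≥0∞} (hq : 1 ≤ q)
    {u : Eucl N → ℝ} {G : Eucl N → Eucl N} {φ : ℕ → Eucl N → ℝ} (h : SmoothApprox D q u G φ) :
    HasWeakGradient D u G := by
  refine ⟨locallyIntegrableOn_of_memLp_ball hq h.memLp,
    locallyIntegrableOn_of_memLp_ball hq h.memLp_grad, fun ψ hψ => ?_⟩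
  obtain ⟨R, -, hR⟩ := hψ.exists_radius
  obtain ⟨C, hC⟩ := hψ.exists_bound
  have hm : MeasurableSet (D ∩ Metric.ball 0 R) :=
    hD.measurableSet.inter Metric.isOpen_ball.measurableSet
  have hψ0 : ∀ x ∉ D ∩ Metric.ball 0 R, ψ x = 0 := fun x hx =>
    image_eq_zero_of_notMem_tsupport fun h => hx (hR h)
  have hψ1 : ∀ x ∉ D ∩ Metric.ball 0 R, gradient ψ x = 0 := fun x hx =>
    gradient_eq_zero_of_notMem fun h => hx (hR h)
  have hψc := hψ.1.continuous
  have hψg := continuous_gradient hψ.1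
  rw [setIntegral_eq_of_forall_notMem (S := D ∩ Metric.ball 0 R) inter_subset_left
    (fun x hx => by rw [hψ1 x hx, smul_zero]),
    setIntegral_eq_of_forall_notMem (S := D ∩ Metric.ball 0 R) inter_subset_left
    (fun x hx => by rw [hψ0 x hx, zero_smul])]
  have t1 : Tendsto (fun n => ∫ x in D ∩ Metric.ball 0 R, φ n x • gradient ψ x) atTop
      (𝓝 (∫ x in D ∩ Metric.ball 0 R, u x • gradient ψ x)) := by
    refine tendsto_integral_of_tendsto_eLpNorm hq
      (fun n => ((h.smooth n).continuous.smul hψg).aestronglyMeasurable)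
      ((h.memLp R).of_le_mul (c := C) ((h.memLp R).1.smul hψg.aestronglyMeasurable) ?_)
      (tendsto_eLpNorm_zero_of_le_mul C (fun n => ?_) (h.tendsto R))
    · refine Eventually.of_forall fun x => ?_
      rw [norm_smul, mul_comm]
      exact mul_le_mul_of_nonneg_right (hC x).2 (norm_nonneg _)
    · refine Eventually.of_forall fun x => ?_
      rw [← sub_smul, norm_smul, mul_comm]
      exact mul_le_mul_of_nonneg_right (hC x).2 (norm_nonneg _)
  have t2 : Tendsto (fun n => ∫ x in D ∩ Metric.ball 0 R, ψ x • gradient (φ n) x) atTop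
      (𝓝 (∫ x in D ∩ Metric.ball 0 R, ψ x • G x)) := by
    refine tendsto_integral_of_tendsto_eLpNorm hq
      (fun n => (hψc.smul (continuous_gradient (h.smooth n))).aestronglyMeasurable)
      ((h.memLp_grad R).of_le_mul (c := C) (hψc.aestronglyMeasurable.smul (h.memLp_grad R).1) ?_)
      (tendsto_eLpNorm_zero_of_le_mul C (fun n => ?_) (h.tendsto_grad R))
    · refine Eventually.of_forall fun x => ?_
      rw [norm_smul]
      exact mul_le_mul_of_nonneg_right (hC x).1 (norm_nonneg _)
    · refine Eventually.of_forall fun x => ?_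
      rw [← smul_sub, norm_smul]
      exact mul_le_mul_of_nonneg_right (hC x).1 (norm_nonneg _)
  refine tendsto_nhds_unique t1 (t2.neg.congr fun n => ?_)
  rw [← setIntegral_eq_of_forall_notMem (S := D ∩ Metric.ball 0 R) (subset_univ _)
    (fun x hx => by rw [hψ0 x hx, zero_smul]),
    ← setIntegral_eq_of_forall_notMem (S := D ∩ Metric.ball 0 R) (subset_univ _)
    (fun x hx => by rw [hψ1 x hx, smul_zero]), setIntegral_univ, setIntegral_univ,
    integral_smul_gradient_eq_neg (h.smooth n) (hψ.mono (subset_univ _))]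

theorem IsTestFunction.integrableOn_smul {E : Type*} [NormedAddCommGroup E] [NormedSpace ℝ E]
    {D : Set (Eucl N)} {ψ : Eucl N → ℝ} (hψ : IsTestFunction D ψ) {f : Eucl N → E}
    (hf : LocallyIntegrableOn f D) : IntegrableOn (fun x => ψ x • f x) D := by
  have h1 : IntegrableOn (fun x => ψ x • f x) (tsupport ψ) :=
    ((hf.integrableOn_compact_subset hψ.2.2 hψ.2.1).continuousOn_smul
      hψ.1.continuous.continuousOn hψ.2.1)
  refine (h1.integrable_of_forall_notMem_eq_zero fun x hx => ?_).integrableOn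
  rw [image_eq_zero_of_notMem_tsupport hx, zero_smul]

theorem IsTestFunction.integrableOn_smul_gradient
    {D : Set (Eucl N)} {ψ : Eucl N → ℝ} (hψ : IsTestFunction D ψ) {f : Eucl N → ℝ}
    (hf : LocallyIntegrableOn f D) : IntegrableOn (fun x => f x • gradient ψ x) D := by
  have h1 : IntegrableOn (fun x => f x • gradient ψ x) (tsupport ψ) :=
    ((hf.integrableOn_compact_subset hψ.2.2 hψ.2.1).smul_continuousOn
      (continuous_gradient hψ.1).continuousOn hψ.2.1)
  refine (h1.integrable_of_forall_notMem_eq_zero fun x hx => ?_).integrableOn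
  rw [gradient_eq_zero_of_notMem hx, smul_zero]

/-- Test the weak gradient of `u` with `χ * ψ` and move the term containing `∇χ` to the other side.
-/
theorem HasWeakGradient.smooth_mul {D : Set (Eucl N)} (hD : IsOpen D) {u : Eucl N → ℝ}
    {G : Eucl N → Eucl N} (h : HasWeakGradient D u G) {χ : Eucl N → ℝ} (hχ : ContDiff ℝ ∞ χ) :
    HasWeakGradient D (fun x => χ x * u x) (fun x => χ x • G x + u x • gradient χ x) := by
  have l1 : LocallyIntegrableOn (fun x => χ x • G x) D :=
    h.2.1.continuousOn_smul hD.isLocallyClosed hχ.continuous.continuousOn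
  have l2 : LocallyIntegrableOn (fun x => u x • gradient χ x) D :=
    h.1.smul_continuousOn hD.isLocallyClosed (continuous_gradient hχ).continuousOn
  refine ⟨h.1.continuousOn_mul hχ.continuous.continuousOn hD.isLocallyClosed, l1.add l2,
    fun ψ hψ => ?_⟩
  have key := h.2.2 _ (hψ.mul hχ)
  simp_rw [gradient_mul hχ hψ.1] at key
  have i1 := hψ.integrableOn_smul_gradient
    (h.1.continuousOn_mul hχ.continuous.continuousOn hD.isLocallyClosed)
  have i2 := hψ.integrableOn_smul l2
  have i3 := hψ.integrableOn_smul l1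
  have e1 : ∫ x in D, u x • (χ x • gradient ψ x + ψ x • gradient χ x) =
      (∫ x in D, (χ x * u x) • gradient ψ x) + ∫ x in D, ψ x • u x • gradient χ x := by
    rw [← integral_add i1 i2]
    refine integral_congr_ae (Eventually.of_forall fun x => ?_)
    simp only [smul_add, smul_smul]
    rw [mul_comm (u x) (χ x), mul_comm (u x) (ψ x)]
  have e2 : ∫ x in D, ψ x • (χ x • G x + u x • gradient χ x) =
      (∫ x in D, (χ x * ψ x) • G x) + ∫ x in D, ψ x • u x • gradient χ x := by
    rw [← integral_add (i3.congr (Eventually.of_forall fun x => by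
      simp only [smul_smul, mul_comm (χ x)])) i2]
    refine integral_congr_ae (Eventually.of_forall fun x => ?_)
    simp only [smul_add, smul_smul]
    rw [mul_comm (ψ x) (χ x)]
  rw [e1] at key
  rw [e2, neg_add, ← key]
  abel

/-- The products `φ n * κ` are test functions in `D` even if the `φ n` do not vanish near the
boundary. This is how the weak equation gets tested with truncated functions. -/
theorem SmoothApprox.memSobolevZero {D : Set (Eucl N)} (hD : IsOpen D) {p : ℝ} (hp : 1 ≤ p)
    {u : Eucl N → ℝ} {G : Eucl N → Eucl N} {φ : ℕ → Eucl N → ℝ}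
    (h : SmoothApprox D (ENNReal.ofReal p) u G φ) {κ : Eucl N → ℝ} (hκ : IsTestFunction D κ) :
    MemSobolevZero D p (fun x => κ x * u x) (fun x => κ x • G x + u x • gradient κ x) := by
  have hq : 1 ≤ ENNReal.ofReal p := by simpa using ENNReal.ofReal_le_ofReal hp
  obtain ⟨R, -, hR⟩ := hκ.exists_radius
  obtain ⟨C, hC⟩ := hκ.exists_bound
  have hm : MeasurableSet (D ∩ Metric.ball 0 R) :=
    hD.measurableSet.inter Metric.isOpen_ball.measurableSet
  have hκ0 : ∀ x ∉ D ∩ Metric.ball 0 R, κ x = 0 := fun x hx =>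
    image_eq_zero_of_notMem_tsupport fun h => hx (hR h)
  have hκ1 : ∀ x ∉ D ∩ Metric.ball 0 R, gradient κ x = 0 := fun x hx =>
    gradient_eq_zero_of_notMem fun h => hx (hR h)
  have hκc := hκ.1.continuous
  have hκg := continuous_gradient hκ.1
  have hind : ∀ {E : Type} [NormedAddCommGroup E] (f : Eucl N → E),
      (∀ x ∉ D ∩ Metric.ball 0 R, f x = 0) → (D ∩ Metric.ball 0 R).indicator f = f := by
    intro E _ f hf
    exact indicator_eq_self.2 fun x hx => by_contra fun h' => hx (hf x h')
  have heq : ∀ {E : Type} [NormedAddCommGroup E] (f : Eucl N → E),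
      (∀ x ∉ D ∩ Metric.ball 0 R, f x = 0) →
      eLpNorm f (ENNReal.ofReal p) (volume.restrict D) =
        eLpNorm f (ENNReal.ofReal p) (volume.restrict (D ∩ Metric.ball 0 R)) := by
    intro E _ f hf
    conv_lhs => rw [← hind f hf, eLpNorm_indicator_eq_eLpNorm_restrict hm,
      Measure.restrict_restrict hm, inter_assoc, inter_comm _ D, ← inter_assoc, inter_self]
  have hmem : ∀ {E : Type} [NormedAddCommGroup E] (f : Eucl N → E),
      (∀ x ∉ D ∩ Metric.ball 0 R, f x = 0) →
      MemLp f (ENNReal.ofReal p) (volume.restrict (D ∩ Metric.ball 0 R)) →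
      MemLp f (ENNReal.ofReal p) (volume.restrict D) := by
    intro E _ f hf hmf
    rw [← hind f hf, memLp_indicator_iff_restrict hm, Measure.restrict_restrict hm]
    rwa [inter_assoc, inter_comm _ D, ← inter_assoc, inter_self]
  have a1 : MemLp (fun x => κ x • G x) (ENNReal.ofReal p)
      (volume.restrict (D ∩ Metric.ball 0 R)) :=
    (h.memLp_grad R).of_le_mul (c := C) (hκc.aestronglyMeasurable.smul (h.memLp_grad R).1)
      (Eventually.of_forall fun x => by
        rw [norm_smul]; exact mul_le_mul_of_nonneg_right (hC x).1 (norm_nonneg _))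
  have a2 : MemLp (fun x => u x • gradient κ x) (ENNReal.ofReal p)
      (volume.restrict (D ∩ Metric.ball 0 R)) :=
    (h.memLp R).of_le_mul (c := C) ((h.memLp R).1.smul hκg.aestronglyMeasurable)
      (Eventually.of_forall fun x => by
        rw [norm_smul, mul_comm]; exact mul_le_mul_of_nonneg_right (hC x).2 (norm_nonneg _))
  have a3 : MemLp (fun x => κ x * u x) (ENNReal.ofReal p)
      (volume.restrict (D ∩ Metric.ball 0 R)) :=
    (h.memLp R).of_le_mul (c := C) (hκc.aestronglyMeasurable.mul (h.memLp R).1)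
      (Eventually.of_forall fun x => by
        rw [norm_mul]; exact mul_le_mul_of_nonneg_right (hC x).1 (norm_nonneg _))
  refine ⟨hmem _ (fun x hx => by rw [hκ0 x hx, zero_mul]) a3,
    hmem _ (fun x hx => by rw [hκ0 x hx, hκ1 x hx, zero_smul, smul_zero, add_zero]) (a1.add a2),
    fun n x => φ n x * κ x, fun n => hκ.mul (h.smooth n), ?_, ?_⟩
  · refine Tendsto.congr (fun n => (heq _ fun x hx => ?_).symm)
      (tendsto_eLpNorm_zero_of_le_mul C (fun n => Eventually.of_forall fun x => ?_) (h.tendsto R))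
    · simp [hκ0 x hx]
    · change ‖φ n x * κ x - κ x * u x‖ ≤ _
      rw [mul_comm (φ n x), ← mul_sub, norm_mul]
      exact mul_le_mul_of_nonneg_right (hC x).1 (norm_nonneg _)
  · have b1 : Tendsto (fun n => eLpNorm (fun x => κ x • (gradient (φ n) x - G x))
        (ENNReal.ofReal p) (volume.restrict (D ∩ Metric.ball 0 R))) atTop (𝓝 0) :=
      tendsto_eLpNorm_zero_of_le_mul C (fun n => Eventually.of_forall fun x => by
        rw [norm_smul]; exact mul_le_mul_of_nonneg_right (hC x).1 (norm_nonneg _))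
        (h.tendsto_grad R)
    have b2 : Tendsto (fun n => eLpNorm (fun x => (φ n x - u x) • gradient κ x)
        (ENNReal.ofReal p) (volume.restrict (D ∩ Metric.ball 0 R))) atTop (𝓝 0) :=
      tendsto_eLpNorm_zero_of_le_mul C (fun n => Eventually.of_forall fun x => by
        rw [norm_smul, mul_comm]; exact mul_le_mul_of_nonneg_right (hC x).2 (norm_nonneg _))
        (h.tendsto R)
    refine (tendsto_eLpNorm_zero_add hq (fun n => hκc.aestronglyMeasurable.smul
      ((continuous_gradient (h.smooth n)).aestronglyMeasurable.sub (h.memLp_grad R).1))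
      (fun n => ((h.smooth n).continuous.aestronglyMeasurable.sub (h.memLp R).1).smul
        hκg.aestronglyMeasurable) b1 b2).congr fun n => ?_
    rw [heq]
    · congr 1
      ext1 x
      change κ x • (gradient (φ n) x - G x) + (φ n x - u x) • gradient κ x = _
      rw [gradient_mul (h.smooth n) hκ.1, sub_smul, smul_sub]
      change _ = φ n x • gradient κ x + κ x • gradient (φ n) x - (κ x • G x + u x • gradient κ x)
      abel
    · intro x hx
      simp [gradient_mul (h.smooth n) hκ.1, hκ0 x hx, hκ1 x hx]

end WeakGradient

/-! ### Mollification. -/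

section Mollification

variable {E : Type*} [NormedAddCommGroup E] [NormedSpace ℝ E]

/-- The probability measure whose density is the normalized bump function `ρ`. -/
def bumpMeasure (ρ : ContDiffBump (0 : Eucl N)) : Measure (Eucl N) :=
  volume.withDensity fun t => ENNReal.ofReal (ρ.normed volume t)

/-- The convolution of `f` with the normalized bump function `ρ`. -/
def mollify (ρ : ContDiffBump (0 : Eucl N)) (f : Eucl N → E) : Eucl N → E :=
  convolution (ρ.normed volume) f (ContinuousLinearMap.lsmul ℝ ℝ) volume

theorem mollify_apply (ρ : ContDiffBump (0 : Eucl N)) (f : Eucl N → E) (x : Eucl N) :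
    mollify ρ f x = ∫ t, ρ.normed volume t • f (x - t) := rfl

theorem mollify_apply_swap (ρ : ContDiffBump (0 : Eucl N)) (f : Eucl N → E) (x : Eucl N) :
    mollify ρ f x = ∫ t, ρ.normed volume (x - t) • f t :=
  convolution_lsmul_swap

theorem measurable_bump (ρ : ContDiffBump (0 : Eucl N)) :
    Measurable fun t => ENNReal.ofReal (ρ.normed volume t) :=
  ρ.continuous_normed.measurable.ennreal_ofReal

theorem mollify_eq_integral_bumpMeasure (ρ : ContDiffBump (0 : Eucl N)) (f : Eucl N → E)
    (x : Eucl N) : mollify ρ f x = ∫ t, f (x - t) ∂(bumpMeasure ρ) := by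
  rw [mollify_apply, bumpMeasure, integral_withDensity_eq_integral_toReal_smul (measurable_bump ρ)
    (Eventually.of_forall fun _ => ENNReal.ofReal_lt_top)]
  simp_rw [ENNReal.toReal_ofReal (ρ.nonneg_normed _)]

instance isProbabilityMeasure_bumpMeasure (ρ : ContDiffBump (0 : Eucl N)) :
    IsProbabilityMeasure (bumpMeasure ρ) := by
  refine ⟨?_⟩
  rw [bumpMeasure, withDensity_apply _ MeasurableSet.univ, setLIntegral_univ,
    ← ofReal_integral_eq_lintegral_ofReal ρ.integrable_normed
      (Eventually.of_forall ρ.nonneg_normed), ρ.integral_normed, ENNReal.ofReal_one]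

theorem convolutionExistsAt_bump (ρ : ContDiffBump (0 : Eucl N)) {f : Eucl N → E}
    (hf : LocallyIntegrable f) (x : Eucl N) :
    ConvolutionExistsAt (ρ.normed volume) f x (ContinuousLinearMap.lsmul ℝ ℝ) volume :=
  ρ.hasCompactSupport_normed.convolutionExists_left _ ρ.continuous_normed hf x

theorem integrable_bumpMeasure (ρ : ContDiffBump (0 : Eucl N)) {f : Eucl N → E}
    (hf : LocallyIntegrable f) (x : Eucl N) :
    Integrable (fun t => f (x - t)) (bumpMeasure ρ) := by
  rw [bumpMeasure, integrable_withDensity_iff_integrable_smul' (measurable_bump ρ)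
    (Eventually.of_forall fun _ => ENNReal.ofReal_lt_top)]
  simp_rw [ENNReal.toReal_ofReal (ρ.nonneg_normed _)]
  exact convolutionExistsAt_bump ρ hf x

theorem ae_bumpMeasure_mem_ball (ρ : ContDiffBump (0 : Eucl N)) :
    ∀ᵐ t ∂(bumpMeasure ρ), t ∈ Metric.ball (0 : Eucl N) ρ.rOut := by
  rw [bumpMeasure, ae_withDensity_iff (measurable_bump ρ)]
  refine Eventually.of_forall fun t ht => ?_
  rw [← ρ.support_normed_eq (μ := volume)]
  intro h
  exact ht (by rw [h, ENNReal.ofReal_zero])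

/-- Jensen for the probability measure `bumpMeasure ρ`, then Tonelli and translation invariance. -/
theorem lintegral_mollify_le [CompleteSpace E] (ρ : ContDiffBump (0 : Eucl N)) {f : Eucl N → E}
    (hf : LocallyIntegrable f) {Θ : E → ℝ} (hΘ : ConvexOn ℝ univ Θ) (hΘc : Continuous Θ)
    (hΘ0 : ∀ ξ, 0 ≤ Θ ξ) (hint : LocallyIntegrable fun x => Θ (f x)) :
    ∫⁻ x, ENNReal.ofReal (Θ (mollify ρ f x)) ≤ ∫⁻ x, ENNReal.ofReal (Θ (f x)) := by
  have h1 : ∀ x, ENNReal.ofReal (Θ (mollify ρ f x)) ≤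
      ∫⁻ t, ENNReal.ofReal (Θ (f (x - t))) ∂(bumpMeasure ρ) := by
    intro x
    have i1 := integrable_bumpMeasure ρ hint x
    rw [mollify_eq_integral_bumpMeasure, ← ofReal_integral_eq_lintegral_ofReal i1
      (Eventually.of_forall fun _ => hΘ0 _)]
    exact ENNReal.ofReal_le_ofReal (hΘ.map_integral_le hΘc.continuousOn isClosed_univ
      (Eventually.of_forall fun _ => mem_univ _) (integrable_bumpMeasure ρ hf x) i1)
  have hm : AEMeasurable (Function.uncurry fun x t => ENNReal.ofReal (Θ (f (x - t))))
      ((volume : Measure (Eucl N)).prod (bumpMeasure ρ)) := by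
    have := (aestronglyMeasurable_const (b := (1 : ℝ)) (μ := bumpMeasure ρ)).convolution_integrand
      (ContinuousLinearMap.lsmul ℝ ℝ) hint.aestronglyMeasurable
    simpa [Function.uncurry_def] using this.aemeasurable.ennreal_ofReal
  calc ∫⁻ x, ENNReal.ofReal (Θ (mollify ρ f x))
      ≤ ∫⁻ x, ∫⁻ t, ENNReal.ofReal (Θ (f (x - t))) ∂(bumpMeasure ρ) := lintegral_mono h1
    _ = ∫⁻ t, (∫⁻ x, ENNReal.ofReal (Θ (f (x - t)))) ∂(bumpMeasure ρ) := lintegral_lintegral_swap hm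
    _ = ∫⁻ _, (∫⁻ x, ENNReal.ofReal (Θ (f x))) ∂(bumpMeasure ρ) := by
        congr 1
        ext t
        exact lintegral_sub_right_eq_self (fun x => ENNReal.ofReal (Θ (f x))) t
    _ = ∫⁻ x, ENNReal.ofReal (Θ (f x)) := by
        rw [lintegral_const, measure_univ, mul_one]

theorem convexOn_norm_rpow {r : ℝ} (hr : 1 ≤ r) : ConvexOn ℝ univ fun ξ : E => ‖ξ‖ ^ r := by
  refine ⟨convex_univ, fun x _ y _ a b ha hb hab => ?_⟩
  calc ‖a • x + b • y‖ ^ r ≤ (a * ‖x‖ + b * ‖y‖) ^ r := by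
        refine Real.rpow_le_rpow (norm_nonneg _) ?_ (by linarith)
        simpa using (convexOn_norm (convex_univ (𝕜 := ℝ) (E := E))).2 (mem_univ x) (mem_univ y)
          ha hb hab
    _ ≤ a • ‖x‖ ^ r + b • ‖y‖ ^ r := (convexOn_rpow hr).2 (norm_nonneg x) (norm_nonneg y) ha hb hab

theorem eLpNorm_mollify_le [CompleteSpace E] {q : ℝ≥0∞} (hq : 1 ≤ q) (hqt : q ≠ ⊤)
    (ρ : ContDiffBump (0 : Eucl N)) {f : Eucl N → E} (hf : MemLp f q volume) :
    eLpNorm (mollify ρ f) q volume ≤ eLpNorm f q volume := by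
  have hq0 : q ≠ 0 := (zero_lt_one.trans_le hq).ne'
  have hr : 1 ≤ q.toReal := by simpa using ENNReal.toReal_mono hqt hq
  rw [eLpNorm_eq_lintegral_rpow_enorm_toReal hq0 hqt, eLpNorm_eq_lintegral_rpow_enorm_toReal hq0 hqt]
  refine ENNReal.rpow_le_rpow ?_ (by positivity)
  have key := lintegral_mollify_le ρ (hf.locallyIntegrable hq) (convexOn_norm_rpow hr)
    (continuous_norm.rpow_const fun _ => Or.inr (by linarith)) (fun _ => by positivity)
    (hf.integrable_norm_rpow hq0 hqt).locallyIntegrable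
  have e : ∀ ξ : E, ENNReal.ofReal (‖ξ‖ ^ q.toReal) = ‖ξ‖ₑ ^ q.toReal := fun ξ => by
    rw [← ENNReal.ofReal_rpow_of_nonneg (norm_nonneg _) (by linarith), ofReal_norm]
  simpa only [e] using key

theorem mollify_add [CompleteSpace E] (ρ : ContDiffBump (0 : Eucl N)) {f g : Eucl N → E}
    (hf : LocallyIntegrable f) (hg : LocallyIntegrable g) (x : Eucl N) :
    mollify ρ (fun y => f y + g y) x = mollify ρ f x + mollify ρ g x :=
  (convolutionExistsAt_bump ρ hf x).distrib_add (convolutionExistsAt_bump ρ hg x)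

theorem continuous_mollify (ρ : ContDiffBump (0 : Eucl N)) {f : Eucl N → E}
    (hf : LocallyIntegrable f) : Continuous (mollify ρ f) :=
  ρ.hasCompactSupport_normed.continuous_convolution_left _ ρ.continuous_normed hf

theorem contDiff_mollify (ρ : ContDiffBump (0 : Eucl N)) {f : Eucl N → E}
    (hf : LocallyIntegrable f) : ContDiff ℝ ∞ (mollify ρ f) :=
  ρ.hasCompactSupport_normed.contDiff_convolution_left (n := ⊤) _ ρ.contDiff_normed hf

theorem mollify_congr_of_eqOn_ball (ρ : ContDiffBump (0 : Eucl N)) {f g : Eucl N → E}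
    {x : Eucl N} (h : ∀ y ∈ Metric.ball x ρ.rOut, f y = g y) : mollify ρ f x = mollify ρ g x := by
  rw [mollify_eq_integral_bumpMeasure, mollify_eq_integral_bumpMeasure]
  refine integral_congr_ae ?_
  filter_upwards [ae_bumpMeasure_mem_ball ρ] with t ht
  refine h _ ?_
  rw [Metric.mem_ball, dist_eq_norm, sub_sub_cancel_left, norm_neg]
  simpa using ht

/-- An `ε/3` argument: replace `f` by a continuous compactly supported `g`, for which mollification
converges uniformly, hence in `L^q` on the set `S` of finite measure; mollification does not
increase the `L^q` error `f - g`. -/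
theorem tendsto_eLpNorm_mollify_sub [CompleteSpace E] {q : ℝ≥0∞} (hq : 1 ≤ q) (hqt : q ≠ ⊤)
    {ρ : ℕ → ContDiffBump (0 : Eucl N)} (hρ : Tendsto (fun n => (ρ n).rOut) atTop (𝓝 0))
    {f : Eucl N → E} (hf : MemLp f q volume) (S : Set (Eucl N)) (hS : volume S ≠ ⊤) :
    Tendsto (fun n => eLpNorm (fun x => mollify (ρ n) f x - f x) q (volume.restrict S))
      atTop (𝓝 0) := by
  have hq0 : q ≠ 0 := (zero_lt_one.trans_le hq).ne'
  rw [ENNReal.tendsto_nhds_zero]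
  intro ε hε
  rcases eq_or_ne ε ⊤ with rfl | hεt
  · simp
  have hε3 : ε / 3 ≠ 0 := (ENNReal.div_pos hε.ne' (by simp)).ne'
  obtain ⟨g, hgs, hfg, hgc, hgm⟩ := hf.exists_hasCompactSupport_eLpNorm_sub_le hqt hε3
  have hgu : UniformContinuous g := hgs.uniformContinuous_of_continuous hgc
  obtain ⟨δ, hδ0, hδ⟩ : ∃ δ : ℝ, 0 < δ ∧
      ENNReal.ofReal δ * (volume.restrict S) univ ^ q.toReal⁻¹ ≤ ε / 3 := by
    set V := (volume.restrict S) univ ^ q.toReal⁻¹ with hV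
    have hVt : V ≠ ⊤ := by
      rw [hV, Measure.restrict_apply_univ]
      exact ENNReal.rpow_ne_top_of_nonneg (by positivity) hS
    have hε3t : ε / 3 ≠ ⊤ := (ENNReal.div_lt_top hεt (by simp)).ne
    -- A uniform error `δ` costs `δ * V` in `L^q(S)`; the added `1` covers the case `V = 0`.
    refine ⟨(ε / 3).toReal / (V.toReal + 1), div_pos (ENNReal.toReal_pos hε3 hε3t)
      (by positivity), ?_⟩
    rw [← ENNReal.ofReal_toReal hVt, ← ENNReal.ofReal_mul (by positivity),
      ENNReal.ofReal_le_iff_le_toReal hε3t, div_mul_eq_mul_div, ENNReal.toReal_ofReal (by positivity),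
      div_le_iff₀ (by positivity)]
    exact mul_le_mul_of_nonneg_left (by linarith) (by positivity)
  obtain ⟨r, hr0, hr⟩ := Metric.uniformContinuous_iff.1 hgu δ hδ0
  filter_upwards [hρ.eventually (gt_mem_nhds hr0)] with n hn
  have lf := hf.locallyIntegrable hq
  have lg := hgm.locallyIntegrable hq
  have hfgm : MemLp (fun x => f x - g x) q volume := hf.sub hgm
  have lfg := hfgm.locallyIntegrable hq
  have e1 : ∀ x, mollify (ρ n) f x - f x =
      (mollify (ρ n) (fun y => f y - g y) x + (mollify (ρ n) g x - g x)) + (g x - f x) := by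
    intro x
    have := mollify_add (ρ n) lfg lg x
    simp only [sub_add_cancel] at this
    rw [this]
    abel
  simp_rw [e1]
  have a1 : eLpNorm (mollify (ρ n) fun y => f y - g y) q (volume.restrict S) ≤ ε / 3 :=
    (eLpNorm_mono_measure _ Measure.restrict_le_self).trans
      ((eLpNorm_mollify_le hq hqt _ hfgm).trans hfg)
  have a2 : eLpNorm (fun x => mollify (ρ n) g x - g x) q (volume.restrict S) ≤ ε / 3 := by
    refine (eLpNorm_le_of_ae_bound (C := δ) (Eventually.of_forall fun x => ?_)).trans
      ((mul_comm _ _).trans_le hδ)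
    rw [← dist_eq_norm]
    refine ContDiffBump.dist_normed_convolution_le lg.aestronglyMeasurable fun y hy => ?_
    exact (hr ((Metric.mem_ball.1 hy).trans hn)).le
  have a3 : eLpNorm (fun x => g x - f x) q (volume.restrict S) ≤ ε / 3 := by
    refine (eLpNorm_mono_measure _ Measure.restrict_le_self).trans ?_
    refine le_trans (le_of_eq ?_) hfg
    exact eLpNorm_sub_comm g f q volume
  have m1 := (continuous_mollify (ρ n) lfg).aestronglyMeasurable (μ := volume.restrict S)
  have m2 : AEStronglyMeasurable (fun x => mollify (ρ n) g x - g x) (volume.restrict S) :=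
    ((continuous_mollify (ρ n) lg).sub hgc).aestronglyMeasurable
  have m3 : AEStronglyMeasurable (fun x => g x - f x) (volume.restrict S) :=
    (hgc.aestronglyMeasurable.sub hf.1).restrict
  calc _ ≤ _ := eLpNorm_add_le (m1.add m2) m3 hq
    _ ≤ _ := add_le_add_left (eLpNorm_add_le m1 m2 hq) _
    _ ≤ ε / 3 + ε / 3 + ε / 3 := add_le_add (add_le_add a1 a2) a3
    _ = ε := ENNReal.add_thirds ε

/-- On the ball of radius `R`, mollification at scale below `1` sees only the values on the ball of
radius `R + 1`, so `f` may be truncated there. -/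
theorem tendsto_eLpNorm_mollify_sub_ball [CompleteSpace E] {q : ℝ≥0∞} (hq : 1 ≤ q) (hqt : q ≠ ⊤)
    {ρ : ℕ → ContDiffBump (0 : Eucl N)} (hρ : Tendsto (fun n => (ρ n).rOut) atTop (𝓝 0))
    {f : Eucl N → E} (hf : ∀ R : ℝ, MemLp f q (volume.restrict (univ ∩ Metric.ball 0 R))) (R : ℝ) :
    Tendsto (fun n => eLpNorm (fun x => mollify (ρ n) f x - f x) q
      (volume.restrict (univ ∩ Metric.ball 0 R))) atTop (𝓝 0) := by
  simp only [univ_inter] at hf ⊢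
  set g := (Metric.ball (0 : Eucl N) (R + 1)).indicator f with hg
  have hgm : MemLp g q volume :=
    (memLp_indicator_iff_restrict Metric.isOpen_ball.measurableSet).2 (hf _)
  refine (tendsto_eLpNorm_mollify_sub hq hqt hρ hgm (Metric.ball 0 R)
    measure_ball_lt_top.ne).congr' ?_
  filter_upwards [hρ.eventually (gt_mem_nhds one_pos)] with n hn
  refine eLpNorm_congr_ae ?_
  filter_upwards [ae_restrict_mem Metric.isOpen_ball.measurableSet] with x hx
  have hx' : ‖x‖ < R := by simpa using hx
  have hgf : ∀ y ∈ Metric.ball x 1, g y = f y := fun y hy => by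
    refine indicator_of_mem ?_ _
    have h1 : ‖y - x‖ < 1 := by simpa [dist_eq_norm] using hy
    have h2 := norm_add_le (y - x) x
    rw [sub_add_cancel] at h2
    rw [mem_ball_zero_iff]
    linarith
  rw [mollify_congr_of_eqOn_ball (ρ n) fun y hy => hgf y (Metric.ball_subset_ball hn.le hy),
    hgf x (Metric.mem_ball_self one_pos)]

theorem HasWeakGradient.locallyIntegrable {u : Eucl N → ℝ} {G : Eucl N → Eucl N}
    (h : HasWeakGradient univ u G) : LocallyIntegrable u ∧ LocallyIntegrable G :=
  ⟨locallyIntegrableOn_univ.1 h.1, locallyIntegrableOn_univ.1 h.2.1⟩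

/-- The derivative falls on the kernel, and the weak gradient tested with `y ↦ ρ (x - y)` carries it
over to `u`; the sign of the inner derivative cancels that of the integration by parts. -/
theorem HasWeakGradient.hasGradientAt_mollify {u : Eucl N → ℝ} {G : Eucl N → Eucl N}
    (h : HasWeakGradient univ u G) (ρ : ContDiffBump (0 : Eucl N)) (x : Eucl N) :
    HasGradientAt (mollify ρ u) (mollify ρ G x) x := by
  set r := ρ.normed (volume : Measure (Eucl N)) with hr
  have hrs : ContDiff ℝ ∞ r := ρ.contDiff_normed (n := ⊤)
  set ψ : Eucl N → ℝ := fun y => r (x - y) with hψ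
  have hψt : IsTestFunction univ ψ := by
    refine ⟨hrs.comp (contDiff_const.sub contDiff_id), ?_, subset_univ _⟩
    exact ρ.hasCompactSupport_normed.comp_homeomorph (Homeomorph.subLeft x)
  have hψg : ∀ y, gradient ψ y = -gradient r (x - y) := by
    intro y
    refine HasGradientAt.gradient (hasGradientAt_of_hasFDerivAt_inner ?_)
    have h1 := HasGradientAt.hasFDerivAt_inner (hasGradientAt_of_contDiff hrs (x - y))
    refine (h1.comp y ((hasFDerivAt_id y).const_sub x)).congr_fderiv ?_
    ext v
    simp
  have key := h.2.2 ψ hψt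
  simp only [setIntegral_univ, hψg, smul_neg, integral_neg, neg_inj] at key
  have hfd := ρ.hasCompactSupport_normed.hasFDerivAt_convolution_left
    (ContinuousLinearMap.lsmul ℝ ℝ) (μ := volume) (hrs.of_le (by simp)) h.locallyIntegrable.1 x
  rw [hasGradientAt_iff_hasFDerivAt]
  refine hfd.congr_fderiv ?_
  have hce := (ρ.hasCompactSupport_normed.fderiv ℝ).convolutionExists_left
    (ContinuousLinearMap.precompL (Eucl N) (ContinuousLinearMap.lsmul ℝ ℝ)) (μ := volume)
    (hrs.continuous_fderiv (by simp)) h.locallyIntegrable.1 x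
  have hiu : Integrable fun y => u y • gradient r (x - y) := by
    have := (hψt.integrableOn_smul_gradient h.1).neg
    rw [IntegrableOn, Measure.restrict_univ] at this
    refine this.congr (Eventually.of_forall fun y => ?_)
    simp [hψg]
  rw [mollify_apply_swap, ← key, convolution_eq_swap]
  ext v
  rw [ContinuousLinearMap.integral_apply hce.integrable_swap, InnerProductSpace.toDual_apply_apply,
    real_inner_comm, ← integral_inner hiu]
  refine integral_congr_ae (Eventually.of_forall fun y => ?_)
  simp only [ContinuousLinearMap.precompL_apply, ContinuousLinearMap.lsmul_apply,
    inner_smul_right, smul_eq_mul]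
  rw [real_inner_comm, inner_gradient_left, mul_comm]

/-- A fixed sequence of bump functions shrinking to the origin. -/
def shrinkingBump (N : ℕ) (n : ℕ) : ContDiffBump (0 : Eucl N) where
  rIn := 1 / (2 * (n + 1))
  rOut := 1 / (n + 1)
  rIn_pos := by positivity
  rIn_lt_rOut := by
    apply one_div_lt_one_div_of_lt
    · positivity
    · have : (0 : ℝ) ≤ n := n.cast_nonneg
      linarith

theorem tendsto_shrinkingBump : Tendsto (fun n => (shrinkingBump N n).rOut) atTop (𝓝 0) :=
  tendsto_one_div_add_atTop_nhds_zero_nat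

theorem HasWeakGradient.smoothApprox {u : Eucl N → ℝ} {G : Eucl N → Eucl N} {q : ℝ≥0∞}
    (hq : 1 ≤ q) (hqt : q ≠ ⊤) (h : HasWeakGradient univ u G)
    (hu : ∀ R : ℝ, MemLp u q (volume.restrict (univ ∩ Metric.ball 0 R)))
    (hG : ∀ R : ℝ, MemLp G q (volume.restrict (univ ∩ Metric.ball 0 R))) :
    SmoothApprox univ q u G (fun n => mollify (shrinkingBump N n) u) := by
  refine ⟨fun n => contDiff_mollify _ h.locallyIntegrable.1, hu, hG,
    tendsto_eLpNorm_mollify_sub_ball hq hqt tendsto_shrinkingBump hu, fun R => ?_⟩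
  simp_rw [(h.hasGradientAt_mollify _ _).gradient]
  exact tendsto_eLpNorm_mollify_sub_ball hq hqt tendsto_shrinkingBump hG R

/-- The mollifications have zero gradient, so they are constants, and they converge to `u` a.e. -/
theorem HasWeakGradient.exists_ae_eq_const {u : Eucl N → ℝ}
    (h : HasWeakGradient univ u fun _ => 0) : ∃ c : ℝ, ∀ᵐ x, u x = c := by
  have hlim := ContDiffBump.ae_convolution_tendsto_right_of_locallyIntegrable
    (φ := shrinkingBump N) (l := atTop) (K := 2) (μ := volume) tendsto_shrinkingBump
    (Eventually.of_forall fun n => le_of_eq (by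
      simp only [shrinkingBump]
      field_simp)) h.locallyIntegrable.1
  obtain ⟨x₀, hx₀⟩ := hlim.exists
  have hconst : ∀ n x, mollify (shrinkingBump N n) u x = mollify (shrinkingBump N n) u x₀ := by
    intro n x
    refine is_const_of_fderiv_eq_zero (𝕜 := ℝ)
      ((contDiff_mollify _ h.locallyIntegrable.1).differentiable (by simp)) (fun y => ?_) x x₀
    have := HasGradientAt.hasFDerivAt_inner (h.hasGradientAt_mollify (shrinkingBump N n) y)
    rw [this.fderiv, mollify_apply]
    simp
  refine ⟨u x₀, hlim.mono fun x hx => ?_⟩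
  exact tendsto_nhds_unique (hx.congr fun n => hconst n x) hx₀

end Mollification

/-! ### Cutoffs along level sets of a Lipschitz function. -/

section Cutoff

theorem exists_bound_deriv_smoothTransition :
    ∃ C : ℝ, 0 < C ∧ ∀ x, |deriv Real.smoothTransition x| ≤ C := by
  have hc : Continuous (deriv Real.smoothTransition) :=
    (Real.smoothTransition.contDiff (n := ⊤)).continuous_deriv (by simp)
  obtain ⟨C, hC⟩ := (isCompact_Icc (a := (0 : ℝ)) (b := 1)).exists_bound_of_continuousOn
    hc.continuousOn
  refine ⟨max C 1, by positivity, fun x => ?_⟩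
  rcases lt_or_ge x 0 with hx | hx
  · have : Real.smoothTransition =ᶠ[𝓝 x] fun _ => 0 := by
      filter_upwards [gt_mem_nhds hx] with y hy using Real.smoothTransition.zero_of_nonpos hy.le
    rw [this.deriv_eq, deriv_const, abs_zero]
    positivity
  rcases lt_or_ge 1 x with hx' | hx'
  · have : Real.smoothTransition =ᶠ[𝓝 x] fun _ => 1 := by
      filter_upwards [lt_mem_nhds hx'] with y hy using Real.smoothTransition.one_of_one_le hy.le
    rw [this.deriv_eq, deriv_const, abs_zero]
    positivity
  · exact (hC x ⟨hx, hx'⟩).trans (le_max_left _ _)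

theorem contDiff_smoothTransition : ContDiff ℝ ∞ Real.smoothTransition :=
  Real.smoothTransition.contDiff (n := ⊤)

theorem lipschitzWith_mollify (ρ : ContDiffBump (0 : Eucl N)) {d : Eucl N → ℝ}
    (hd : LipschitzWith 1 d) : LipschitzWith 1 (mollify ρ d) := by
  have hl : LocallyIntegrable d := hd.continuous.locallyIntegrable
  refine LipschitzWith.of_dist_le_mul fun x y => ?_
  rw [dist_eq_norm, mollify_eq_integral_bumpMeasure, mollify_eq_integral_bumpMeasure,
    ← integral_sub (integrable_bumpMeasure ρ hl x) (integrable_bumpMeasure ρ hl y)]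
  refine (norm_integral_le_of_norm_le_const (C := dist x y)
    (Eventually.of_forall fun t => ?_)).trans ?_
  · have := hd.dist_le_mul (x - t) (y - t)
    rwa [NNReal.coe_one, one_mul, dist_sub_right, dist_eq_norm] at this
  · simp

/-- Smooth cutoff along the levels of a `1`-Lipschitz function `d`: it vanishes where `d ≤ ε / 4`
and equals `1` where `ε ≤ d`. -/
structure IsCutoff (d : Eucl N → ℝ) (ε C : ℝ) (χ : Eucl N → ℝ) : Prop where
  smooth : ContDiff ℝ ∞ χ
  nonneg : ∀ x, 0 ≤ χ x
  le_one : ∀ x, χ x ≤ 1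
  eq_zero : ∀ x, d x ≤ ε / 4 → χ x = 0
  eq_one : ∀ x, ε ≤ d x → χ x = 1
  gradient_le : ∀ x, ‖gradient χ x‖ ≤ C / ε

theorem IsCutoff.gradient_eq_zero {d : Eucl N → ℝ} {ε C : ℝ} {χ : Eucl N → ℝ}
    (h : IsCutoff d ε C χ) (hd : Continuous d) {x : Eucl N} (hx : ε < d x) :
    gradient χ x = 0 := by
  have : χ =ᶠ[𝓝 x] fun _ => 1 := by
    filter_upwards [hd.continuousAt.eventually (lt_mem_nhds hx)] with y hy using h.eq_one y hy.le
  rw [this.gradient_eq, gradient, fderiv_const_apply, map_zero]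

/-- The constant depends neither on the dimension, nor on `d`, nor on `ε`. It serves both for the
distance to the complement (near the boundary) and for the norm (at infinity). -/
theorem exists_isCutoff : ∃ C : ℝ, 0 < C ∧ ∀ (N : ℕ) (d : Eucl N → ℝ), LipschitzWith 1 d →
    ∀ ε : ℝ, 0 < ε → ∃ χ, IsCutoff d ε C χ := by
  obtain ⟨C, hC0, hC⟩ := exists_bound_deriv_smoothTransition
  refine ⟨4 * C, by positivity, fun N d hd ε hε => ?_⟩
  -- At this radius the mollified `d` differs from `d` by at most `ε / 4`. It is thus at most `ε /
  -- 2` where `d ≤ ε / 4` and at least `3 ε / 4` where `ε ≤ d`, and `t ↦ 4 t / ε - 2` sends these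
  -- levels to `0` and `1`.
  let ρ : ContDiffBump (0 : Eucl N) := ⟨ε / 8, ε / 4, by positivity, by linarith⟩
  have hl : LocallyIntegrable d := hd.continuous.locallyIntegrable
  have hclose : ∀ x, |mollify ρ d x - d x| ≤ ε / 4 := fun x => by
    refine ContDiffBump.dist_normed_convolution_le hl.aestronglyMeasurable fun y hy => ?_
    have h1 := hd.dist_le_mul y x
    rw [NNReal.coe_one, one_mul] at h1
    exact h1.trans (Metric.mem_ball.1 hy).le
  have hsm : ContDiff ℝ ∞ (mollify ρ d) := contDiff_mollify ρ hl
  have harg : ContDiff ℝ ∞ fun x => 4 / ε * mollify ρ d x - 2 :=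
    (contDiff_const.mul hsm).sub contDiff_const
  refine ⟨fun x => Real.smoothTransition (4 / ε * mollify ρ d x - 2),
    contDiff_smoothTransition.comp harg, fun x => Real.smoothTransition.nonneg _,
    fun x => Real.smoothTransition.le_one _, fun x hx => ?_, fun x hx => ?_, fun x => ?_⟩
  · refine Real.smoothTransition.zero_of_nonpos ?_
    have h1 := (abs_le.1 (hclose x)).2
    rw [sub_nonpos, div_mul_eq_mul_div, div_le_iff₀ hε]
    linarith
  · refine Real.smoothTransition.one_of_one_le ?_
    have h1 := (abs_le.1 (hclose x)).1
    rw [le_sub_iff_add_le, div_mul_eq_mul_div, le_div_iff₀ hε]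
    linarith
  · rw [norm_gradient_eq]
    have h1 : HasDerivAt Real.smoothTransition
        (deriv Real.smoothTransition (4 / ε * mollify ρ d x - 2)) (4 / ε * mollify ρ d x - 2) :=
      (contDiff_smoothTransition.differentiable (by simp) _).hasDerivAt
    have h2 : HasFDerivAt (mollify ρ d) (fderiv ℝ (mollify ρ d) x) x :=
      (hsm.differentiable (by simp) x).hasFDerivAt
    have h3 := h1.comp_hasFDerivAt x ((h2.const_mul (4 / ε)).sub_const 2)
    have h4 : ‖fderiv ℝ (mollify ρ d) x‖ ≤ 1 := by
      simpa using norm_fderiv_le_of_lipschitz ℝ (lipschitzWith_mollify ρ hd) (x₀ := x)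
    have h5 : fderiv ℝ (fun x => Real.smoothTransition (4 / ε * mollify ρ d x - 2)) x = _ :=
      h3.fderiv
    rw [h5, norm_smul, norm_smul, Real.norm_eq_abs, Real.norm_of_nonneg (by positivity)]
    calc _ ≤ C * (4 / ε * 1) := by gcongr; exact hC _
      _ = 4 * C / ε := by ring

end Cutoff

/-! ### Differences along segments controlled by the gradient. -/

section Translation

theorem lintegral_rpow_le {α : Type*} [MeasurableSpace α] {μ : Measure α} {p : ℝ} (hp : 1 < p)
    {a : α → ℝ≥0∞} (ha : AEMeasurable a μ) :
    (∫⁻ x, a x ∂μ) ^ p ≤ μ univ ^ (p - 1) * ∫⁻ x, a x ^ p ∂μ := by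
  have hpq := Real.HolderConjugate.conjExponent hp
  have h1 := ENNReal.lintegral_mul_le_Lp_mul_Lq μ hpq ha (aemeasurable_const (b := (1 : ℝ≥0∞)))
  have hp0 : p ≠ 0 := by linarith
  simp only [Pi.mul_apply, mul_one, ENNReal.one_rpow, lintegral_const, one_mul] at h1
  calc _ ≤ ((∫⁻ x, a x ^ p ∂μ) ^ (1 / p) * μ univ ^ (1 / p.conjExponent)) ^ p :=
        ENNReal.rpow_le_rpow h1 (by linarith)
    _ = _ := by
        rw [ENNReal.mul_rpow_of_nonneg _ _ (by linarith), ← ENNReal.rpow_mul, ← ENNReal.rpow_mul,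
          one_div_mul_cancel hp0, ENNReal.rpow_one, mul_comm]
        congr 2
        rw [Real.conjExponent]
        have : p - 1 ≠ 0 := by linarith
        field_simp

theorem enorm_sub_translate_le {f : Eucl N → ℝ} (hf : ContDiff ℝ ∞ f) {e : Eucl N}
    (he : ‖e‖ = 1) (y : Eucl N) {t : ℝ} (ht : 0 ≤ t) :
    ‖f y - f (y - t • e)‖ₑ ≤ ∫⁻ s in Ioc 0 t, ‖gradient f (y - s • e)‖ₑ := by
  have hd : ∀ s, HasDerivAt (fun s : ℝ => f (y - s • e)) (-inner ℝ (gradient f (y - s • e)) e) s := by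
    intro s
    have h1 := HasGradientAt.hasFDerivAt_inner (hasGradientAt_of_contDiff hf (y - s • e))
    have h2 : HasDerivAt (fun s : ℝ => y - s • e) (-((1 : ℝ) • e)) s :=
      ((hasDerivAt_id s).smul_const e).const_sub y
    have h3 := h1.comp_hasDerivAt s h2
    refine HasDerivAt.congr_deriv h3 ?_
    simp
  have hcont : Continuous fun s : ℝ => -inner ℝ (gradient f (y - s • e)) e := by
    have := continuous_gradient hf
    fun_prop
  have hftc := intervalIntegral.integral_eq_sub_of_hasDerivAt (fun s _ => hd s)
    (hcont.intervalIntegrable 0 t)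
  rw [← enorm_neg, neg_sub]
  simp only [zero_smul, sub_zero] at hftc
  rw [← hftc, intervalIntegral.integral_of_le ht]
  refine (enorm_integral_le_lintegral_enorm _).trans (lintegral_mono fun s => ?_)
  rw [enorm_neg, enorm_le_iff_norm_le]
  simpa [he] using norm_inner_le_norm (𝕜 := ℝ) (gradient f (y - s • e)) e

/-- The fundamental theorem of calculus on the segment, Hölder in the length variable, then Tonelli
and translation invariance. The shift `τ` may vary with the point. -/
theorem lintegral_sub_translate_le {p : ℝ} (hp : 1 < p) {f : Eucl N → ℝ} (hf : ContDiff ℝ ∞ f)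
    {e : Eucl N} (he : ‖e‖ = 1) {S S' : Set (Eucl N)} (hS : MeasurableSet S)
    (hS' : MeasurableSet S') {L : ℝ} {τ : Eucl N → ℝ} (hτ0 : ∀ y ∈ S, 0 ≤ τ y)
    (hτL : ∀ y ∈ S, τ y ≤ L) (hseg : ∀ y ∈ S, ∀ s ∈ Ioo 0 (τ y), y - s • e ∈ S') :
    ∫⁻ y in S, ‖f y - f (y - τ y • e)‖ₑ ^ p ≤
      ENNReal.ofReal L ^ p * ∫⁻ y in S', ‖gradient f y‖ₑ ^ p := by
  have hp0 : 0 < p := by linarith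
  -- Cutting the gradient off outside `S'` allows the interval `(0, τ y)` to be enlarged to the
  -- fixed `(0, L]`. No change of variables involving `τ` is then needed.
  set g : Eucl N → ℝ≥0∞ := S'.indicator fun y => ‖gradient f y‖ₑ with hg
  have hgm : Measurable g := ((continuous_gradient hf).enorm.measurable).indicator hS'
  have hgp : ∀ y, g y ^ p = S'.indicator (fun y => ‖gradient f y‖ₑ ^ p) y := by
    intro y
    by_cases hy : y ∈ S'
    · simp [hg, hy]
    · simp [hg, hy, hp0]
  have hms : Measurable fun z : Eucl N × ℝ => g (z.1 - z.2 • e) ^ p := by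
    refine (hgm.comp ?_).pow_const p
    fun_prop
  have h1 : ∀ y ∈ S, ‖f y - f (y - τ y • e)‖ₑ ^ p ≤
      ENNReal.ofReal L ^ (p - 1) * ∫⁻ s in Ioc 0 L, g (y - s • e) ^ p := by
    intro y hy
    have h2 : ‖f y - f (y - τ y • e)‖ₑ ≤ ∫⁻ s in Ioc 0 L, g (y - s • e) := by
      refine (enorm_sub_translate_le hf he y (hτ0 y hy)).trans ?_
      rw [← restrict_Ioo_eq_restrict_Ioc]
      calc _ = ∫⁻ s in Ioo 0 (τ y), g (y - s • e) := by
            refine setLIntegral_congr_fun measurableSet_Ioo fun s hs => ?_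
            simp [hg, hseg y hy s hs]
        _ ≤ _ := lintegral_mono_set
            (Ioo_subset_Ioc_self.trans (Ioc_subset_Ioc_right (hτL y hy)))
    refine (ENNReal.rpow_le_rpow h2 hp0.le).trans ?_
    refine (lintegral_rpow_le hp ?_).trans_eq ?_
    · exact (hgm.comp (by fun_prop)).aemeasurable
    · rw [Measure.restrict_apply_univ, Real.volume_Ioc, sub_zero]
  calc ∫⁻ y in S, ‖f y - f (y - τ y • e)‖ₑ ^ p
      ≤ ∫⁻ y in S, ENNReal.ofReal L ^ (p - 1) * ∫⁻ s in Ioc 0 L, g (y - s • e) ^ p :=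
        setLIntegral_mono' hS h1
    _ ≤ ∫⁻ y, ENNReal.ofReal L ^ (p - 1) * ∫⁻ s in Ioc 0 L, g (y - s • e) ^ p :=
        setLIntegral_le_lintegral _ _
    _ = ENNReal.ofReal L ^ (p - 1) * ∫⁻ y, ∫⁻ s in Ioc 0 L, g (y - s • e) ^ p := by
        rw [lintegral_const_mul]
        exact hms.lintegral_prod_right'
    _ = ENNReal.ofReal L ^ (p - 1) * ∫⁻ s in Ioc 0 L, ∫⁻ y, g (y - s • e) ^ p := by
        rw [lintegral_lintegral_swap hms.aemeasurable]
    _ = ENNReal.ofReal L ^ (p - 1) * ∫⁻ s in Ioc 0 L, ∫⁻ y, g y ^ p := by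
        congr 2
        ext s
        exact lintegral_sub_right_eq_self (fun y => g y ^ p) _
    _ = ENNReal.ofReal L ^ p * ∫⁻ y in S', ‖gradient f y‖ₑ ^ p := by
        rw [lintegral_const, Measure.restrict_apply_univ, Real.volume_Ioc, sub_zero,
          mul_comm (∫⁻ y, g y ^ p), ← mul_assoc]
        congr 1
        · conv_lhs => rw [← ENNReal.rpow_one (ENNReal.ofReal L), ← ENNReal.rpow_mul]
          rw [← ENNReal.rpow_add_of_nonneg _ _ (by linarith) (by norm_num)]
          congr 1
          ring
        · simp_rw [hgp]
          rw [lintegral_indicator hS']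

end Translation

/-! ### Strips above a Lipschitz graph. -/

section Graph

/-- The height of `y` above the graph of `γ` over the hyperplane orthogonal to `e`. -/
def graphHeight (e : Eucl N) (γ : Eucl N → ℝ) (y : Eucl N) : ℝ :=
  inner ℝ e y - γ (y - inner ℝ e y • e)

/-- The projection of `y` onto the graph of `γ` along `e`. -/
def graphFoot (e : Eucl N) (γ : Eucl N → ℝ) (y : Eucl N) : Eucl N :=
  y - graphHeight e γ y • e

variable {e : Eucl N} {γ : Eucl N → ℝ} {K : NNReal}

theorem graphHeight_sub_smul (he : ‖e‖ = 1) (y : Eucl N) (s : ℝ) :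
    graphHeight e γ (y - s • e) = graphHeight e γ y - s := by
  have h1 : inner ℝ e (y - s • e) = inner ℝ e y - s := by
    rw [inner_sub_right, inner_smul_right, real_inner_self_eq_norm_sq, he]
    ring
  rw [graphHeight, graphHeight, h1, sub_smul]
  have : y - s • e - (inner ℝ e y • e - s • e) = y - inner ℝ e y • e := by abel
  rw [this]
  ring

theorem abs_graphHeight_sub_le (he : ‖e‖ = 1) (hγ : LipschitzWith K γ) (y z : Eucl N) :
    |graphHeight e γ y - graphHeight e γ z| ≤ (1 + K) * ‖y - z‖ := by
  have h1 : |inner ℝ e y - inner ℝ e z| ≤ ‖y - z‖ := by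
    rw [← inner_sub_right]
    simpa [he] using abs_real_inner_le_norm e (y - z)
  have h2 : ‖(y - inner ℝ e y • e) - (z - inner ℝ e z • e)‖ ≤ ‖y - z‖ := by
    have e1 : (y - inner ℝ e y • e) - (z - inner ℝ e z • e) =
        (y - z) - inner ℝ e (y - z) • e := by
      rw [inner_sub_right, sub_smul]
      abel
    rw [e1]
    refine le_of_sq_le_sq ?_ (norm_nonneg _) |> fun h => h
    rw [@norm_sub_sq_real, inner_smul_right, norm_smul, he, real_inner_comm, Real.norm_eq_abs,
      mul_one, sq_abs]
    nlinarith [sq_nonneg (inner ℝ e (y - z))]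
  have h3 := hγ.dist_le_mul (y - inner ℝ e y • e) (z - inner ℝ e z • e)
  rw [Real.dist_eq, dist_eq_norm] at h3
  have h4 : (K : ℝ) * ‖(y - inner ℝ e y • e) - (z - inner ℝ e z • e)‖ ≤ K * ‖y - z‖ :=
    mul_le_mul_of_nonneg_left h2 K.2
  rw [graphHeight, graphHeight, sub_sub_sub_comm]
  refine (abs_sub _ _).trans ?_
  linarith

theorem continuous_graphHeight (hγ : LipschitzWith K γ) :
    Continuous (graphHeight e γ) := by
  have := hγ.continuous
  unfold graphHeight
  fun_prop

theorem continuous_graphFoot (hγ : LipschitzWith K γ) :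
    Continuous (graphFoot e γ) := by
  have := hγ.continuous
  unfold graphFoot graphHeight
  fun_prop

/-- By Fubini the strip has volume `L` times the Lebesgue measure of its shadow on the hyperplane
orthogonal to `e`. The projection along `e` is `1`-Lipschitz and leaves the shadow of the foot
unchanged, so that measure is at most the Hausdorff measure of `A`. -/
theorem volume_graph_strip_le {n : ℕ} {e : Eucl (n + 1)} {γ : Eucl (n + 1) → ℝ} (he : ‖e‖ = 1)
    (hγ : LipschitzWith K γ) (L : ℝ) (A : Set (Eucl (n + 1))) :
    volume {y | graphHeight e γ y ∈ Ioo 0 L ∧ graphFoot e γ y ∈ A} ≤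
      ENNReal.ofReal L * Measure.hausdorffMeasure (n : ℝ) A := by
  have hv : Orthonormal ℝ (({0} : Set (Fin (n + 1))).domRestrict fun _ => e) := by
    refine ⟨fun _ => he, fun i j hij => ?_⟩
    exact absurd (Subtype.ext (i.2.trans j.2.symm)) hij
  obtain ⟨b, hb⟩ := hv.exists_orthonormalBasis_extension_of_card_eq (by simp)
  have hb0 : b 0 = e := hb 0 rfl
  set P : Eucl (n + 1) → (Fin n → ℝ) := fun y i => b.repr y i.succ with hP
  have hPlip : LipschitzWith 1 P := by
    refine LipschitzWith.of_dist_le_mul fun y z => ?_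
    rw [NNReal.coe_one, one_mul, dist_pi_le_iff dist_nonneg]
    intro i
    rw [dist_eq_norm, dist_eq_norm, ← b.repr.norm_map (y - z), map_sub]
    exact PiLp.norm_apply_le (b.repr y - b.repr z) i.succ
  set γ' : (Fin n → ℝ) → ℝ := fun a => γ (∑ i, a i • b i.succ) with hγ'
  have hγ'c : Continuous γ' := by
    have := hγ.continuous
    fun_prop
  have hproj : ∀ y, y - inner ℝ e y • e = ∑ i, P y i • b i.succ := by
    intro y
    have h1 := b.sum_repr y
    rw [Fin.sum_univ_succ, hb0, b.repr_apply_apply, hb0] at h1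
    exact sub_eq_iff_eq_add'.2 h1.symm
  have hheight : ∀ y, graphHeight e γ y = b.repr y 0 - γ' (P y) := by
    intro y
    rw [graphHeight, hproj, b.repr_apply_apply, hb0]
  have hfoot : ∀ y, P (graphFoot e γ y) = P y := by
    intro y
    ext i
    simp only [hP, graphFoot, map_sub, map_smul, ← hb0]
    simp [OrthonormalBasis.repr_self]
  -- The shadow of `A` need not be measurable, so a measurable hull of equal measure replaces it.
  set B : Set (Fin n → ℝ) := toMeasurable volume (P '' A) with hB
  have hBm : MeasurableSet B := measurableSet_toMeasurable _ _
  have hBvol : volume B ≤ Measure.hausdorffMeasure (n : ℝ) A := by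
    rw [hB, measure_toMeasurable, ← hausdorffMeasure_pi_real, Fintype.card_fin]
    simpa using hPlip.hausdorffMeasure_image_le (d := (n : ℝ)) (by positivity) A
  set W : Set (ℝ × (Fin n → ℝ)) := {w | w.2 ∈ B ∧ w.1 - γ' w.2 ∈ Ioo 0 L} with hW
  have hWm : MeasurableSet W := by
    refine (measurable_snd hBm).inter ?_
    exact (measurable_fst.sub (hγ'c.measurable.comp measurable_snd)) measurableSet_Ioo
  have hWvol : volume W = ENNReal.ofReal L * volume B := by
    rw [Measure.volume_eq_prod, Measure.prod_apply_symm hWm]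
    -- Over each point of `B` the fibre is an open interval of length `L`.
    have : ∀ a, volume ((fun t => (t, a)) ⁻¹' W) = B.indicator (fun _ => ENNReal.ofReal L) a := by
      intro a
      by_cases ha : a ∈ B
      · have e1 : (fun t => (t, a)) ⁻¹' W = Ioo (γ' a) (γ' a + L) := by
          ext t
          simp only [hW, mem_preimage, mem_ofPred_eq, ha, true_and, mem_Ioo, sub_pos]
          constructor <;> rintro ⟨h1, h2⟩ <;> exact ⟨h1, by linarith⟩
        rw [e1, Real.volume_Ioo, indicator_of_mem ha]
        congr 1
        ring
      · have e1 : (fun t => (t, a)) ⁻¹' W = ∅ := by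
          ext t
          simp [hW, ha]
        rw [e1, measure_empty, indicator_of_notMem ha]
    simp_rw [this]
    rw [lintegral_indicator hBm, lintegral_const, Measure.restrict_apply_univ]
  set T : Eucl (n + 1) → ℝ × (Fin n → ℝ) := fun y => (b.repr y 0, P y) with hT
  have hTm : MeasurePreserving T := by
    have h1 := b.measurePreserving_repr
    have h2 := PiLp.volume_preserving_ofLp (Fin (n + 1))
    have h3 := volume_preserving_piFinSuccAbove (fun _ : Fin (n + 1) => ℝ) 0
    exact h3.comp (h2.comp h1)
  calc volume {y | graphHeight e γ y ∈ Ioo 0 L ∧ graphFoot e γ y ∈ A}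
      ≤ volume (T ⁻¹' W) := by
        refine measure_mono fun y hy => ?_
        refine ⟨subset_toMeasurable _ _ ⟨_, hy.2, hfoot y⟩, ?_⟩
        have h1 := hy.1
        rwa [hheight] at h1
    _ = ENNReal.ofReal L * volume B := by
        rw [hTm.measure_preimage hWm.nullMeasurableSet, hWvol]
    _ ≤ _ := by gcongr

end Graph

/-! ### Lipschitz charts and the boundary strip estimate. -/

section Chart

/-- In the ball of radius `r` around `x`, the set `D` is the region above the graph of `γ`. -/
structure IsGraphChart (D : Set (Eucl N)) (x e : Eucl N) (γ : Eucl N → ℝ) (K : NNReal)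
    (r : ℝ) : Prop where
  norm_eq : ‖e‖ = 1
  lipschitz : LipschitzWith K γ
  pos : 0 < r
  mem_iff : ∀ y ∈ Metric.ball x r, y ∈ D ↔ 0 < graphHeight e γ y

variable {D : Set (Eucl N)} {x e : Eucl N} {γ : Eucl N → ℝ} {K : NNReal} {r : ℝ}

theorem HasLipschitzBoundary.exists_chart (hD : HasLipschitzBoundary D) (hx : x ∈ frontier D) :
    ∃ e γ K r, r ≤ 1 ∧ IsGraphChart D x e γ K r := by
  obtain ⟨e, γ, K, r, he, hγ, hr, h⟩ := hD x hx
  refine ⟨e, γ, K, min r 1, min_le_right _ _, he, hγ, by positivity, fun y hy => ?_⟩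
  rw [h y (Metric.ball_subset_ball (min_le_left _ _) hy), graphHeight, sub_pos]

theorem eventually_sub_smul_mem_ball (e : Eucl N) {y : Eucl N}
    (hy : y ∈ Metric.ball x r) : ∀ᶠ s : ℝ in 𝓝 0, y - s • e ∈ Metric.ball x r := by
  have hc : Continuous fun s : ℝ => y - s • e := by fun_prop
  have h0 := hc.tendsto 0
  simp only [zero_smul, sub_zero] at h0
  exact h0 (Metric.isOpen_ball.mem_nhds hy)

theorem IsGraphChart.mem_frontier (h : IsGraphChart D x e γ K r) {y : Eucl N}
    (hy : y ∈ Metric.ball x r) (hy0 : graphHeight e γ y = 0) : y ∈ frontier D := by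
  rw [frontier_eq_closure_inter_closure]
  refine ⟨?_, subset_closure ?_⟩
  · have hc : Continuous fun s : ℝ => y - s • e := by fun_prop
    have h0 : Tendsto (fun s : ℝ => y - s • e) (𝓝[<] 0) (𝓝 y) := by
      have := hc.tendsto 0
      simp only [zero_smul, sub_zero] at this
      exact this.mono_left nhdsWithin_le_nhds
    refine mem_closure_of_tendsto h0 ?_
    filter_upwards [(eventually_sub_smul_mem_ball e hy).filter_mono nhdsWithin_le_nhds,
      self_mem_nhdsWithin] with s hs hs0
    rw [h.mem_iff _ hs, graphHeight_sub_smul h.norm_eq, hy0]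
    simpa using hs0
  · intro hyD
    exact absurd ((h.mem_iff y hy).1 hyD) (by rw [hy0]; exact lt_irrefl 0)

/-- Openness of `D` excludes positive height at a frontier point, and being a limit of points of `D`
excludes negative height. -/
theorem IsGraphChart.height_eq_zero (hDo : IsOpen D) (h : IsGraphChart D x e γ K r) {b : Eucl N}
    (hb : b ∈ Metric.ball x r) (hbD : b ∈ frontier D) : graphHeight e γ b = 0 := by
  rw [hDo.frontier_eq] at hbD
  refine le_antisymm (not_lt.1 fun h0 => hbD.2 ((h.mem_iff b hb).2 h0)) ?_
  have hc := continuous_graphHeight (e := e) h.lipschitz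
  have h1 : b ∈ closure (D ∩ Metric.ball x r) :=
    Metric.isOpen_ball.closure_inter ⟨hbD.1, hb⟩
  refine closure_minimal (t := {y | 0 ≤ graphHeight e γ y}) (fun y hy => ?_)
    (isClosed_le continuous_const hc) h1
  exact ((h.mem_iff y hy.2).1 hy.1).le

theorem IsGraphChart.sub_smul_mem_ball (h : IsGraphChart D x e γ K r) {y : Eucl N} {δ s : ℝ}
    (hy : y ∈ Metric.ball x δ) (hs : δ + |s| ≤ r) : y - s • e ∈ Metric.ball x r := by
  rw [Metric.mem_ball, dist_eq_norm] at hy ⊢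
  have h1 : y - s • e - x = (y - x) - s • e := by abel
  rw [h1]
  refine (norm_sub_le _ _).trans_lt ?_
  rw [norm_smul, h.norm_eq, Real.norm_eq_abs, mul_one]
  linarith

/-- The segment from `y` to a point of the complement closer than `ε` must meet the frontier.
Otherwise `D` and the complement of its closure would disconnect it. -/
theorem exists_mem_frontier_dist_lt (hDo : IsOpen D) {y : Eucl N} (hy : y ∈ D) {ε : ℝ}
    (hne : (Dᶜ).Nonempty) (hε : Metric.infDist y Dᶜ < ε) : y ∈ Metric.thickening ε (frontier D) := by
  obtain ⟨b, hb, hyb⟩ := (Metric.infDist_lt_iff hne).1 hε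
  rw [Metric.mem_thickening_iff]
  by_contra! hcon
  have hseg : ∀ z ∈ segment ℝ y b, z ∉ frontier D := fun z hz hzD => by
    refine (hcon z hzD).not_gt (lt_of_le_of_lt ?_ hyb)
    have := dist_add_dist_of_mem_segment hz
    linarith [dist_nonneg (x := z) (y := b)]
  have hbD : b ∉ closure D := fun h' =>
    hseg b (right_mem_segment ℝ y b) (by rw [hDo.frontier_eq]; exact ⟨h', hb⟩)
  obtain ⟨z, -, hz1, hz2⟩ := (convex_segment y b).isPreconnected D (closure D)ᶜ hDo
    isClosed_closure.isOpen_compl (fun z hz => by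
      by_contra h'
      simp only [mem_union, mem_compl_iff, not_or, not_not] at h'
      exact hseg z hz (by rw [hDo.frontier_eq]; exact ⟨h'.2, h'.1⟩))
    ⟨y, left_mem_segment ℝ y b, hy⟩ ⟨b, right_mem_segment ℝ y b, hbD⟩
  exact hz2 (subset_closure hz1)

/-- The form of `volume_graph_strip_le` that bounds integrals of `f ∘ graphFoot` over the strip by
boundary integrals. -/
theorem map_graphFoot_le (hDo : IsOpen D) (he : ‖e‖ = 1) (hγ : LipschitzWith K γ)
    {S : Set (Eucl N)} (hS : MeasurableSet S) {L : ℝ}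
    (hheight : ∀ y ∈ S, graphHeight e γ y ∈ Ioo 0 L) (hfoot : ∀ y ∈ S, graphFoot e γ y ∈ frontier D) :
    (volume.restrict S).map (graphFoot e γ) ≤ ENNReal.ofReal L • surfaceMeasure D := by
  have hfm : Measurable (graphFoot e γ) := (continuous_graphFoot hγ).measurable
  refine Measure.le_iff.2 fun A hA => ?_
  rw [Measure.map_apply hfm hA, Measure.restrict_apply (hfm hA), Measure.smul_apply,
    surfaceMeasure, Measure.restrict_apply hA, smul_eq_mul]
  -- Dimension zero contains no unit vector; in dimension `n + 1` the surface measure has exponent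
  -- `n`.
  rcases N with - | n
  · rw [Subsingleton.elim e 0, norm_zero] at he
    exact absurd he zero_ne_one
  · have e1 : ((n + 1 : ℕ) : ℝ) - 1 = n := by push_cast; ring
    rw [e1]
    refine (measure_mono fun y hy => ?_).trans (volume_graph_strip_le he hγ L _)
    exact ⟨hheight y hy.2, hy.1, hfoot y hy.2⟩

/-- Functions are controlled near the part `s` of the boundary of `D` by their boundary values and
their gradients. -/
def StripBound (D : Set (Eucl N)) (p R : ℝ) (s : Set (Eucl N)) : Prop :=
  ∃ C : ℝ≥0∞, C ≠ ⊤ ∧ ∃ ε₀ : ℝ, 0 < ε₀ ∧ ∀ ε, 0 < ε → ε ≤ ε₀ → ∀ f : Eucl N → ℝ, ContDiff ℝ ∞ f →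
    ∫⁻ y in D ∩ Metric.thickening ε s, ‖f y‖ₑ ^ p ≤
      C * (ENNReal.ofReal ε * (∫⁻ y, ‖f y‖ₑ ^ p ∂(surfaceMeasure D)) +
        ENNReal.ofReal ε ^ p * ∫⁻ y in D ∩ Metric.ball 0 R, ‖gradient f y‖ₑ ^ p)

/-- Compare `f y` with its value at the foot of `y` on the graph. The foot values integrate to at
most `M ε` times the boundary integral, and the differences to at most `(M ε)^p` times the gradient
integral. Here `M = 1 + K` is the Lipschitz constant of the height, so the strip has height below `M
ε`. -/
theorem IsGraphChart.stripBound (hDo : IsOpen D) (h : IsGraphChart D x e γ K r) (hr : r ≤ 1)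
    {p : ℝ} (hp : 1 < p) {R : ℝ} (hR : ‖x‖ + 1 ≤ R) :
    StripBound D p R (frontier D ∩ Metric.ball x (r / (2 * (2 + K)))) := by
  set M : ℝ := 1 + K with hM
  have hM1 : 1 ≤ M := by simp [hM]
  have hrpos := h.pos
  have hden : 2 * (2 + (K : ℝ)) = 2 * (1 + M) := by rw [hM]; ring
  rw [hden]
  set δ : ℝ := r / (2 * (1 + M)) with hδ
  have hδ0 : 0 < δ := by positivity
  -- A strip point is within `2 δ` of `x` and its foot is less than `2 M δ` away, so the joining
  -- segment stays in the chart.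
  have hδr : 2 * δ + M * (2 * δ) = r := by rw [hδ]; field_simp
  have hδr' : 2 * δ < r := by nlinarith
  refine ⟨2 ^ (p - 1) * ENNReal.ofReal M ^ p, ENNReal.mul_ne_top
    (ENNReal.rpow_ne_top_of_nonneg (by linarith) (by simp))
    (ENNReal.rpow_ne_top_of_nonneg (by linarith) ENNReal.ofReal_ne_top), δ, hδ0, ?_⟩
  intro ε hε hεδ f hf
  set S := D ∩ Metric.thickening ε (frontier D ∩ Metric.ball x δ) with hSdef
  have hSm : MeasurableSet S := (hDo.inter Metric.isOpen_thickening).measurableSet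
  have hS2 : ∀ y ∈ S, y ∈ Metric.ball x (2 * δ) := fun y hy => by
    obtain ⟨b, hb, hyb⟩ := Metric.mem_thickening_iff.1 hy.2
    have := dist_triangle y b x
    have h2 := Metric.mem_ball.1 hb.2
    rw [Metric.mem_ball]
    linarith
  have hSr : ∀ y ∈ S, y ∈ Metric.ball x r := fun y hy =>
    Metric.ball_subset_ball hδr'.le (hS2 y hy)
  have hpos : ∀ y ∈ S, 0 < graphHeight e γ y := fun y hy => (h.mem_iff y (hSr y hy)).1 hy.1
  have hlt : ∀ y ∈ S, graphHeight e γ y < M * ε := fun y hy => by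
    obtain ⟨b, hb, hyb⟩ := Metric.mem_thickening_iff.1 hy.2
    have hb0 := h.height_eq_zero hDo (Metric.ball_subset_ball (by linarith) hb.2) hb.1
    have h2 := abs_graphHeight_sub_le h.norm_eq h.lipschitz y b
    rw [hb0, sub_zero, ← dist_eq_norm] at h2
    refine ((le_abs_self _).trans h2).trans_lt ?_
    gcongr
  have hseg : ∀ y ∈ S, ∀ s ∈ Icc 0 (graphHeight e γ y), y - s • e ∈ Metric.ball x r :=
    fun y hy s hs => by
      refine h.sub_smul_mem_ball (hS2 y hy) ?_
      rw [abs_of_nonneg hs.1]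
      have h3 := hs.2.trans (hlt y hy).le
      have h4 : M * ε ≤ M * (2 * δ) := by gcongr; linarith
      linarith
  have hball : Metric.ball x r ⊆ Metric.ball 0 R := by
    refine Metric.ball_subset_ball' ?_
    rw [dist_zero_right]
    linarith
  have hfoot : ∀ y ∈ S, graphFoot e γ y ∈ frontier D := fun y hy => by
    refine h.mem_frontier (hseg y hy _ ⟨(hpos y hy).le, le_rfl⟩) ?_
    rw [graphFoot, graphHeight_sub_smul h.norm_eq, sub_self]
  have b1 : ∫⁻ y in S, ‖f (graphFoot e γ y)‖ₑ ^ p ≤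
      ENNReal.ofReal (M * ε) * ∫⁻ y, ‖f y‖ₑ ^ p ∂(surfaceMeasure D) := by
    have hfm : Measurable fun y => ‖f y‖ₑ ^ p := hf.continuous.enorm.measurable.pow_const p
    calc _ = ∫⁻ y, ‖f y‖ₑ ^ p ∂((volume.restrict S).map (graphFoot e γ)) :=
          (lintegral_map hfm (continuous_graphFoot h.lipschitz).measurable).symm
      _ ≤ ∫⁻ y, ‖f y‖ₑ ^ p ∂(ENNReal.ofReal (M * ε) • surfaceMeasure D) :=
          lintegral_mono' (map_graphFoot_le hDo h.norm_eq h.lipschitz hSm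
            (fun y hy => ⟨hpos y hy, hlt y hy⟩) hfoot) le_rfl
      _ = _ := by rw [lintegral_smul_measure, smul_eq_mul]
  have b2 : ∫⁻ y in S, ‖f y - f (graphFoot e γ y)‖ₑ ^ p ≤
      ENNReal.ofReal (M * ε) ^ p * ∫⁻ y in D ∩ Metric.ball 0 R, ‖gradient f y‖ₑ ^ p := by
    refine lintegral_sub_translate_le hp hf h.norm_eq hSm
      (hDo.inter Metric.isOpen_ball).measurableSet (fun y hy => (hpos y hy).le)
      (fun y hy => (hlt y hy).le) fun y hy s hs => ?_
    have hmem := hseg y hy s ⟨hs.1.le, hs.2.le⟩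
    refine ⟨(h.mem_iff _ hmem).2 ?_, hball hmem⟩
    rw [graphHeight_sub_smul h.norm_eq]
    linarith [hs.2]
  have hfc := hf.continuous
  have hm1 : Measurable fun y => ‖f (graphFoot e γ y)‖ₑ ^ p :=
    (hfc.comp (continuous_graphFoot h.lipschitz)).enorm.measurable.pow_const p
  have hM1' : 1 ≤ ENNReal.ofReal M := by simpa using ENNReal.ofReal_le_ofReal hM1
  -- Since `M ≥ 1`, the factor `M` of the boundary term is absorbed in the `M^p` of the gradient
  -- term.
  have hMp : ENNReal.ofReal M ≤ ENNReal.ofReal M ^ p := by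
    simpa using ENNReal.rpow_le_rpow_of_exponent_le hM1' hp.le
  calc ∫⁻ y in S, ‖f y‖ₑ ^ p
      ≤ ∫⁻ y in S, 2 ^ (p - 1) * (‖f (graphFoot e γ y)‖ₑ ^ p +
          ‖f y - f (graphFoot e γ y)‖ₑ ^ p) := by
        refine lintegral_mono fun y => ?_
        refine le_trans ?_ (ENNReal.rpow_add_le_mul_rpow_add_rpow _ _ hp.le)
        refine ENNReal.rpow_le_rpow ?_ (by linarith)
        refine le_trans (le_of_eq ?_) (enorm_add_le _ _)
        rw [add_sub_cancel]
    _ = 2 ^ (p - 1) * ((∫⁻ y in S, ‖f (graphFoot e γ y)‖ₑ ^ p) +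
          ∫⁻ y in S, ‖f y - f (graphFoot e γ y)‖ₑ ^ p) := by
        rw [lintegral_const_mul', lintegral_add_left hm1]
        exact ENNReal.rpow_ne_top_of_nonneg (by linarith) (by simp)
    _ ≤ 2 ^ (p - 1) * (ENNReal.ofReal (M * ε) * (∫⁻ y, ‖f y‖ₑ ^ p ∂(surfaceMeasure D)) +
          ENNReal.ofReal (M * ε) ^ p * ∫⁻ y in D ∩ Metric.ball 0 R, ‖gradient f y‖ₑ ^ p) := by
        gcongr
    _ ≤ _ := by
        rw [ENNReal.ofReal_mul (by linarith), ENNReal.mul_rpow_of_nonneg _ _ (by linarith),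
          mul_assoc (2 ^ (p - 1)), mul_add (ENNReal.ofReal M ^ p), mul_assoc, mul_assoc]
        gcongr

/-- Compactness induction: the estimate passes to subsets and to unions of two sets, and it holds
near each point by a chart. -/
theorem stripBound_frontier (hDo : IsOpen D) (hD : HasLipschitzBoundary D)
    (hc : IsCompact (frontier D)) {p : ℝ} (hp : 1 < p) {R : ℝ}
    (hR : ∀ x ∈ frontier D, ‖x‖ + 1 ≤ R) : StripBound D p R (frontier D) := by
  refine hc.induction_on (p := StripBound D p R) ?_ ?_ ?_ ?_
  · refine ⟨0, by simp, 1, one_pos, fun ε _ _ f _ => ?_⟩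
    simp
  · rintro s t hst ⟨C, hC, ε₀, hε₀, H⟩
    refine ⟨C, hC, ε₀, hε₀, fun ε h1 h2 f hf => le_trans (lintegral_mono_set ?_) (H ε h1 h2 f hf)⟩
    exact inter_subset_inter_right _ (Metric.thickening_subset_of_subset ε hst)
  · rintro s t ⟨C, hC, ε₀, hε₀, H⟩ ⟨C', hC', ε₀', hε₀', H'⟩
    refine ⟨C + C', ENNReal.add_ne_top.2 ⟨hC, hC'⟩, min ε₀ ε₀', lt_min hε₀ hε₀',
      fun ε h1 h2 f hf => ?_⟩
    rw [Metric.thickening_union, inter_union_distrib_left, add_mul]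
    exact (lintegral_union_le _ _ _).trans (add_le_add (H ε h1 (h2.trans (min_le_left _ _)) f hf)
      (H' ε h1 (h2.trans (min_le_right _ _)) f hf))
  · intro x hx
    obtain ⟨e, γ, K, r, hr, h⟩ := hD.exists_chart hx
    refine ⟨_, ?_, h.stripBound hDo hr hp (hR x hx)⟩
    have := h.pos
    exact inter_mem_nhdsWithin _ (Metric.ball_mem_nhds x (by positivity))

theorem IsGraphChart.exteriorDomain_iff (h : IsGraphChart D x e γ K r) {y : Eucl N}
    (hy : y ∈ Metric.ball x r) : y ∈ exteriorDomain D ↔ graphHeight e γ y < 0 := by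
  rw [exteriorDomain, mem_compl_iff]
  constructor
  · intro hyD
    have h1 : ¬ 0 < graphHeight e γ y := fun h0 => hyD (subset_closure ((h.mem_iff y hy).2 h0))
    refine lt_of_le_of_ne (not_lt.1 h1) fun h0 => hyD ?_
    exact frontier_subset_closure (h.mem_frontier hy h0)
  · intro h0 hyD
    have hc := continuous_graphHeight (e := e) h.lipschitz
    have hU : IsOpen (Metric.ball x r ∩ {z | graphHeight e γ z < 0}) :=
      Metric.isOpen_ball.inter (isOpen_lt hc continuous_const)
    obtain ⟨z, hz1, hz2⟩ := mem_closure_iff.1 hyD _ hU ⟨hy, h0⟩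
    exact lt_asymm hz1.2 ((h.mem_iff z hz1.1).1 hz2)

theorem frontier_exteriorDomain_subset (D : Set (Eucl N)) :
    frontier (exteriorDomain D) ⊆ frontier D := by
  rw [exteriorDomain, frontier_compl]
  exact frontier_closure_subset

/-- Reversing the axis and the sign of the graph function exchanges the two sides of the boundary.
-/
theorem HasLipschitzBoundary.exteriorDomain (hD : HasLipschitzBoundary D) :
    HasLipschitzBoundary (exteriorDomain D) := by
  intro x hx
  obtain ⟨e, γ, K, r, -, h⟩ := hD.exists_chart (frontier_exteriorDomain_subset D hx)
  refine ⟨-e, fun z => -γ z, K, r, by rw [norm_neg, h.norm_eq], h.lipschitz.neg, h.pos,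
    fun y hy => ?_⟩
  rw [h.exteriorDomain_iff hy, graphHeight, inner_neg_left, smul_neg, neg_smul, neg_neg,
    neg_lt_neg_iff, sub_neg]

theorem surfaceMeasure_exteriorDomain_le (D : Set (Eucl N)) :
    surfaceMeasure (exteriorDomain D) ≤ surfaceMeasure D :=
  Measure.restrict_mono_set _ (frontier_exteriorDomain_subset D)

theorem isOpen_exteriorDomain (D : Set (Eucl N)) : IsOpen (exteriorDomain D) :=
  isClosed_closure.isOpen_compl

/-- Poincaré's inequality on the strip for functions of zero trace: in the limit the boundary term
disappears. The factor `ε` left over compensates the gradient, of order `1 / ε`, of a cutoff on the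
strip. -/
theorem StripBound.eLpNorm_le {p : ℝ} (hp : 1 < p) {R : ℝ} (hR : ∀ x ∈ frontier D, ‖x‖ + 1 ≤ R)
    (h : StripBound D p R (frontier D)) :
    ∃ C : ℝ≥0∞, C ≠ ⊤ ∧ ∃ ε₀ : ℝ, 0 < ε₀ ∧ ∀ ε, 0 < ε → ε ≤ ε₀ →
      ∀ (w : Eucl N → ℝ) (G : Eucl N → Eucl N) (f : ℕ → Eucl N → ℝ),
      SmoothApprox D (ENNReal.ofReal p) w G f →
      Tendsto (fun n => eLpNorm (f n) (ENNReal.ofReal p) (surfaceMeasure D)) atTop (𝓝 0) →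
      eLpNorm w (ENNReal.ofReal p) (volume.restrict (D ∩ Metric.thickening ε (frontier D))) ≤
        C * ENNReal.ofReal ε *
          eLpNorm G (ENNReal.ofReal p) (volume.restrict (D ∩ Metric.ball 0 R)) := by
  obtain ⟨C, hC, ε₀, hε₀, H⟩ := h
  have hp0 : 0 < p := by linarith
  have hq : 1 ≤ ENNReal.ofReal p := by simpa using ENNReal.ofReal_le_ofReal hp.le
  have hq0 : ENNReal.ofReal p ≠ 0 := (zero_lt_one.trans_le hq).ne'
  have hqt : ENNReal.ofReal p ≠ ⊤ := ENNReal.ofReal_ne_top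
  have hCp : C ^ (1 / p) ≠ ⊤ := ENNReal.rpow_ne_top_of_nonneg (by positivity) hC
  -- Width at most `1` keeps the strip in the ball of radius `R`, as `‖x‖ + 1 ≤ R` on the frontier.
  refine ⟨C ^ (1 / p), hCp, min ε₀ 1,
    lt_min hε₀ one_pos, fun ε hε hεε w G f hf hfs => ?_⟩
  have hsub : D ∩ Metric.thickening ε (frontier D) ⊆ D ∩ Metric.ball 0 R := by
    refine inter_subset_inter_right _ fun y hy => ?_
    obtain ⟨b, hb, hyb⟩ := Metric.mem_thickening_iff.1 hy
    have h1 := hR b hb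
    have h2 := dist_triangle y b 0
    have h3 := hεε.trans (min_le_right _ _)
    rw [dist_zero_right b] at h2
    rw [Metric.mem_ball]
    linarith
  set μ := volume.restrict (D ∩ Metric.thickening ε (frontier D)) with hμ
  set μ' := volume.restrict (D ∩ Metric.ball 0 R) with hμ'
  have hμμ : μ ≤ μ' := Measure.restrict_mono hsub le_rfl
  have hfn : ∀ n, eLpNorm (f n) (ENNReal.ofReal p) μ ≤ C ^ (1 / p) *
      (ENNReal.ofReal ε ^ (1 / p) * eLpNorm (f n) (ENNReal.ofReal p) (surfaceMeasure D) +
        ENNReal.ofReal ε * eLpNorm (gradient (f n)) (ENNReal.ofReal p) μ') := by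
    intro n
    have h1 := H ε hε (hεε.trans (min_le_left _ _)) (f n) (hf.smooth n)
    rw [eLpNorm_eq_lintegral_rpow_enorm_toReal hq0 hqt, eLpNorm_eq_lintegral_rpow_enorm_toReal hq0 hqt,
      eLpNorm_eq_lintegral_rpow_enorm_toReal hq0 hqt, ENNReal.toReal_ofReal hp0.le]
    refine (ENNReal.rpow_le_rpow h1 (by positivity)).trans ?_
    rw [ENNReal.mul_rpow_of_nonneg _ _ (by positivity)]
    gcongr
    refine (ENNReal.rpow_add_le_add_rpow _ _ (by positivity)
      ((div_le_one hp0).2 hp.le)).trans_eq ?_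
    rw [ENNReal.mul_rpow_of_nonneg _ _ (by positivity), ENNReal.mul_rpow_of_nonneg _ _ (by positivity),
      ← ENNReal.rpow_mul, mul_one_div_cancel hp0.ne', ENNReal.rpow_one]
  have hmw : ∀ n, eLpNorm w (ENNReal.ofReal p) μ ≤
      eLpNorm (fun x => f n x - w x) (ENNReal.ofReal p) μ' + C ^ (1 / p) *
      (ENNReal.ofReal ε ^ (1 / p) * eLpNorm (f n) (ENNReal.ofReal p) (surfaceMeasure D) +
        ENNReal.ofReal ε * (eLpNorm (fun x => gradient (f n) x - G x) (ENNReal.ofReal p) μ' +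
          eLpNorm G (ENNReal.ofReal p) μ')) := by
    intro n
    have m1 : AEStronglyMeasurable (fun x => f n x - w x) μ' :=
      (hf.smooth n).continuous.aestronglyMeasurable.sub (hf.memLp R).1
    have m2 : AEStronglyMeasurable (fun x => gradient (f n) x - G x) μ' :=
      (continuous_gradient (hf.smooth n)).aestronglyMeasurable.sub (hf.memLp_grad R).1
    have e1 : w = fun x => f n x - (f n x - w x) := by ext x; ring
    have e2 : gradient (f n) = fun x => (gradient (f n) x - G x) + G x := by ext1 x; simp
    calc eLpNorm w (ENNReal.ofReal p) μ
        ≤ eLpNorm (f n) (ENNReal.ofReal p) μ +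
            eLpNorm (fun x => f n x - w x) (ENNReal.ofReal p) μ := by
          conv_lhs => rw [e1]
          exact eLpNorm_sub_le (hf.smooth n).continuous.aestronglyMeasurable
            (m1.mono_measure hμμ) hq
      _ ≤ _ := by
          rw [add_comm]
          refine add_le_add (eLpNorm_mono_measure _ hμμ) ((hfn n).trans ?_)
          gcongr
          conv_lhs => rw [e2]
          exact eLpNorm_add_le m2 (hf.memLp_grad R).1 hq
  have t1 := ENNReal.Tendsto.const_mul (a := ENNReal.ofReal ε ^ (1 / p)) hfs
    (Or.inr (ENNReal.rpow_ne_top_of_nonneg (by positivity) ENNReal.ofReal_ne_top))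
  have t2 := ENNReal.Tendsto.const_mul (a := ENNReal.ofReal ε)
    ((hf.tendsto_grad R).add_const (eLpNorm G (ENNReal.ofReal p) μ')) (Or.inr ENNReal.ofReal_ne_top)
  have t3 := (hf.tendsto R).add (ENNReal.Tendsto.const_mul (t1.add t2) (Or.inr hCp))
  simpa [mul_assoc] using ge_of_tendsto' t3 hmw

end Chart

/-! ### Bounded profiles for the test functions. -/

section Profiles

/-- A smooth function of one variable, bounded by `C` together with its derivative `a'`. -/
structure IsBoundedProfile (a a' : ℝ → ℝ) (C : ℝ) : Prop where
  smooth : ContDiff ℝ ∞ a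
  hasDerivAt : ∀ s, HasDerivAt a (a' s) s
  bound : ∀ s, |a s| ≤ C
  bound_deriv : ∀ s, |a' s| ≤ C

theorem IsBoundedProfile.continuous_deriv {a a' : ℝ → ℝ} {C : ℝ} (h : IsBoundedProfile a a' C) :
    Continuous a' := by
  have : a' = deriv a := funext fun s => (h.hasDerivAt s).deriv.symm
  rw [this]
  exact h.smooth.continuous_deriv (by simp)

/-- All nonlinear test functions and variations have the form `a (u - v) * b u`; this makes the
chain rule apply to them. -/
theorem IsBoundedProfile.mul_comp_sub {a a' b b' : ℝ → ℝ} {C C' : ℝ} (ha : IsBoundedProfile a a' C)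
    (hb : IsBoundedProfile b b' C') :
    IsSmoothLipschitz (fun s t => a (s - t) * b s)
      (fun s t => a' (s - t) * b s + a (s - t) * b' s) (fun s t => -(a' (s - t) * b s))
      (2 * (C * C')) := by
  have hac := ha.smooth.continuous
  have hbc := hb.smooth.continuous
  have ha'c := ha.continuous_deriv
  have hb'c := hb.continuous_deriv
  have hC : 0 ≤ C := (abs_nonneg _).trans (ha.bound 0)
  have hC' : 0 ≤ C' := (abs_nonneg _).trans (hb.bound 0)
  refine ⟨?_, by fun_prop, by fun_prop, fun s t => ?_, fun s t => ?_, fun s t => ?_⟩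
  · exact (ha.smooth.comp (contDiff_fst.sub contDiff_snd)).mul (hb.smooth.comp contDiff_fst)
  · have h1 : HasFDerivAt (fun r : ℝ × ℝ => r.1 - r.2)
        (ContinuousLinearMap.fst ℝ ℝ ℝ - ContinuousLinearMap.snd ℝ ℝ ℝ) (s, t) :=
      hasFDerivAt_fst.sub hasFDerivAt_snd
    have h2 := (ha.hasDerivAt (s - t)).comp_hasFDerivAt (s, t) h1
    have h3 := (hb.hasDerivAt s).comp_hasFDerivAt (s, t)
      (hasFDerivAt_fst (𝕜 := ℝ) (E := ℝ) (F := ℝ) (p := (s, t)))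
    refine (h2.mul h3).congr_fderiv ?_
    ext <;> simp <;> ring
  · refine (abs_add_le _ _).trans ?_
    rw [abs_mul, abs_mul]
    have h1 := mul_le_mul (ha.bound_deriv (s - t)) (hb.bound s) (abs_nonneg _) hC
    have h2 := mul_le_mul (ha.bound (s - t)) (hb.bound_deriv s) (abs_nonneg _) hC
    linarith
  · rw [abs_neg, abs_mul]
    have h1 := mul_le_mul (ha.bound_deriv (s - t)) (hb.bound s) (abs_nonneg _) hC
    have h2 := mul_nonneg hC hC'
    linarith

theorem isBoundedProfile_one : IsBoundedProfile (fun _ => 1) (fun _ => 0) 1 :=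
  ⟨contDiff_const, fun s => hasDerivAt_const s 1, by simp, by simp⟩

theorem abs_arctan_le (s : ℝ) : |Real.arctan s| ≤ 2 := by
  have h1 := Real.neg_pi_div_two_lt_arctan s
  have h2 := Real.arctan_lt_pi_div_two s
  have h3 := Real.pi_lt_four
  rw [abs_le]
  constructor <;> linarith

theorem one_div_one_add_sq_le (s : ℝ) : |1 / (1 + s ^ 2)| ≤ 1 := by
  rw [abs_of_nonneg (by positivity), div_le_one (by positivity)]
  linarith [sq_nonneg s]

theorem isBoundedProfile_arctan :
    IsBoundedProfile Real.arctan (fun s => 1 / (1 + s ^ 2)) 2 :=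
  ⟨Real.contDiff_arctan, Real.hasDerivAt_arctan, abs_arctan_le,
    fun s => (one_div_one_add_sq_le s).trans one_le_two⟩

/-- The derivative vanishes at `0`. So the gradient of `arctan(u - v)^3` is zero where `u = v`,
without the fact that `∇(u - v) = 0` a.e. on that set. -/
theorem isBoundedProfile_arctan_cube :
    IsBoundedProfile (fun s => Real.arctan s ^ 3)
      (fun s => 3 * Real.arctan s ^ 2 * (1 / (1 + s ^ 2))) 12 := by
  refine ⟨Real.contDiff_arctan.pow 3, fun s => ?_, fun s => ?_, fun s => ?_⟩
  · refine HasDerivAt.congr_deriv ((Real.hasDerivAt_arctan s).pow 3) ?_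
    simp
  · rw [abs_pow]
    have := pow_le_pow_left₀ (abs_nonneg _) (abs_arctan_le s) 3
    linarith
  · rw [abs_mul, abs_mul, abs_pow]
    have h1 := pow_le_pow_left₀ (abs_nonneg _) (abs_arctan_le s) 2
    have h2 := one_div_one_add_sq_le s
    have h3 : |(3 : ℝ)| * |Real.arctan s| ^ 2 ≤ 12 := by
      rw [abs_of_pos (by norm_num : (0 : ℝ) < 3)]
      linarith
    calc _ ≤ (12 : ℝ) * 1 := mul_le_mul h3 h2 (abs_nonneg _) (by norm_num)
      _ = 12 := mul_one _

/-- A smooth bounded weight that is positive exactly away from `0`; it localizes the second test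
function to the set `u ≠ v`. -/
theorem isBoundedProfile_sq_div :
    IsBoundedProfile (fun s => s ^ 2 / (1 + s ^ 2)) (fun s => 2 * s / (1 + s ^ 2) ^ 2) 1 := by
  have hpos : ∀ s : ℝ, 0 < 1 + s ^ 2 := fun s => by positivity
  refine ⟨?_, fun s => ?_, fun s => ?_, fun s => ?_⟩
  · exact (contDiff_id.pow 2).div (contDiff_const.add (contDiff_id.pow 2)) fun s => (hpos s).ne'
  · have h1 : HasDerivAt (fun s : ℝ => s ^ 2) (2 * s) s := by simpa using hasDerivAt_pow 2 s
    have h2 := h1.div (h1.const_add 1) (hpos s).ne'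
    refine h2.congr_deriv ?_
    congr 1
    ring
  · rw [abs_of_nonneg (by positivity), div_le_one (hpos s)]
    linarith
  · rw [abs_div, abs_of_pos (pow_pos (hpos s) 2), div_le_one (pow_pos (hpos s) 2), abs_mul,
      abs_of_pos (by norm_num : (0 : ℝ) < 2)]
    nlinarith [sq_abs s, sq_nonneg (|s| - 1), sq_nonneg s]

theorem abs_arctan_le_abs (s : ℝ) : |Real.arctan s| ≤ |s| := by
  have h := Convex.norm_image_sub_le_of_norm_hasDerivWithin_le (f := Real.arctan) (s := univ)
    (C := 1) (x := 0) (y := s) (fun x _ => (Real.hasDerivAt_arctan x).hasDerivWithinAt)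
    (fun x _ => one_div_one_add_sq_le x) convex_univ (mem_univ _) (mem_univ _)
  simpa using h

theorem abs_arctan_le_min (s : ℝ) : |Real.arctan s| ≤ 2 * min 1 |s| := by
  rcases le_total 1 |s| with h | h
  · rw [min_eq_left h, mul_one]
    exact abs_arctan_le s
  · rw [min_eq_right h]
    linarith [abs_arctan_le_abs s, abs_nonneg s]

theorem abs_sq_div_le_min (s : ℝ) : |s ^ 2 / (1 + s ^ 2)| ≤ min 1 |s| := by
  rw [abs_of_nonneg (by positivity), le_min_iff, div_le_one (by positivity),
    div_le_iff₀ (by positivity)]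
  refine ⟨by linarith, ?_⟩
  nlinarith [sq_abs s, abs_nonneg s, sq_nonneg (|s| - 1)]

end Profiles

/-! ### The subdifferential of the norm and monotonicity of the flux. -/

section Subdifferential

variable {F : Seminorm ℝ (Eucl N)} {p : ℝ}

theorem seminorm_continuous (F : Seminorm ℝ (Eucl N)) : Continuous F :=
  (Seminorm.convexOn F).locallyLipschitz.continuous

theorem exists_seminorm_le (F : Seminorm ℝ (Eucl N)) : ∃ C : ℝ, 0 < C ∧ ∀ ξ, F ξ ≤ C * ‖ξ‖ :=
  Seminorm.bound_of_continuous_normedSpace F (seminorm_continuous F)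

/-- Euler's identity for a one-homogeneous function: the subgradient inequality at `2 ξ` and at `0`
gives the two inequalities. -/
theorem inner_self_of_mem_subdifferential {z ξ : Eucl N} (h : z ∈ subdifferential F ξ) :
    inner ℝ z ξ = F ξ := by
  have h1 := h ((2 : ℝ) • ξ)
  have h2 := h 0
  rw [map_smul_eq_mul, Real.norm_of_nonneg (by norm_num : (0 : ℝ) ≤ 2), two_smul,
    add_sub_cancel_right] at h1
  rw [zero_sub, inner_neg_right, map_zero] at h2
  linarith

theorem inner_le_of_mem_subdifferential {z ξ : Eucl N} (h : z ∈ subdifferential F ξ) (η : Eucl N) :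
    inner ℝ z η ≤ F η := by
  have h1 := h η
  rw [inner_sub_right, inner_self_of_mem_subdifferential h] at h1
  linarith

theorem norm_le_of_mem_subdifferential {C : ℝ} (hC0 : 0 ≤ C) (hC : ∀ ξ, F ξ ≤ C * ‖ξ‖) {z ξ : Eucl N}
    (h : z ∈ subdifferential F ξ) : ‖z‖ ≤ C := by
  have h1 := (inner_le_of_mem_subdifferential h z).trans (hC z)
  rw [real_inner_self_eq_norm_sq] at h1
  rcases eq_or_ne z 0 with rfl | hz
  · rw [norm_zero]
    exact hC0
  · have h2 := norm_pos_iff.2 hz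
    nlinarith

theorem flux_inner_self (hp : 1 < p) {z ξ : Eucl N} (h : z ∈ subdifferential F ξ) :
    F ξ ^ (p - 1) * inner ℝ z ξ = F ξ ^ p := by
  rw [inner_self_of_mem_subdifferential h]
  rcases (apply_nonneg F ξ).eq_or_lt with h0 | h0
  · rw [← h0, mul_zero, Real.zero_rpow (by linarith)]
  · rw [← Real.rpow_add_one h0.ne']
    congr 1
    ring

/-- With `c = z₁ · ξ₂ ≤ F ξ₂` and `d = z₂ · ξ₁ ≤ F ξ₁`, the difference is the sum of three
nonnegative terms. The last, `(a^(p-1) - b^(p-1)) (a - b)`, vanishes only if `a = b`. Equality then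
forces the first to vanish, which is weaker than `ξ₁ = ξ₂` but enough for the second test. -/
theorem flux_monotone (hp : 1 < p) {z₁ z₂ ξ₁ ξ₂ : Eucl N} (h₁ : z₁ ∈ subdifferential F ξ₁)
    (h₂ : z₂ ∈ subdifferential F ξ₂) :
    0 ≤ F ξ₁ ^ (p - 1) * inner ℝ z₁ (ξ₁ - ξ₂) - F ξ₂ ^ (p - 1) * inner ℝ z₂ (ξ₁ - ξ₂) ∧
    (F ξ₁ ^ (p - 1) * inner ℝ z₁ (ξ₁ - ξ₂) - F ξ₂ ^ (p - 1) * inner ℝ z₂ (ξ₁ - ξ₂) = 0 →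
      F ξ₁ = F ξ₂ ∧ F ξ₁ ^ (p - 1) * inner ℝ z₁ (ξ₁ - ξ₂) = 0) := by
  have e1 := inner_self_of_mem_subdifferential h₁
  have e2 := inner_self_of_mem_subdifferential h₂
  have i1 := inner_le_of_mem_subdifferential h₁ ξ₂
  have i2 := inner_le_of_mem_subdifferential h₂ ξ₁
  set a := F ξ₁
  set b := F ξ₂
  have ha : 0 ≤ a := apply_nonneg F ξ₁
  have hb : 0 ≤ b := apply_nonneg F ξ₂
  rw [inner_sub_right, inner_sub_right, e1, e2]
  set c := inner ℝ z₁ ξ₂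
  set d := inner ℝ z₂ ξ₁
  have ha' : 0 ≤ a ^ (p - 1) := Real.rpow_nonneg ha _
  have hb' : 0 ≤ b ^ (p - 1) := Real.rpow_nonneg hb _
  have t1 : 0 ≤ a ^ (p - 1) * (b - c) := mul_nonneg ha' (by linarith)
  have t2 : 0 ≤ b ^ (p - 1) * (a - d) := mul_nonneg hb' (by linarith)
  have t3 : a ≠ b → 0 < (a ^ (p - 1) - b ^ (p - 1)) * (a - b) := by
    intro hab
    rcases lt_or_gt_of_ne hab with h | h
    · have := Real.rpow_lt_rpow ha h (by linarith : 0 < p - 1)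
      exact mul_pos_of_neg_of_neg (by linarith) (by linarith)
    · have := Real.rpow_lt_rpow hb h (by linarith : 0 < p - 1)
      exact mul_pos (by linarith) (by linarith)
  have key : a ^ (p - 1) * (a - c) - b ^ (p - 1) * (d - b) =
      a ^ (p - 1) * (b - c) + b ^ (p - 1) * (a - d) + (a ^ (p - 1) - b ^ (p - 1)) * (a - b) := by
    ring
  by_cases hab : a = b
  · rw [hab] at t1 t2 key ⊢
    refine ⟨by rw [key]; nlinarith, fun h0 => ⟨rfl, ?_⟩⟩
    rw [key] at h0
    rw [sub_self, zero_mul, add_zero] at h0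
    linarith
  · have := t3 hab
    exact ⟨by linarith, fun h0 => by linarith⟩

end Subdifferential

/-! ### Enlarging the class of test functions by exhausting cutoffs. -/

section TestLimit

/-- Test functions `κ n` in `D` exhausting `D` whose gradients, weighted by `m`, are bounded in
`L^p`. -/
structure IsExhaustingCutoff (D : Set (Eucl N)) (p : ℝ) (m : Eucl N → ℝ)
    (κ : ℕ → Eucl N → ℝ) : Prop where
  test : ∀ n, IsTestFunction D (κ n)
  abs_le_one : ∀ n x, |κ n x| ≤ 1
  eventually_eq : ∀ x ∈ D, ∀ᶠ n in atTop, κ n x = 1 ∧ gradient (κ n) x = 0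
  bounded : ∃ C : ℝ≥0∞, C ≠ ⊤ ∧ ∀ n,
    eLpNorm (fun x => m x • gradient (κ n) x) (ENNReal.ofReal p) (volume.restrict D) ≤ C

theorem eLpNorm_smul_le_of_eq_zero {E : Type*} [NormedAddCommGroup E] [NormedSpace ℝ E]
    {D T : Set (Eucl N)} (hT : MeasurableSet T) {q : ℝ≥0∞} {c : ℝ} (hc : 0 ≤ c) {m : Eucl N → ℝ}
    {g : Eucl N → E} (hg : ∀ x, ‖g x‖ ≤ c) (hg0 : ∀ᵐ x ∂volume.restrict D, x ∉ T → g x = 0) :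
    eLpNorm (fun x => m x • g x) q (volume.restrict D) ≤
      ENNReal.ofReal c * eLpNorm m q (volume.restrict (D ∩ T)) := by
  rw [inter_comm, ← Measure.restrict_restrict hT, ← eLpNorm_indicator_eq_eLpNorm_restrict hT]
  refine eLpNorm_le_mul_eLpNorm_of_ae_le_mul ?_ q
  filter_upwards [hg0] with x hx
  by_cases hxT : x ∈ T
  · rw [indicator_of_mem hxT, norm_smul, mul_comm]
    exact mul_le_mul_of_nonneg_right (hg x) (norm_nonneg _)
  · rw [hx hxT, smul_zero, norm_zero]
    positivity

theorem integrable_inner_of_memLp {α E : Type*} [MeasurableSpace α] {μ : Measure α}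
    [NormedAddCommGroup E] [InnerProductSpace ℝ E] {q r : ℝ≥0∞} [ENNReal.HolderTriple q r 1]
    {f g : α → E} (hf : MemLp f q μ) (hg : MemLp g r μ) :
    Integrable (fun x => inner ℝ (f x) (g x)) μ ∧
      eLpNorm (fun x => inner ℝ (f x) (g x)) 1 μ ≤ eLpNorm f q μ * eLpNorm g r μ := by
  have h1 := eLpNorm_le_eLpNorm_mul_eLpNorm_of_nnnorm (p := q) (q := r) (r := 1) hf.1 hg.1
    (fun a b : E => (inner ℝ a b : ℝ)) 1 (Eventually.of_forall fun x => by
      rw [one_mul]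
      exact nnnorm_inner_le_nnnorm _ _)
  rw [ENNReal.coe_one, one_mul] at h1
  refine ⟨memLp_one_iff_integrable.1 ⟨hf.1.inner hg.1, h1.trans_lt (ENNReal.mul_lt_top hf.2 hg.2)⟩,
    h1⟩

theorem SmoothApprox.aestronglyMeasurable {D : Set (Eucl N)} {q : ℝ≥0∞} {u : Eucl N → ℝ}
    {G : Eucl N → Eucl N} {φ : ℕ → Eucl N → ℝ} (h : SmoothApprox D q u G φ) :
    AEStronglyMeasurable u (volume.restrict D) := by
  have e1 : D = ⋃ n : ℕ, D ∩ Metric.ball 0 n := by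
    rw [← inter_iUnion, Metric.iUnion_ball_nat, inter_univ]
  rw [e1, aestronglyMeasurable_iUnion_iff]
  exact fun n => (h.memLp n).1

/-- Test with `κ n * η` and let `n` tend to infinity. The main term converges by domination, and the
error term is controlled by the weighted bound on `∇κ n`. -/
theorem IsExhaustingCutoff.integral_inner_eq_zero {D : Set (Eucl N)} (hD : IsOpen D) {p p' : ℝ}
    (hpp : p'.HolderConjugate p) {m : Eucl N → ℝ} {κ : ℕ → Eucl N → ℝ}
    (hκ : IsExhaustingCutoff D p m κ) {σ : Eucl N → Eucl N}
    (hσ : MemLp σ (ENNReal.ofReal p') (volume.restrict D))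
    (hσ0 : ∀ η H, MemSobolevZero D p η H → ∫ x in D, inner ℝ (σ x) (H x) = 0)
    {η : Eucl N → ℝ} {H : Eucl N → Eucl N} {f : ℕ → Eucl N → ℝ} {C : ℝ}
    (hη : SmoothApprox D (ENNReal.ofReal p) η H f) (hηm : ∀ x, |η x| ≤ C * |m x|)
    (hH : MemLp H (ENNReal.ofReal p) (volume.restrict D)) :
    ∫ x in D, inner ℝ (σ x) (H x) = 0 := by
  have hp1 : 1 ≤ p := hpp.symm.lt.le
  have : ENNReal.HolderTriple (ENNReal.ofReal p') (ENNReal.ofReal p) 1 := hpp.ennrealOfReal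
  have hp'0 : ENNReal.ofReal p' ≠ 0 := by
    simpa using hpp.pos
  obtain ⟨B, hB, hκB⟩ := hκ.bounded
  have hηae := hη.aestronglyMeasurable
  have hg : ∀ n, Continuous (gradient (κ n)) := fun n => continuous_gradient (hκ.test n).1
  have hηκm : ∀ n, MemLp (fun x => η x • gradient (κ n) x) (ENNReal.ofReal p)
      (volume.restrict D) ∧ eLpNorm (fun x => η x • gradient (κ n) x) (ENNReal.ofReal p)
        (volume.restrict D) ≤ ENNReal.ofReal C * B := by
    intro n
    have h1 : eLpNorm (fun x => η x • gradient (κ n) x) (ENNReal.ofReal p)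
        (volume.restrict D) ≤ ENNReal.ofReal C * B := by
      refine (eLpNorm_le_mul_eLpNorm_of_ae_le_mul (Eventually.of_forall fun x => ?_) _).trans
        (mul_le_mul_right (hκB n) _)
      rw [norm_smul, norm_smul, ← mul_assoc]
      exact mul_le_mul_of_nonneg_right (hηm x) (norm_nonneg _)
    exact ⟨⟨hηae.smul (hg n).aestronglyMeasurable,
      h1.trans_lt (ENNReal.mul_lt_top ENNReal.ofReal_lt_top hB.lt_top)⟩, h1⟩
  have hκH : ∀ n, MemLp (fun x => κ n x • H x) (ENNReal.ofReal p) (volume.restrict D) := fun n =>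
    hH.of_le ((hκ.test n).1.continuous.aestronglyMeasurable.smul hH.1)
      (Eventually.of_forall fun x => by
        rw [norm_smul]
        exact mul_le_of_le_one_left (norm_nonneg _) (hκ.abs_le_one n x))
  have hzero : ∀ n, (∫ x in D, inner ℝ (σ x) (κ n x • H x)) +
      ∫ x in D, inner ℝ (σ x) (η x • gradient (κ n) x) = 0 := by
    intro n
    rw [← integral_add (integrable_inner_of_memLp hσ (hκH n)).1
      (integrable_inner_of_memLp hσ (hηκm n).1).1, ← hσ0 _ _ (hη.memSobolevZero hD hp1 (hκ.test n))]
    simp_rw [inner_add_right]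
  have hDae : ∀ᵐ x ∂(volume.restrict D), x ∈ D := ae_restrict_mem hD.measurableSet
  have t1 : Tendsto (fun n => ∫ x in D, inner ℝ (σ x) (κ n x • H x)) atTop
      (𝓝 (∫ x in D, inner ℝ (σ x) (H x))) := by
    have hi : Integrable (fun x => ‖σ x‖ * ‖H x‖) (volume.restrict D) :=
      MemLp.integrable_mul hσ.norm hH.norm
    refine tendsto_integral_of_dominated_convergence (fun x => ‖σ x‖ * ‖H x‖)
      (fun n => (integrable_inner_of_memLp hσ (hκH n)).1.1) hi
      (fun n => Eventually.of_forall fun x => ?_) ?_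
    · refine (norm_inner_le_norm _ _).trans (mul_le_mul_of_nonneg_left ?_ (norm_nonneg _))
      rw [norm_smul]
      exact mul_le_of_le_one_left (norm_nonneg _) (hκ.abs_le_one n x)
    · filter_upwards [hDae] with x hx
      refine tendsto_const_nhds.congr' ?_
      filter_upwards [hκ.eventually_eq x hx] with n hn
      rw [hn.1, one_smul]
  -- The factor `η ∇κ n` is only bounded in `L^p`, but it lives where `∇κ n ≠ 0`. These sets
  -- eventually leave each point, so `σ` restricted to them tends to zero in `L^p'`, and Hölder
  -- concludes.
  have t2 : Tendsto (fun n => ∫ x in D, inner ℝ (σ x) (η x • gradient (κ n) x)) atTop (𝓝 0) := by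
    set S : ℕ → Set (Eucl N) := fun n => {x | gradient (κ n) x ≠ 0}
    have hS : ∀ n, MeasurableSet (S n) := fun n =>
      (isOpen_ne_fun (hg n) continuous_const).measurableSet
    have h1 : Tendsto (fun n => eLpNorm ((S n).indicator σ) (ENNReal.ofReal p')
        (volume.restrict D)) atTop (𝓝 0) := by
      refine tendsto_eLpNorm_zero_of_dominated (f := fun n => (S n).indicator σ)
        (b := fun x => ‖σ x‖) hp'0 ENNReal.ofReal_ne_top hσ.norm
        (fun n => hσ.1.indicator (hS n)) (fun n => Eventually.of_forall fun x =>
          norm_indicator_le_norm_self _ _) ?_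
      filter_upwards [hDae] with x hx
      refine tendsto_const_nhds.congr' ?_
      filter_upwards [hκ.eventually_eq x hx] with n hn
      rw [indicator_of_notMem]
      exact fun h => h hn.2
    have hind : ∀ n, MemLp ((S n).indicator σ) (ENNReal.ofReal p') (volume.restrict D) :=
      fun n => MemLp.indicator (hS n) hσ
    have hCB : ENNReal.ofReal C * B ≠ ⊤ := ENNReal.mul_ne_top ENNReal.ofReal_ne_top hB
    have h2 := ENNReal.Tendsto.mul_const h1 (Or.inr hCB)
    rw [zero_mul] at h2
    rw [tendsto_zero_iff_enorm_tendsto_zero]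
    refine tendsto_of_tendsto_of_tendsto_of_le_of_le tendsto_const_nhds h2 (fun _ => zero_le)
      fun n => ?_
    have h3 := (integrable_inner_of_memLp (hind n) (hηκm n).1).2
    rw [eLpNorm_one_eq_lintegral_enorm] at h3
    refine (enorm_integral_le_lintegral_enorm _).trans (le_trans (le_of_eq ?_)
      (h3.trans (mul_le_mul_right (hηκm n).2 _)))
    refine lintegral_congr fun x => ?_
    by_cases hx : x ∈ S n
    · rw [indicator_of_mem hx]
    · have : gradient (κ n) x = 0 := not_not.1 hx
      rw [this, smul_zero, inner_zero_right, inner_zero_right]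
  have t3 := t1.add t2
  simp_rw [hzero, add_zero] at t3
  exact (tendsto_nhds_unique t3 tendsto_const_nhds)

theorem IsCutoff.gradient_eq_zero_of_lt {d : Eucl N → ℝ} {ε C : ℝ} {χ : Eucl N → ℝ}
    (h : IsCutoff d ε C χ) (hd : Continuous d) {x : Eucl N} (hx : d x < ε / 4) :
    gradient χ x = 0 := by
  have : χ =ᶠ[𝓝 x] fun _ => 0 := by
    filter_upwards [hd.continuousAt.eventually (gt_mem_nhds hx)] with y hy using h.eq_zero y hy.le
  rw [this.gradient_eq, gradient, fderiv_const_apply, map_zero]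

theorem gradient_one_sub {X : Eucl N → ℝ} (hX : ContDiff ℝ ∞ X) (x : Eucl N) :
    gradient (fun y => 1 - X y) x = -gradient X x := by
  refine HasGradientAt.gradient (hasGradientAt_of_hasFDerivAt_inner ?_)
  refine ((HasGradientAt.hasFDerivAt_inner (hasGradientAt_of_contDiff hX x)).const_sub
    1).congr_fderiv ?_
  simp

theorem IsCutoff.isTestFunction_mul {D : Set (Eucl N)} {ε C R C' : ℝ} {χ X : Eucl N → ℝ}
    (hε : 0 < ε) (hχ : IsCutoff (fun x => Metric.infDist x Dᶜ) ε C χ)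
    (hX : IsCutoff (fun x => ‖x‖) R C' X) : IsTestFunction D (fun x => χ x * (1 - X x)) := by
  have hdc : Continuous fun x => Metric.infDist x Dᶜ := Metric.continuous_infDist_pt _
  have h1 : tsupport (fun x => χ x * (1 - X x)) ⊆
      {x | ε / 4 ≤ Metric.infDist x Dᶜ} ∩ Metric.closedBall 0 R := by
    refine closure_minimal (fun x hx => ?_)
      ((isClosed_le continuous_const hdc).inter Metric.isClosed_closedBall)
    have hx' := mul_ne_zero_iff.1 hx
    constructor
    · by_contra h
      exact hx'.1 (hχ.eq_zero x (not_le.1 h).le)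
    · rw [mem_closedBall_zero_iff]
      by_contra h
      exact hx'.2 (by rw [hX.eq_one x (not_le.1 h).le, sub_self])
  refine ⟨hχ.smooth.mul (contDiff_const.sub hX.smooth), ?_, fun x hx => ?_⟩
  · exact (isCompact_closedBall (0 : Eucl N) R).of_isClosed_subset isClosed_closure
      (h1.trans inter_subset_right)
  · by_contra hxD
    have h2 : ε / 4 ≤ Metric.infDist x Dᶜ := (h1 hx).1
    rw [Metric.infDist_zero_of_mem hxD] at h2
    linarith

/-- The cutoffs vanish near the boundary at scale `1 / k` and at infinity at scale `k`. The strip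
estimate for `w` and the linear growth of the norm of `m` exactly offset the sizes of the two
gradients. -/
theorem exists_isExhaustingCutoff {D : Set (Eucl N)} (hDo : IsOpen D)
    (hne : (Dᶜ).Nonempty) (hDL : HasLipschitzBoundary D) (hc : IsCompact (frontier D)) {p : ℝ}
    (hp : 1 < p) {w : Eucl N → ℝ} {G : Eucl N → Eucl N} {f : ℕ → Eucl N → ℝ}
    (hw : SmoothApprox D (ENNReal.ofReal p) w G f)
    (hf : Tendsto (fun n => eLpNorm (f n) (ENNReal.ofReal p) (surfaceMeasure D)) atTop (𝓝 0))
    {m : Eucl N → ℝ} (hmm : AEStronglyMeasurable m (volume.restrict D)) (hmw : ∀ x, |m x| ≤ |w x|) {A : ℝ≥0∞} (hA : A ≠ ⊤)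
    (hm : ∀ R : ℝ, 1 ≤ R → eLpNorm m (ENNReal.ofReal p) (volume.restrict (D ∩ Metric.ball 0 R)) ≤
      A * ENNReal.ofReal R) :
    ∃ κ, IsExhaustingCutoff D p m κ := by
  obtain ⟨R, hR⟩ : ∃ R : ℝ, ∀ x ∈ frontier D, ‖x‖ + 1 ≤ R := by
    obtain ⟨R, hR⟩ := hc.isBounded.exists_norm_le
    exact ⟨R + 1, fun x hx => by linarith [hR x hx]⟩
  obtain ⟨B, hB, ε₀, hε₀, hstrip⟩ := (stripBound_frontier hDo hDL hc hp hR).eLpNorm_le hp hR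
  obtain ⟨C, hC, hcut⟩ := exists_isCutoff
  have hp1 : 1 ≤ ENNReal.ofReal p := by simpa using ENNReal.ofReal_le_ofReal hp.le
  -- The shift by `n₀` makes every strip width `2 / k n` at most `ε₀`.
  obtain ⟨n₀, hn₀⟩ := exists_nat_gt (2 / ε₀)
  set k : ℕ → ℝ := fun n => (n : ℝ) + n₀ + 1 with hk
  have hk1 : ∀ n, 1 ≤ k n := fun n => by
    have h1 : (0 : ℝ) ≤ n := n.cast_nonneg
    have h2 : (0 : ℝ) ≤ n₀ := n₀.cast_nonneg
    simp only [hk]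
    linarith
  have hk0 : ∀ n, 0 < k n := fun n => one_pos.trans_le (hk1 n)
  have hkε : ∀ n, 2 / k n ≤ ε₀ := fun n => by
    rw [div_le_iff₀ (hk0 n), ← div_le_iff₀' hε₀]
    have h1 : (0 : ℝ) ≤ n := n.cast_nonneg
    simp only [hk]
    linarith
  have hkt : Tendsto k atTop atTop :=
    tendsto_atTop_add_const_right _ _ (tendsto_atTop_add_const_right _ _
      tendsto_natCast_atTop_atTop)
  have hkt' : Tendsto (fun n => 1 / k n) atTop (𝓝 0) := by
    simp_rw [one_div]
    exact hkt.inv_tendsto_atTop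
  set d : Eucl N → ℝ := fun x => Metric.infDist x Dᶜ with hd
  have hdc : Continuous d := Metric.continuous_infDist_pt _
  have hε : ∀ n, 0 < 1 / k n := fun n => one_div_pos.2 (hk0 n)
  choose χ hχ using fun n => hcut N d (Metric.lipschitz_infDist_pt _) (1 / k n) (hε n)
  choose X hX using fun n => hcut N (fun x => ‖x‖) lipschitzWith_one_norm (k n) (hk0 n)
  have hgrad : ∀ n x, gradient (fun y => χ n y * (1 - X n y)) x =
      χ n x • -gradient (X n) x + (1 - X n x) • gradient (χ n) x := fun n x => by
    rw [gradient_mul (hχ n).smooth (contDiff_const.sub (hX n).smooth), gradient_one_sub (hX n).smooth]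
  refine ⟨fun n x => χ n x * (1 - X n x), fun n => (hχ n).isTestFunction_mul (hε n) (hX n),
    fun n x => ?_, fun x hx => ?_, 2 * (ENNReal.ofReal C * A) +
      2 * (ENNReal.ofReal C * B *
        eLpNorm G (ENNReal.ofReal p) (volume.restrict (D ∩ Metric.ball 0 R))), ?_, fun n => ?_⟩
  · have h1 := (hχ n).nonneg x
    have h2 := (hχ n).le_one x
    have h3 := (hX n).nonneg x
    have h4 := (hX n).le_one x
    rw [abs_of_nonneg (mul_nonneg h1 (by linarith))]
    exact mul_le_one₀ h2 (by linarith) (by linarith)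
  · have hdx : 0 < d x :=
      (hDo.isClosed_compl.notMem_iff_infDist_pos hne).1 fun h => h hx
    filter_upwards [hkt'.eventually (gt_mem_nhds hdx), hkt.eventually_gt_atTop (4 * ‖x‖)]
      with n h1 h2
    have h3 : ‖x‖ < k n / 4 := by linarith
    refine ⟨?_, ?_⟩
    · rw [(hχ n).eq_one x h1.le, (hX n).eq_zero x h3.le]
      norm_num
    · rw [hgrad, (hχ n).gradient_eq_zero hdc h1,
        (hX n).gradient_eq_zero_of_lt continuous_norm h3, neg_zero, smul_zero, smul_zero, add_zero]
  · refine ENNReal.add_ne_top.2 ⟨ENNReal.mul_ne_top (by simp)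
      (ENNReal.mul_ne_top ENNReal.ofReal_ne_top hA), ENNReal.mul_ne_top (by simp)
      (ENNReal.mul_ne_top (ENNReal.mul_ne_top ENNReal.ofReal_ne_top hB) (hw.memLp_grad R).2.ne)⟩
  · have g1 : ∀ x, ‖-gradient (X n) x‖ ≤ C / k n := fun x => by
      rw [norm_neg]; exact (hX n).gradient_le x
    have g2 : ∀ x, ‖gradient (χ n) x‖ ≤ C * k n := fun x => by
      simpa using (hχ n).gradient_le x
    -- At infinity: a gradient of size `C / k` on the ball of radius `2 k`, where `m` has norm at
    -- most `2 k A`.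
    have b1 : eLpNorm (fun x => m x • (χ n x • -gradient (X n) x)) (ENNReal.ofReal p)
        (volume.restrict D) ≤ 2 * (ENNReal.ofReal C * A) := by
      have h1 := eLpNorm_smul_le_of_eq_zero (D := D) (T := Metric.ball 0 (2 * k n))
        Metric.isOpen_ball.measurableSet (q := ENNReal.ofReal p) (m := m) (c := C / k n)
        (g := fun x => χ n x • -gradient (X n) x) (div_nonneg hC.le (hk0 n).le)
        (fun x => by
          rw [norm_smul, Real.norm_of_nonneg ((hχ n).nonneg x)]
          exact (mul_le_of_le_one_left (norm_nonneg _) ((hχ n).le_one x)).trans (g1 x))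
        (Eventually.of_forall fun x hx => by
          have : k n < ‖x‖ := by
            rw [mem_ball_zero_iff, not_lt] at hx
            linarith [hk0 n]
          rw [(hX n).gradient_eq_zero continuous_norm this, neg_zero, smul_zero])
      refine h1.trans ((mul_le_mul_right (hm (2 * k n) (by linarith [hk1 n])) _).trans_eq ?_)
      rw [ENNReal.ofReal_mul two_pos.le, div_eq_mul_inv, ENNReal.ofReal_mul hC.le,
        ENNReal.ofReal_inv_of_pos (hk0 n), ENNReal.ofReal_ofNat]
      calc ENNReal.ofReal C * (ENNReal.ofReal (k n))⁻¹ * (A * (2 * ENNReal.ofReal (k n)))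
          = 2 * (ENNReal.ofReal C * A) * ((ENNReal.ofReal (k n))⁻¹ * ENNReal.ofReal (k n)) := by ring
        _ = _ := by
          rw [ENNReal.inv_mul_cancel (by simpa using hk0 n) ENNReal.ofReal_ne_top, mul_one]
    -- Near the boundary: a gradient of size `C k` on the strip of width `2 / k`, where `w`, and so
    -- `m`, has norm of order `1 / k`.
    have b2 : eLpNorm (fun x => m x • ((1 - X n x) • gradient (χ n) x)) (ENNReal.ofReal p)
        (volume.restrict D) ≤ 2 * (ENNReal.ofReal C * B *
          eLpNorm G (ENNReal.ofReal p) (volume.restrict (D ∩ Metric.ball 0 R))) := by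
      have h1 := eLpNorm_smul_le_of_eq_zero (D := D) (T := Metric.thickening (2 / k n) (frontier D))
        Metric.isOpen_thickening.measurableSet (q := ENNReal.ofReal p) (m := m) (c := C * k n)
        (g := fun x => (1 - X n x) • gradient (χ n) x) (mul_nonneg hC.le (hk0 n).le)
        (fun x => by
          have h3 := (hX n).nonneg x
          have h4 := (hX n).le_one x
          rw [norm_smul, Real.norm_of_nonneg (by linarith)]
          exact (mul_le_of_le_one_left (norm_nonneg _) (by linarith)).trans (g2 x))
        (by
          filter_upwards [ae_restrict_mem hDo.measurableSet] with x hxD hx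
          have : 1 / k n < d x := by
            by_contra! h
            refine hx (exists_mem_frontier_dist_lt hDo hxD hne (h.trans_lt ?_))
            exact div_lt_div_of_pos_right one_lt_two (hk0 n)
          rw [(hχ n).gradient_eq_zero hdc this, smul_zero])
      refine h1.trans ?_
      have h2 := hstrip (2 / k n) (div_pos two_pos (hk0 n)) (hkε n) w G f hw hf
      have h3 : eLpNorm m (ENNReal.ofReal p)
          (volume.restrict (D ∩ Metric.thickening (2 / k n) (frontier D))) ≤ _ :=
        (eLpNorm_mono hmw).trans h2
      refine (mul_le_mul_right h3 _).trans_eq ?_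
      rw [ENNReal.ofReal_mul hC.le, div_eq_mul_inv, ENNReal.ofReal_mul two_pos.le,
        ENNReal.ofReal_inv_of_pos (hk0 n), ENNReal.ofReal_ofNat]
      set g := eLpNorm G (ENNReal.ofReal p) (volume.restrict (D ∩ Metric.ball 0 R))
      calc ENNReal.ofReal C * ENNReal.ofReal (k n) * (B * (2 * (ENNReal.ofReal (k n))⁻¹) * g)
          = 2 * (ENNReal.ofReal C * B * g) * ((ENNReal.ofReal (k n))⁻¹ * ENNReal.ofReal (k n)) := by
            ring
        _ = _ := by
          rw [ENNReal.inv_mul_cancel (by simpa using hk0 n) ENNReal.ofReal_ne_top, mul_one]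
    simp_rw [hgrad, smul_add]
    refine (eLpNorm_add_le ?_ ?_ hp1).trans (add_le_add b1 b2)
    · exact hmm.smul ((hχ n).smooth.continuous.smul
        (continuous_gradient (hX n).smooth).neg).aestronglyMeasurable
    · exact hmm.smul ((continuous_const.sub (hX n).smooth.continuous).smul
        (continuous_gradient (hχ n).smooth)).aestronglyMeasurable

end TestLimit

/-! ### Uniqueness for the equation in an open set with compact Lipschitz boundary. -/

section Uniqueness

theorem isSmoothLipschitz_sub :
    IsSmoothLipschitz (fun s t => s - t) (fun _ _ => 1) (fun _ _ => -1) 1 := by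
  refine ⟨contDiff_fst.sub contDiff_snd, continuous_const, continuous_const, fun s t => ?_,
    by simp, by simp⟩
  refine (hasFDerivAt_fst.sub hasFDerivAt_snd).congr_fderiv ?_
  ext <;> simp

theorem IsCutoff.isTestFunction_mul_left {D : Set (Eucl N)} {ε C : ℝ} {χ ψ : Eucl N → ℝ}
    (hε : 0 < ε) (hχ : IsCutoff (fun x => Metric.infDist x Dᶜ) ε C χ)
    (hψ : IsTestFunction univ ψ) : IsTestFunction D (fun x => χ x * ψ x) := by
  have h := hψ.mul hχ.smooth
  refine ⟨h.1, h.2.1, fun x hx => ?_⟩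
  have h1 : tsupport (fun x => χ x * ψ x) ⊆ {x | ε / 4 ≤ Metric.infDist x Dᶜ} := by
    refine closure_minimal (fun y hy => ?_)
      (isClosed_le continuous_const (Metric.continuous_infDist_pt _))
    by_contra h
    exact (mul_ne_zero_iff.1 hy).1 (hχ.eq_zero y (not_le.1 h).le)
  by_contra hxD
  have h2 : ε / 4 ≤ Metric.infDist x Dᶜ := h1 hx
  rw [Metric.infDist_zero_of_mem hxD] at h2
  linarith

/-- The strip estimate with zero gradient makes `J` vanish near the boundary. Its extension by zero
therefore has zero weak gradient in the whole space and is constant. Connectedness of `D` plays no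
role, since the constant is read off on the complement. -/
theorem SmoothApprox.ae_eq_zero {D : Set (Eucl N)} (hDo : IsOpen D)
    (hne : volume Dᶜ ≠ 0) (hDL : HasLipschitzBoundary D) (hc : IsCompact (frontier D)) {p : ℝ}
    (hp : 1 < p) {J : Eucl N → ℝ} {H : Eucl N → Eucl N} {f : ℕ → Eucl N → ℝ}
    (hJ : SmoothApprox D (ENNReal.ofReal p) J H f)
    (hf : Tendsto (fun n => eLpNorm (f n) (ENNReal.ofReal p) (surfaceMeasure D)) atTop (𝓝 0))
    (hH : ∀ᵐ x ∂volume.restrict D, H x = 0) {B : ℝ} (hB : ∀ x, |J x| ≤ B) :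
    ∀ᵐ x ∂volume.restrict D, J x = 0 := by
  have hne' : (Dᶜ).Nonempty := nonempty_of_measure_ne_zero hne
  obtain ⟨R, hR⟩ : ∃ R : ℝ, ∀ x ∈ frontier D, ‖x‖ + 1 ≤ R := by
    obtain ⟨R, hR⟩ := hc.isBounded.exists_norm_le
    exact ⟨R + 1, fun x hx => by linarith [hR x hx]⟩
  obtain ⟨A, -, ε, hε, hstrip⟩ := (stripBound_frontier hDo hDL hc hp hR).eLpNorm_le hp hR
  have hp1 : 1 ≤ ENNReal.ofReal p := by simpa using ENNReal.ofReal_le_ofReal hp.le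
  have hp0 : ENNReal.ofReal p ≠ 0 := (zero_lt_one.trans_le hp1).ne'
  have hJm := hJ.aestronglyMeasurable
  set d : Eucl N → ℝ := fun x => Metric.infDist x Dᶜ with hd
  have hdc : Continuous d := Metric.continuous_infDist_pt _
  have hstrip0 : ∀ᵐ x ∂volume.restrict D, d x < ε → J x = 0 := by
    have h1 := hstrip ε hε le_rfl J H f hJ hf
    have h2 : eLpNorm H (ENNReal.ofReal p) (volume.restrict (D ∩ Metric.ball 0 R)) = 0 := by
      rw [eLpNorm_congr_ae (g := 0), eLpNorm_zero]
      exact ae_mono (Measure.restrict_mono inter_subset_left le_rfl) hH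
    rw [h2, mul_zero, le_zero_iff, eLpNorm_eq_zero_iff
      (hJm.mono_measure (Measure.restrict_mono inter_subset_left le_rfl)) hp0, inter_comm,
      ← Measure.restrict_restrict Metric.isOpen_thickening.measurableSet,
      EventuallyEq, ae_restrict_iff' Metric.isOpen_thickening.measurableSet] at h1
    filter_upwards [h1, ae_restrict_mem hDo.measurableSet] with x hx hxD hxε
    exact hx (exists_mem_frontier_dist_lt hDo hxD hne' hxε)
  obtain ⟨C, hC, hcut⟩ := exists_isCutoff
  -- At scale `ε / 2` the cutoff is identically `1` around every point with `ε ≤ d`, thus wherever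
  -- `J` may be nonzero. Replacing `ψ` by `χ * ψ` changes nothing on the left.
  obtain ⟨χ, hχ⟩ := hcut N d (Metric.lipschitz_infDist_pt _) (ε / 2) (by positivity)
  have hwg : HasWeakGradient univ (D.indicator J) fun _ => 0 := by
    have hm : AEStronglyMeasurable (D.indicator J) volume :=
      (aestronglyMeasurable_indicator_iff hDo.measurableSet).2 hJm
    have hb : MemLp (D.indicator J) ⊤ volume :=
      memLp_top_of_bound hm B (Eventually.of_forall fun x =>
        (norm_indicator_le_norm_self _ _).trans (hB x))
    refine ⟨(hb.locallyIntegrable le_top).locallyIntegrableOn _,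
      (locallyIntegrable_const _).locallyIntegrableOn _, fun ψ hψ => ?_⟩
    have hχψ := hχ.isTestFunction_mul_left (by positivity) hψ
    have h1 := (hJ.hasWeakGradient hDo hp1).2.2 _ hχψ
    have h2 : ∫ x in D, (χ x * ψ x) • H x = 0 := by
      rw [integral_congr_ae (g := fun _ => 0), integral_zero]
      filter_upwards [hH] with x hx
      rw [hx, smul_zero]
    rw [h2, neg_zero] at h1
    simp only [smul_zero, integral_zero, neg_zero, setIntegral_univ]
    rw [← h1, ← integral_indicator hDo.measurableSet]
    refine integral_congr_ae ?_
    filter_upwards [(ae_restrict_iff' hDo.measurableSet).1 hstrip0] with x hx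
    by_cases hxD : x ∈ D
    · simp only [indicator_of_mem hxD]
      rcases lt_or_ge (d x) ε with hxε | hxε
      · rw [hx hxD hxε, zero_smul, zero_smul]
      · have h3 : ε / 2 < d x := by linarith
        rw [gradient_mul hχ.smooth hψ.1, hχ.gradient_eq_zero hdc h3, hχ.eq_one x h3.le, smul_zero,
          add_zero, one_smul]
    · simp only [indicator_of_notMem hxD, zero_smul]
  obtain ⟨c, hcc⟩ := hwg.exists_ae_eq_const
  have hc0 : c = 0 := by
    have h1 : ∃ᵐ x ∂volume, x ∈ Dᶜ := frequently_ae_mem_iff.2 hne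
    obtain ⟨x, hx1, hx2⟩ := (h1.and_eventually hcc).exists
    rw [← hx2, indicator_of_notMem hx1]
  rw [ae_restrict_iff' hDo.measurableSet]
  filter_upwards [hcc] with x hx hxD
  rw [indicator_of_mem hxD, hc0] at hx
  exact hx

/-- Subgradients are bounded by `C`, so the flux is at most `C^p |G|^(p-1)`, and `p' = p / (p - 1)`.
-/
theorem memLp_flux {F : Seminorm ℝ (Eucl N)} {p p' : ℝ} (hpp : p'.HolderConjugate p)
    {μ : Measure (Eucl N)} {G z : Eucl N → Eucl N} (hG : MemLp G (ENNReal.ofReal p) μ)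
    (hz : AEStronglyMeasurable z μ) (hzF : ∀ᵐ x ∂μ, z x ∈ subdifferential F (G x)) :
    MemLp (fun x => F (G x) ^ (p - 1) • z x) (ENNReal.ofReal p') μ := by
  obtain ⟨C, hC, hFC⟩ := exists_seminorm_le F
  have hp1 : 0 < p - 1 := by linarith [hpp.symm.lt]
  have h1 := hG.norm_rpow_div (ENNReal.ofReal (p - 1))
  rw [ENNReal.toReal_ofReal hp1.le, ← ENNReal.ofReal_div_of_pos hp1,
    ← hpp.symm.conjugate_eq] at h1
  have hFG : AEStronglyMeasurable (fun x => F (G x) ^ (p - 1)) μ :=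
    ((Real.continuous_rpow_const hp1.le).comp (seminorm_continuous F)).comp_aestronglyMeasurable
      hG.1
  refine h1.of_le_mul (c := C ^ (p - 1) * C) (hFG.smul hz) ?_
  filter_upwards [hzF] with x hx
  have h2 := norm_le_of_mem_subdifferential hC.le hFC hx
  have h0 := apply_nonneg F (G x)
  rw [norm_smul, Real.norm_of_nonneg (Real.rpow_nonneg h0 _),
    Real.norm_of_nonneg (Real.rpow_nonneg (norm_nonneg _) _)]
  have h3 := Real.rpow_le_rpow h0 (hFC (G x)) hp1.le
  rw [Real.mul_rpow hC.le (norm_nonneg _)] at h3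
  calc _ ≤ (C ^ (p - 1) * ‖G x‖ ^ (p - 1)) * C := by gcongr
    _ = _ := by ring

/-- The two-test argument. The first test compares the equations; the second uses only that of `u`,
but its cross term is killed by the equality case of the first. -/
theorem ae_eq_of_satisfiesEquation {D : Set (Eucl N)} (hDo : IsOpen D)
    (hne : volume Dᶜ ≠ 0) (hDL : HasLipschitzBoundary D) (hc : IsCompact (frontier D)) {p : ℝ}
    (hp : 1 < p) {F : Seminorm ℝ (Eucl N)} (hF : ∀ ξ, F ξ = 0 → ξ = 0) {u v : Eucl N → ℝ}
    {G H : Eucl N → Eucl N} {φ ψ : ℕ → Eucl N → ℝ}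
    (hu : SmoothApprox D (ENNReal.ofReal p) u G φ) (hv : SmoothApprox D (ENNReal.ofReal p) v H ψ)
    (hφψ : Tendsto (fun n => eLpNorm (fun x => φ n x - ψ n x) (ENNReal.ofReal p)
      (surfaceMeasure D)) atTop (𝓝 0))
    (hG : MemLp G (ENNReal.ofReal p) (volume.restrict D))
    (hH : MemLp H (ENNReal.ofReal p) (volume.restrict D))
    {A : ℝ≥0∞} (hA : A ≠ ⊤)
    (hgrowth : ∀ R : ℝ, 1 ≤ R → eLpNorm (fun x => min 1 |u x - v x|) (ENNReal.ofReal p)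
      (volume.restrict (D ∩ Metric.ball 0 R)) ≤ A * ENNReal.ofReal R)
    (hequ : SatisfiesEquation F p D G) (heqv : SatisfiesEquation F p D H) :
    u =ᵐ[volume.restrict D] v := by
  have hne' : (Dᶜ).Nonempty := nonempty_of_measure_ne_zero hne
  have hp1 : 1 ≤ ENNReal.ofReal p := by simpa using ENNReal.ofReal_le_ofReal hp.le
  have hpt : ENNReal.ofReal p ≠ ⊤ := ENNReal.ofReal_ne_top
  set m : Eucl N → ℝ := fun x => min 1 |u x - v x| with hm
  have hm0 : ∀ x, |m x| = min 1 |u x - v x| := fun x =>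
    abs_of_nonneg (le_min zero_le_one (abs_nonneg _))
  have hum := hu.aestronglyMeasurable
  have hvm := hv.aestronglyMeasurable
  have hw := hu.comp hp1 hpt hv isSmoothLipschitz_sub
  have hmm : AEStronglyMeasurable m (volume.restrict D) :=
    (continuous_const.min continuous_abs).comp_aestronglyMeasurable (hum.sub hvm)
  obtain ⟨κ, hκ⟩ := exists_isExhaustingCutoff hDo hne' hDL hc hp hw hφψ hmm
    (fun x => (hm0 x).trans_le (min_le_right _ _)) hA hgrowth
  obtain ⟨z, hz, hzF, hz0⟩ := hequ
  obtain ⟨y, hy, hyF, hy0⟩ := heqv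
  obtain ⟨p', hpp⟩ : ∃ p' : ℝ, p'.HolderConjugate p :=
    ⟨_, (Real.HolderConjugate.conjExponent hp).symm⟩
  have : ENNReal.HolderTriple (ENNReal.ofReal p') (ENNReal.ofReal p) 1 := hpp.ennrealOfReal
  have hσ := memLp_flux hpp hG hz hzF
  have hτ := memLp_flux hpp hH hy hyF
  have hσ0 : ∀ η K, MemSobolevZero D p η K →
      ∫ x in D, inner ℝ (F (G x) ^ (p - 1) • z x) (K x) = 0 := fun η K h => by
    rw [← hz0 η K h]
    simp_rw [real_inner_smul_left]
  have hτ0 : ∀ η K, MemSobolevZero D p η K →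
      ∫ x in D, inner ℝ (F (H x) ^ (p - 1) • y x) (K x) = 0 := fun η K h => by
    rw [← hy0 η K h]
    simp_rw [real_inner_smul_left]
  have hcomp : ∀ {a a' b b' : ℝ → ℝ} {C C' : ℝ}, IsBoundedProfile a a' C →
      IsBoundedProfile b b' C' → MemLp (fun x => (a' (u x - v x) * b (u x) +
        a (u x - v x) * b' (u x)) • G x + (-(a' (u x - v x) * b (u x))) • H x)
        (ENNReal.ofReal p) (volume.restrict D) := by
    intro a a' b b' C C' ha hb
    have hΦ := ha.mul_comp_sub hb
    refine MemLp.add ?_ ?_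
    · refine hG.of_le_mul (c := 2 * (C * C')) (AEStronglyMeasurable.smul
        (hΦ.continuous_left.comp_aestronglyMeasurable (hum.prodMk hvm)) hG.1)
        (Eventually.of_forall fun x => ?_)
      rw [norm_smul]
      exact mul_le_mul_of_nonneg_right (hΦ.bound_left _ _) (norm_nonneg _)
    · refine hH.of_le_mul (c := 2 * (C * C')) (AEStronglyMeasurable.smul
        (hΦ.continuous_right.comp_aestronglyMeasurable (hum.prodMk hvm)) hH.1)
        (Eventually.of_forall fun x => ?_)
      rw [norm_smul]
      exact mul_le_mul_of_nonneg_right (hΦ.bound_right _ _) (norm_nonneg _)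
  -- the energies agree
  have hFeq : ∀ᵐ x ∂volume.restrict D, F (G x) = F (H x) ∧
      F (G x) ^ (p - 1) * inner ℝ (z x) (G x - H x) = 0 := by
    have hm1 := hcomp isBoundedProfile_arctan isBoundedProfile_one
    have happ := hu.comp hp1 hpt hv (isBoundedProfile_arctan.mul_comp_sub isBoundedProfile_one)
    have hηm : ∀ x, |Real.arctan (u x - v x) * 1| ≤ 2 * |m x| := fun x => by
      rw [mul_one, hm0]
      exact abs_arctan_le_min _
    have i1 := hκ.integral_inner_eq_zero hDo hpp hσ hσ0 happ hηm hm1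
    have i2 := hκ.integral_inner_eq_zero hDo hpp hτ hτ0 happ hηm hm1
    have j1 := (integrable_inner_of_memLp hσ hm1).1
    have j2 := (integrable_inner_of_memLp hτ hm1).1
    have i3 := integral_sub j1 j2
    rw [i1, i2, sub_zero] at i3
    -- `arctan` is increasing, so the integrand is a positive weight times the expression of
    -- `flux_monotone`.
    have hval : ∀ x, inner ℝ (F (G x) ^ (p - 1) • z x)
        ((1 / (1 + (u x - v x) ^ 2) * 1 + Real.arctan (u x - v x) * 0) • G x +
          (-(1 / (1 + (u x - v x) ^ 2) * 1)) • H x) - inner ℝ (F (H x) ^ (p - 1) • y x)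
        ((1 / (1 + (u x - v x) ^ 2) * 1 + Real.arctan (u x - v x) * 0) • G x +
          (-(1 / (1 + (u x - v x) ^ 2) * 1)) • H x) = 1 / (1 + (u x - v x) ^ 2) *
        (F (G x) ^ (p - 1) * inner ℝ (z x) (G x - H x) -
          F (H x) ^ (p - 1) * inner ℝ (y x) (G x - H x)) := fun x => by
      simp only [real_inner_smul_left, inner_add_right, inner_sub_right, inner_smul_right]
      ring
    have hnn := (integral_eq_zero_iff_of_nonneg_ae ?_ (j1.sub j2)).1 i3
    · filter_upwards [hnn, hzF, hyF] with x hx hx1 hx2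
      simp only [Pi.zero_apply, Pi.sub_apply] at hx
      rw [hval x] at hx
      have hpos : 0 < 1 / (1 + (u x - v x) ^ 2) := by positivity
      exact (flux_monotone hp hx1 hx2).2 ((mul_eq_zero_iff_left hpos.ne').1 hx)
    · filter_upwards [hzF, hyF] with x hx1 hx2
      simp only [Pi.zero_apply, Pi.sub_apply]
      rw [hval x]
      exact mul_nonneg (by positivity) (flux_monotone hp hx1 hx2).1
  -- the gradients vanish where the solutions differ
  have hvanish : ∀ᵐ x ∂volume.restrict D, u x - v x ≠ 0 → G x = 0 ∧ H x = 0 := by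
    have hm1 := hcomp isBoundedProfile_sq_div isBoundedProfile_arctan
    have happ := hu.comp hp1 hpt hv
      (isBoundedProfile_sq_div.mul_comp_sub isBoundedProfile_arctan)
    have hηm : ∀ x, |(u x - v x) ^ 2 / (1 + (u x - v x) ^ 2) * Real.arctan (u x)| ≤
        2 * |m x| := fun x => by
      rw [abs_mul, hm0, mul_comm]
      exact mul_le_mul (abs_arctan_le _) (abs_sq_div_le_min _) (abs_nonneg _) two_pos.le
    have i1 := hκ.integral_inner_eq_zero hDo hpp hσ hσ0 happ hηm hm1
    have j1 := (integrable_inner_of_memLp hσ hm1).1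
    -- The coefficient of `G - H`, which has no sign, multiplies `F(G)^(p-1) z · (G - H) = 0`. Only
    -- the derivative of `arctan u` remains, and it contributes `F(G)^p` with a nonnegative weight.
    have hval : ∀ᵐ x ∂volume.restrict D, inner ℝ (F (G x) ^ (p - 1) • z x)
        ((2 * (u x - v x) / (1 + (u x - v x) ^ 2) ^ 2 * Real.arctan (u x) +
          (u x - v x) ^ 2 / (1 + (u x - v x) ^ 2) * (1 / (1 + u x ^ 2))) • G x +
          (-(2 * (u x - v x) / (1 + (u x - v x) ^ 2) ^ 2 * Real.arctan (u x))) • H x) =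
        (u x - v x) ^ 2 / (1 + (u x - v x) ^ 2) * (1 / (1 + u x ^ 2)) * F (G x) ^ p := by
      filter_upwards [hFeq, hzF] with x hx hx1
      have h1 := hx.2
      rw [inner_sub_right] at h1
      simp only [real_inner_smul_left, inner_add_right, inner_smul_right]
      have h2 := flux_inner_self hp hx1
      linear_combination (2 * (u x - v x) / (1 + (u x - v x) ^ 2) ^ 2 * Real.arctan (u x)) * h1 +
        ((u x - v x) ^ 2 / (1 + (u x - v x) ^ 2) * (1 / (1 + u x ^ 2))) * h2
    have hnn := (integral_eq_zero_iff_of_nonneg_ae ?_ j1).1 i1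
    · filter_upwards [hnn, hval, hFeq] with x hx hx1 hx2 hxw
      simp only [Pi.zero_apply] at hx
      rw [hx1] at hx
      have hpos : 0 < (u x - v x) ^ 2 / (1 + (u x - v x) ^ 2) * (1 / (1 + u x ^ 2)) := by
        have := pow_pos (abs_pos.2 hxw) 2
        rw [sq_abs] at this
        positivity
      have h3 := (Real.rpow_eq_zero (apply_nonneg F (G x)) (by linarith)).1
        ((mul_eq_zero_iff_left hpos.ne').1 hx)
      exact ⟨hF _ h3, hF _ (hx2.1 ▸ h3)⟩
    · filter_upwards [hval] with x hx
      rw [hx]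
      have := apply_nonneg F (G x)
      simp only [Pi.zero_apply]
      positivity
  -- Its gradient vanishes a.e.: by `hvanish` where `u ≠ v`, and by the cube where `u = v`.
  have hJ := hu.comp hp1 hpt hv (isBoundedProfile_arctan_cube.mul_comp_sub isBoundedProfile_one)
  have hJ0 := hJ.ae_eq_zero hDo hne hDL hc hp ?_ ?_ (B := 12) ?_
  · filter_upwards [hJ0] with x hx
    rw [mul_one, pow_eq_zero_iff three_ne_zero, Real.arctan_eq_zero_iff] at hx
    exact sub_eq_zero.1 hx
  · refine tendsto_eLpNorm_zero_of_le_mul 4 (fun n => Eventually.of_forall fun x => ?_) hφψ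
    rw [mul_one, Real.norm_eq_abs, Real.norm_eq_abs, abs_pow, pow_succ]
    have h1 := pow_le_pow_left₀ (abs_nonneg _) (abs_arctan_le (φ n x - ψ n x)) 2
    exact mul_le_mul (by linarith) (abs_arctan_le_abs _) (abs_nonneg _) (by norm_num)
  · filter_upwards [hvanish] with x hx
    by_cases h : u x - v x = 0
    · simp [h]
    · obtain ⟨h1, h2⟩ := hx h
      rw [h1, h2, smul_zero, smul_zero, add_zero]
  · intro x
    rw [mul_one]
    exact isBoundedProfile_arctan_cube.bound _

end Uniqueness

/-! ### The interior and exterior Dirichlet problems. -/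

section Dirichlet

/-- Hölder on the ball gives the factor `|B_R|^(1/q - 1/r)`, a multiple of `R^(N (1/q - 1/r))`. The
condition on the exponent makes this at most linear in `R`. -/
theorem eLpNorm_ball_le {q r : ℝ≥0∞} (hqr : q ≤ r)
    (h0 : 0 ≤ 1 / q.toReal - 1 / r.toReal) (h1 : N * (1 / q.toReal - 1 / r.toReal) ≤ 1)
    {D : Set (Eucl N)} {m : Eucl N → ℝ} (hm : AEStronglyMeasurable m (volume.restrict D)) {R : ℝ}
    (hR : 1 ≤ R) :
    eLpNorm m q (volume.restrict (D ∩ Metric.ball 0 R)) ≤ eLpNorm m r (volume.restrict D) *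
      volume (Metric.ball (0 : Eucl N) 1) ^ (1 / q.toReal - 1 / r.toReal) * ENNReal.ofReal R := by
  set a := 1 / q.toReal - 1 / r.toReal
  set V := volume (Metric.ball (0 : Eucl N) 1)
  have hle : volume.restrict (D ∩ Metric.ball 0 R) ≤ volume.restrict D :=
    Measure.restrict_mono inter_subset_left le_rfl
  refine (eLpNorm_le_eLpNorm_mul_rpow_measure_univ hqr (hm.mono_measure hle)).trans ?_
  rw [mul_assoc]
  refine mul_le_mul' (eLpNorm_mono_measure _ hle) ?_
  have hR1 : 1 ≤ ENNReal.ofReal R := by simpa using ENNReal.ofReal_le_ofReal hR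
  calc (volume.restrict (D ∩ Metric.ball 0 R)) univ ^ a
      ≤ (volume (Metric.ball (0 : Eucl N) R)) ^ a := by
        rw [Measure.restrict_apply_univ]
        exact ENNReal.rpow_le_rpow (measure_mono inter_subset_right) h0
    _ = V ^ a * ENNReal.ofReal R ^ (N * a) := by
        rw [Measure.addHaar_ball_of_pos _ _ (by linarith), finrank_euclideanSpace_fin,
          ENNReal.mul_rpow_of_nonneg _ _ h0, mul_comm, ENNReal.ofReal_pow (by linarith),
          ← ENNReal.rpow_natCast, ← ENNReal.rpow_mul]
    _ ≤ V ^ a * ENNReal.ofReal R := by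
        gcongr
        simpa using ENNReal.rpow_le_rpow_of_exponent_le hR1 h1

theorem exists_eLpNorm_ball_le {q r : ℝ≥0∞} (hqr : q ≤ r)
    (h0 : 0 ≤ 1 / q.toReal - 1 / r.toReal) (h1 : N * (1 / q.toReal - 1 / r.toReal) ≤ 1)
    {D : Set (Eucl N)} {m : Eucl N → ℝ} (hm : MemLp m r (volume.restrict D)) :
    ∃ A : ℝ≥0∞, A ≠ ⊤ ∧ ∀ R : ℝ, 1 ≤ R →
      eLpNorm m q (volume.restrict (D ∩ Metric.ball 0 R)) ≤ A * ENNReal.ofReal R :=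
  ⟨_, ENNReal.mul_ne_top hm.2.ne (ENNReal.rpow_ne_top_of_nonneg h0 measure_ball_lt_top.ne),
    fun _ hR => eLpNorm_ball_le hqr h0 h1 hm.1 hR⟩

/-- The exponent `r` is the global integrability of `min(1,|u - v|)`: `p` in the interior problem,
the Sobolev exponent or `∞` in the exterior one. The common datum makes the boundary values of the
two approximating sequences merge. -/
theorem ae_eq_of_hasTrace {Ω D : Set (Eucl N)} (hS : surfaceMeasure D ≤ surfaceMeasure Ω)
    (hDo : IsOpen D) (hne : volume Dᶜ ≠ 0) (hDL : HasLipschitzBoundary D)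
    (hc : IsCompact (frontier D)) {p : ℝ} (hp : 1 < p) {F : Seminorm ℝ (Eucl N)}
    (hF : ∀ ξ, F ξ = 0 → ξ = 0) {φ u v : Eucl N → ℝ}
    (hφ : AEStronglyMeasurable φ (surfaceMeasure Ω)) {G H : Eucl N → Eucl N}
    (hu : ∀ R : ℝ, MemLp u (ENNReal.ofReal p) (volume.restrict (D ∩ Metric.ball 0 R)))
    (hv : ∀ R : ℝ, MemLp v (ENNReal.ofReal p) (volume.restrict (D ∩ Metric.ball 0 R)))
    (hG : MemLp G (ENNReal.ofReal p) (volume.restrict D))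
    (hH : MemLp H (ENNReal.ofReal p) (volume.restrict D))
    (hut : HasTrace Ω D p u G φ) (hvt : HasTrace Ω D p v H φ) {r : ℝ≥0∞}
    (hpr : ENNReal.ofReal p ≤ r) (h0 : 0 ≤ 1 / p - 1 / r.toReal)
    (h1 : N * (1 / p - 1 / r.toReal) ≤ 1)
    (hm : MemLp (fun x => min 1 |u x - v x|) r (volume.restrict D))
    (hequ : SatisfiesEquation F p D G) (heqv : SatisfiesEquation F p D H) :
    u =ᵐ[volume.restrict D] v := by
  obtain ⟨φ₁, h₁, h₁', h₁''⟩ := hut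
  obtain ⟨φ₂, h₂, h₂', h₂''⟩ := hvt
  have hp1 : 1 ≤ ENNReal.ofReal p := by simpa using ENNReal.ofReal_le_ofReal hp.le
  have hGR : ∀ {K : Eucl N → Eucl N}, MemLp K (ENNReal.ofReal p) (volume.restrict D) → ∀ R : ℝ,
      MemLp K (ENNReal.ofReal p) (volume.restrict (D ∩ Metric.ball 0 R)) := fun hK R =>
    hK.mono_measure (Measure.restrict_mono inter_subset_left le_rfl)
  have a₁ : SmoothApprox D (ENNReal.ofReal p) u G φ₁ :=
    ⟨fun n => (h₁ n).1, hu, hGR hG, fun R => (h₁' R).1, fun R => (h₁' R).2⟩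
  have a₂ : SmoothApprox D (ENNReal.ofReal p) v H φ₂ :=
    ⟨fun n => (h₂ n).1, hv, hGR hH, fun R => (h₂' R).1, fun R => (h₂' R).2⟩
  have hpR : (ENNReal.ofReal p).toReal = p := ENNReal.toReal_ofReal (by linarith)
  obtain ⟨A, hA, hgrowth⟩ := exists_eLpNorm_ball_le hpr (by rwa [hpR]) (by rwa [hpR]) hm
  refine ae_eq_of_satisfiesEquation hDo hne hDL hc hp hF a₁ a₂ ?_ hG hH hA hgrowth hequ heqv
  have t := h₁''.add h₂''
  rw [add_zero] at t
  refine tendsto_of_tendsto_of_tendsto_of_le_of_le tendsto_const_nhds t (fun _ => zero_le)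
    fun n => (eLpNorm_mono_measure _ hS).trans ?_
  have e : (fun x => φ₁ n x - φ₂ n x) = fun x => (φ₁ n x - φ x) - (φ₂ n x - φ x) := by
    ext x; ring
  rw [e]
  exact eLpNorm_sub_le ((h₁ n).1.continuous.aestronglyMeasurable.sub hφ)
    ((h₂ n).1.continuous.aestronglyMeasurable.sub hφ) hp1

theorem isCompact_frontier_of_isBounded {Ω : Set (Eucl N)} (hΩb : Bornology.IsBounded Ω) :
    IsCompact (frontier Ω) :=
  Metric.isCompact_of_isClosed_isBounded isClosed_frontier
    (hΩb.closure.subset frontier_subset_closure)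

theorem volume_univ_eq_top (hN : 2 ≤ N) : volume (univ : Set (Eucl N)) = ⊤ := by
  have : Nonempty (Fin N) := ⟨⟨0, by omega⟩⟩
  have : NoncompactSpace (Eucl N) := NormedSpace.noncompactSpace ℝ (Eucl N)
  exact measure_univ_of_isAddLeftInvariant _

theorem memLp_min_one {μ : Measure (Eucl N)} {r : ℝ≥0∞} {w : Eucl N → ℝ} (hw : MemLp w r μ) :
    MemLp (fun x => min 1 |w x|) r μ :=
  hw.of_le ((continuous_const.min continuous_abs).comp_aestronglyMeasurable hw.1)
    (Eventually.of_forall fun x => by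
      rw [Real.norm_of_nonneg (le_min zero_le_one (abs_nonneg _))]
      exact min_le_right _ _)

theorem IsInteriorSolution.ae_eq (hN : 2 ≤ N) {Ω : Set (Eucl N)} (hΩo : IsOpen Ω)
    (hΩb : Bornology.IsBounded Ω) (hΩL : HasLipschitzBoundary Ω) {p : ℝ} (hp : 1 < p)
    {F : Seminorm ℝ (Eucl N)} (hF : ∀ ξ, F ξ = 0 → ξ = 0) {φ u v : Eucl N → ℝ}
    (hφ : MemBoundarySobolev Ω p φ) (hu : IsInteriorSolution F p Ω φ u)
    (hv : IsInteriorSolution F p Ω φ v) : u =ᵐ[volume.restrict Ω] v := by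
  obtain ⟨G, -, hu, hG, hut, hequ⟩ := hu
  obtain ⟨H, -, hv, hH, hvt, heqv⟩ := hv
  have hle : ∀ R : ℝ, volume.restrict (Ω ∩ Metric.ball 0 R) ≤ volume.restrict Ω := fun R =>
    Measure.restrict_mono inter_subset_left le_rfl
  have hpR : (ENNReal.ofReal p).toReal = p := ENNReal.toReal_ofReal (by linarith)
  refine ae_eq_of_hasTrace le_rfl hΩo ?_ hΩL (isCompact_frontier_of_isBounded hΩb) hp hF hφ.1.1
    (fun R => hu.mono_measure (hle R)) (fun R => hv.mono_measure (hle R)) hG hH hut hvt le_rfl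
    (by rw [hpR, sub_self]) (by rw [hpR, sub_self, mul_zero]; exact zero_le_one)
    (memLp_min_one (hu.sub hv)) hequ heqv
  rw [measure_compl hΩo.measurableSet hΩb.measure_lt_top.ne, volume_univ_eq_top hN,
    ENNReal.top_sub hΩb.measure_lt_top.ne]
  exact ENNReal.top_ne_zero

theorem sobolev_exponent_sub {p : ℝ} (hp : 1 < p) (hpN : p < N) :
    1 / p - 1 / (p * N / (N - p)) = 1 / N := by
  have h1 : (N : ℝ) - p ≠ 0 := by linarith
  have h2 : (N : ℝ) ≠ 0 := by linarith
  have h3 : p ≠ 0 := by linarith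
  field_simp
  ring

theorem lt_sobolev_exponent {p : ℝ} (hp : 1 < p) (hpN : p < N) : p < p * N / (N - p) := by
  rw [lt_div_iff₀ (by linarith)]
  nlinarith

theorem IsExteriorSolution.ae_eq (hN : 2 ≤ N) {Ω : Set (Eucl N)} (hΩo : IsOpen Ω)
    (hΩne : Ω.Nonempty) (hΩb : Bornology.IsBounded Ω) (hΩL : HasLipschitzBoundary Ω) {p : ℝ}
    (hp : 1 < p) {F : Seminorm ℝ (Eucl N)} (hF : ∀ ξ, F ξ = 0 → ξ = 0) {φ u v : Eucl N → ℝ}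
    (hφ : MemBoundarySobolev Ω p φ) (hu : IsExteriorSolution F p Ω φ u)
    (hv : IsExteriorSolution F p Ω φ v) : u =ᵐ[volume.restrict (exteriorDomain Ω)] v := by
  obtain ⟨G, -, hu, hG, hut, hequ, hu'⟩ := hu
  obtain ⟨H, -, hv, hH, hvt, heqv, hv'⟩ := hv
  have hN0 : (0 : ℝ) < N := by
    have : (2 : ℝ) ≤ N := by exact_mod_cast hN
    linarith
  have hne : volume (exteriorDomain Ω)ᶜ ≠ 0 := by
    rw [exteriorDomain, compl_compl]
    exact ((hΩo.measure_pos volume hΩne).trans_le (measure_mono subset_closure)).ne'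
  have hc : IsCompact (frontier (exteriorDomain Ω)) :=
    (isCompact_frontier_of_isBounded hΩb).of_isClosed_subset isClosed_frontier
      (frontier_exteriorDomain_subset Ω)
  have key := @ae_eq_of_hasTrace N Ω (exteriorDomain Ω) (surfaceMeasure_exteriorDomain_le Ω)
    (isOpen_exteriorDomain Ω) hne hΩL.exteriorDomain hc p hp F hF φ u v hφ.1.1 G H hu hv hG hH
    hut hvt
  rcases lt_or_ge p N with hpN | hpN
  · have hq := lt_sobolev_exponent hp hpN
    have hqR : (ENNReal.ofReal (p * N / (N - p))).toReal = p * N / (N - p) :=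
      ENNReal.toReal_ofReal (by linarith)
    refine key (r := ENNReal.ofReal (p * N / (N - p))) (ENNReal.ofReal_le_ofReal hq.le) ?_ ?_
      (memLp_min_one ((hu' hpN).1.sub (hv' hpN).1)) hequ heqv
    · rw [hqR, sobolev_exponent_sub hp hpN]
      positivity
    · rw [hqR, sobolev_exponent_sub hp hpN, mul_one_div_cancel hN0.ne']
  -- For `p ≥ N` the truncation at `1` suffices: a bounded function has `L^p` norm of order `R^(N/p)
  -- ≤ R` on balls.
  · refine key (r := ⊤) le_top ?_ ?_ ?_ hequ heqv
    · simp only [ENNReal.toReal_top, div_zero, sub_zero]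
      positivity
    · simp only [ENNReal.toReal_top, div_zero, sub_zero]
      rw [mul_one_div]
      exact (div_le_one (by linarith)).2 hpN
    · have hm : ∀ {w : Eucl N → ℝ}, (∀ R : ℝ, MemLp w (ENNReal.ofReal p)
          (volume.restrict (exteriorDomain Ω ∩ Metric.ball 0 R))) →
          AEStronglyMeasurable w (volume.restrict (exteriorDomain Ω)) := fun {w} hw => by
        have e1 : exteriorDomain Ω = ⋃ n : ℕ, exteriorDomain Ω ∩ Metric.ball 0 n := by
          rw [← inter_iUnion, Metric.iUnion_ball_nat, inter_univ]
        rw [e1, aestronglyMeasurable_iUnion_iff]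
        exact fun n => (hw n).1
      refine memLp_top_of_bound ((continuous_const.min continuous_abs).comp_aestronglyMeasurable
        ((hm hu).sub (hm hv))) 1 (Eventually.of_forall fun x => ?_)
      change ‖min 1 |u x - v x|‖ ≤ 1
      rw [Real.norm_of_nonneg (le_min zero_le_one (abs_nonneg _))]
      exact min_le_left _ _

end Dirichlet

/-! ### Uniqueness of energy minimizers. -/

section Minimizers

variable {p : ℝ} {Ω : Set (Eucl N)} {F : Seminorm ℝ (Eucl N)} {u v : Eucl N → ℝ}
  {G H : Eucl N → Eucl N}

theorem isSmoothLipschitz_linear (α β : ℝ) :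
    IsSmoothLipschitz (fun s t => α * s + β * t) (fun _ _ => α) (fun _ _ => β) (max |α| |β|) := by
  refine ⟨(contDiff_const.mul contDiff_fst).add (contDiff_const.mul contDiff_snd),
    continuous_const, continuous_const, fun s t => ?_,
    fun _ _ => le_max_left _ _, fun _ _ => le_max_right _ _⟩
  exact (hasFDerivAt_fst.const_mul α).add (hasFDerivAt_snd.const_mul β)

theorem deriv_smoothTransition_nonneg (x : ℝ) : 0 ≤ deriv Real.smoothTransition x :=
  Real.smoothTransition.monotone.deriv_nonneg

theorem IsBoundedProfile.abs_sub_le {a a' : ℝ → ℝ} {C : ℝ} (h : IsBoundedProfile a a' C)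
    (s t : ℝ) : |a s - a t| ≤ C * |s - t| :=
  Convex.norm_image_sub_le_of_norm_hasDerivWithin_le (f := a) (s := univ)
    (fun x _ => (h.hasDerivAt x).hasDerivWithinAt) (fun x _ => h.bound_deriv x) convex_univ
    (mem_univ _) (mem_univ _)

theorem exists_isBoundedProfile_smoothTransition_neg : ∃ C, 1 ≤ C ∧
    IsBoundedProfile (fun s => Real.smoothTransition (-s))
      (fun s => -deriv Real.smoothTransition (-s)) C := by
  obtain ⟨C, hC0, hC⟩ := exists_bound_deriv_smoothTransition
  refine ⟨max C 1, le_max_right _ _, contDiff_smoothTransition.comp contDiff_neg, fun s => ?_,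
    fun s => ?_, fun s => ?_⟩
  · have h1 : HasDerivAt Real.smoothTransition (deriv Real.smoothTransition (-s)) (-s) :=
      (contDiff_smoothTransition.differentiable (by simp) _).hasDerivAt
    exact (h1.comp s (hasDerivAt_neg s)).congr_deriv (by ring)
  · rw [abs_of_nonneg (Real.smoothTransition.nonneg _)]
    exact (Real.smoothTransition.le_one _).trans (le_max_right _ _)
  · rw [abs_neg]
    exact (hC _).trans (le_max_left _ _)

theorem isBoundedProfile_arctan_sub :
    IsBoundedProfile (fun s => Real.arctan s - Real.pi / 2) (fun s => 1 / (1 + s ^ 2)) 4 := by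
  refine ⟨Real.contDiff_arctan.sub contDiff_const, fun s => (Real.hasDerivAt_arctan s).sub_const _,
    fun s => ?_, fun s => (one_div_one_add_sq_le s).trans (by norm_num)⟩
  have h1 := Real.neg_pi_div_two_lt_arctan s
  have h2 := Real.arctan_lt_pi_div_two s
  have h3 := Real.pi_lt_four
  rw [abs_le]
  constructor <;> linarith

theorem continuous_seminorm_rpow (hp : 1 ≤ p) (F : Seminorm ℝ (Eucl N)) :
    Continuous fun ξ => F ξ ^ p :=
  (Real.continuous_rpow_const (by linarith)).comp (seminorm_continuous F)

theorem integrable_seminorm_rpow (hp : 1 ≤ p) {μ : Measure (Eucl N)}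
    (hG : MemLp G (ENNReal.ofReal p) μ) : Integrable (fun x => F (G x) ^ p) μ := by
  obtain ⟨C, hC, hFC⟩ := exists_seminorm_le F
  have hp0 : 0 < p := by linarith
  have h1 := (hG.integrable_norm_rpow (by simpa using hp0) ENNReal.ofReal_ne_top).const_mul (C ^ p)
  rw [ENNReal.toReal_ofReal hp0.le] at h1
  refine h1.mono' ((continuous_seminorm_rpow hp F).comp_aestronglyMeasurable hG.1)
    (Eventually.of_forall fun x => ?_)
  have h0 := apply_nonneg F (G x)
  rw [Real.norm_of_nonneg (Real.rpow_nonneg h0 _), ← Real.mul_rpow hC.le (norm_nonneg _)]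
  exact Real.rpow_le_rpow h0 (hFC _) hp0.le

theorem energy_eq_ofReal (hp : 1 ≤ p) (hG : MemLp G (ENNReal.ofReal p) volume) :
    energy F p G = ENNReal.ofReal (∫ x, F (G x) ^ p) :=
  (ofReal_integral_eq_lintegral_ofReal (integrable_seminorm_rpow hp hG)
    (Eventually.of_forall fun _ => Real.rpow_nonneg (apply_nonneg F _) _)).symm

theorem integral_le_of_energy_le (hp : 1 ≤ p) (hG : MemLp G (ENNReal.ofReal p) volume)
    (hH : MemLp H (ENNReal.ofReal p) volume) (h : energy F p G ≤ energy F p H) :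
    ∫ x, F (G x) ^ p ≤ ∫ x, F (H x) ^ p := by
  rw [energy_eq_ofReal hp hG, energy_eq_ofReal hp hH] at h
  exact (ENNReal.ofReal_le_ofReal_iff
    (integral_nonneg fun x => Real.rpow_nonneg (apply_nonneg F _) _)).1 h

theorem IsCompetitor.memLp_ball (hp : 1 < p) (hpN : p < N) (h : IsCompetitor p Ω u G) (R : ℝ) :
    MemLp u (ENNReal.ofReal p) (volume.restrict (univ ∩ Metric.ball 0 R)) :=
  (h.1.mono_measure Measure.restrict_le_self).mono_exponent
    (ENNReal.ofReal_le_ofReal (lt_sobolev_exponent hp hpN).le)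

theorem IsCompetitor.smoothApprox (hp : 1 < p) (hpN : p < N) (h : IsCompetitor p Ω u G) :
    SmoothApprox univ (ENNReal.ofReal p) u G (fun n => mollify (shrinkingBump N n) u) :=
  h.2.1.smoothApprox (by simpa using ENNReal.ofReal_le_ofReal hp.le) ENNReal.ofReal_ne_top
    (h.memLp_ball hp hpN) fun R => h.2.2.1.mono_measure Measure.restrict_le_self

theorem IsCompetitor.midpoint (hp : 1 < p) (hpN : p < N) (hu : IsCompetitor p Ω u G)
    (hv : IsCompetitor p Ω v H) :
    IsCompetitor p Ω (fun x => 1 / 2 * u x + 1 / 2 * v x)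
      (fun x => (1 / 2 : ℝ) • G x + (1 / 2 : ℝ) • H x) := by
  have hp1 : 1 ≤ ENNReal.ofReal p := by simpa using ENNReal.ofReal_le_ofReal hp.le
  refine ⟨MemLp.add (f := fun x => 1 / 2 * u x) (g := fun x => 1 / 2 * v x)
    (hu.1.const_mul _) (hv.1.const_mul _), ((hu.smoothApprox hp hpN).comp hp1 ENNReal.ofReal_ne_top (hv.smoothApprox hp hpN)
      (isSmoothLipschitz_linear (1 / 2) (1 / 2))).hasWeakGradient isOpen_univ hp1,
    MemLp.add (f := fun x => (1 / 2 : ℝ) • G x) (g := fun x => (1 / 2 : ℝ) • H x)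
      (hu.2.2.1.const_smul (1 / 2 : ℝ)) (hv.2.2.1.const_smul (1 / 2 : ℝ)), ?_⟩
  filter_upwards [hu.2.2.2, hv.2.2.2] with x h1 h2
  linarith

/-- The midpoint is a competitor, so the convexity inequality for the energy is an equality. Where
`F G ≠ F H`, strict convexity of `t ↦ t^p` would make it strict. -/
theorem ae_eq_seminorm_of_minimizers (hp : 1 < p) (hpN : p < N) (hu : IsCompetitor p Ω u G)
    (hv : IsCompetitor p Ω v H)
    (hmu : ∀ w K, IsCompetitor p Ω w K → energy F p G ≤ energy F p K)
    (hmv : ∀ w K, IsCompetitor p Ω w K → energy F p H ≤ energy F p K) :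
    ∀ᵐ x, F (G x) = F (H x) := by
  have hm := hu.midpoint hp hpN hv
  have iG := integrable_seminorm_rpow (F := F) hp.le hu.2.2.1
  have iH := integrable_seminorm_rpow (F := F) hp.le hv.2.2.1
  have iM := integrable_seminorm_rpow (F := F) hp.le hm.2.2.1
  have e1 := integral_le_of_energy_le hp.le hu.2.2.1 hm.2.2.1 (hmu _ _ hm)
  have e2 := integral_le_of_energy_le hp.le hv.2.2.1 hm.2.2.1 (hmv _ _ hm)
  have hle : ∀ x, F ((1 / 2 : ℝ) • G x + (1 / 2 : ℝ) • H x) ^ p ≤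
      (1 / 2 * F (G x) + 1 / 2 * F (H x)) ^ p := fun x => by
    refine Real.rpow_le_rpow (apply_nonneg F _) ?_ (by linarith)
    exact F.convexOn.2 (mem_univ _) (mem_univ _) (by norm_num) (by norm_num) (by norm_num)
  have hconv : ∀ x, (1 / 2 * F (G x) + 1 / 2 * F (H x)) ^ p ≤
      1 / 2 * F (G x) ^ p + 1 / 2 * F (H x) ^ p := fun x =>
    (convexOn_rpow hp.le).2 (apply_nonneg F (G x)) (apply_nonneg F (H x)) (by norm_num)
      (by norm_num) (by norm_num)
  have hi := ((iG.const_mul (1 / 2)).add (iH.const_mul (1 / 2))).sub iM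
  have h0 : ∫ x, (1 / 2 * F (G x) ^ p + 1 / 2 * F (H x) ^ p -
      F ((1 / 2 : ℝ) • G x + (1 / 2 : ℝ) • H x) ^ p) = 0 := by
    refine le_antisymm ?_ (integral_nonneg fun x => sub_nonneg.2 ((hle x).trans (hconv x)))
    have h1 := integral_sub ((iG.const_mul (1 / 2)).add (iH.const_mul (1 / 2))) iM
    have h2 := integral_add (iG.const_mul (1 / 2)) (iH.const_mul (1 / 2))
    simp only [Pi.add_apply] at h1
    rw [h1, h2, integral_const_mul, integral_const_mul]
    linarith
  have hz := (integral_eq_zero_iff_of_nonneg (fun x => sub_nonneg.2 ((hle x).trans (hconv x)))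
    hi).1 h0
  filter_upwards [hz] with x hx
  simp only [Pi.zero_apply] at hx
  by_contra hne
  have hs := (strictConvexOn_rpow hp).2 (apply_nonneg F (G x)) (apply_nonneg F (H x)) hne
    (by norm_num : (0 : ℝ) < 1 / 2) (by norm_num : (0 : ℝ) < 1 / 2) (by norm_num)
  simp only [smul_eq_mul] at hs
  linarith [hle x]

/-- The variation raises `u` only where `u < v`, so it respects the constraint. The factor `arctan u
- π/2` is negative with positive derivative, which lowers the total weight of the gradients from `1`
to `1 - a`. -/
theorem ae_seminorm_eq_zero_of_lt (hp : 1 < p) (hpN : p < N) (hu : IsCompetitor p Ω u G)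
    (hv : IsCompetitor p Ω v H)
    (hmu : ∀ w K, IsCompetitor p Ω w K → energy F p G ≤ energy F p K)
    (hFF : ∀ᵐ x, F (G x) = F (H x)) : ∀ᵐ x, u x < v x → F (G x) = 0 := by
  have hp1 : 1 ≤ ENNReal.ofReal p := by simpa using ENNReal.ofReal_le_ofReal hp.le
  obtain ⟨C, hC1, hS⟩ := exists_isBoundedProfile_smoothTransition_neg
  have hΦ := hS.mul_comp_sub isBoundedProfile_arctan_sub
  have su := hu.smoothApprox hp hpN
  have sv := hv.smoothApprox hp hpN
  have sm := su.comp hp1 ENNReal.ofReal_ne_top sv hΦ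
  -- The unscaled weights are at most `4 C` for `b` (from `π < 4`) and `1` for `a`, so this `c`
  -- gives `a + b ≤ 1`.
  set c : ℝ := 1 / (4 * C + 1) with hc
  have hc0 : 0 < c := by positivity
  have hcC : c * (4 * C + 1) = 1 := by rw [hc]; field_simp
  set m : Eucl N → ℝ := fun x =>
    Real.smoothTransition (-(u x - v x)) * (Real.arctan (u x) - Real.pi / 2) with hm
  set a : Eucl N → ℝ := fun x => c * Real.smoothTransition (-(u x - v x)) * (1 / (1 + u x ^ 2))
    with ha
  set b : Eucl N → ℝ := fun x => c * deriv Real.smoothTransition (-(u x - v x)) *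
    (Real.pi / 2 - Real.arctan (u x)) with hb
  have sw := su.comp hp1 ENNReal.ofReal_ne_top sm (isSmoothLipschitz_linear 1 (-c))
  have hum : AEStronglyMeasurable u volume := hu.1.1
  have hvm : AEStronglyMeasurable v volume := hv.1.1
  have hSabs : ∀ x, |Real.smoothTransition (-(u x - v x))| ≤ C * |u x - v x| := fun x => by
    have := hS.abs_sub_le (u x - v x) 0
    simpa using this
  have hm0 : ∀ x, m x ≤ 0 := fun x =>
    mul_nonpos_of_nonneg_of_nonpos (Real.smoothTransition.nonneg _)
      (by linarith [Real.arctan_lt_pi_div_two (u x)])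
  have hmmeas : AEStronglyMeasurable m volume :=
    hΦ.smooth.continuous.comp_aestronglyMeasurable (hum.prodMk hvm)
  have hmLp : MemLp m (ENNReal.ofReal (p * N / (N - p))) volume := by
    refine (hu.1.sub hv.1).of_le_mul (c := C * 4) hmmeas (Eventually.of_forall fun x => ?_)
    rw [norm_mul, mul_right_comm]
    exact mul_le_mul (hSabs x) (isBoundedProfile_arctan_sub.bound _) (abs_nonneg _)
      (by positivity)
  have hKeq : ∀ x, (1 : ℝ) • G x + -c • ((-deriv Real.smoothTransition (-(u x - v x)) *
      (Real.arctan (u x) - Real.pi / 2) + Real.smoothTransition (-(u x - v x)) *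
      (1 / (1 + u x ^ 2))) • G x + (-(-deriv Real.smoothTransition (-(u x - v x)) *
      (Real.arctan (u x) - Real.pi / 2))) • H x) = (1 - b x - a x) • G x + b x • H x := fun x => by
    simp only [ha, hb]
    module
  have ha0 : ∀ x, 0 ≤ a x := fun x =>
    mul_nonneg (mul_nonneg hc0.le (Real.smoothTransition.nonneg _)) (by positivity)
  have hb0 : ∀ x, 0 ≤ b x := fun x =>
    mul_nonneg (mul_nonneg hc0.le (deriv_smoothTransition_nonneg _))
      (by linarith [Real.arctan_lt_pi_div_two (u x)])
  have hab : ∀ x, b x + a x ≤ 1 := fun x => by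
    have h1 := hS.bound_deriv (u x - v x)
    rw [abs_neg, abs_of_nonneg (deriv_smoothTransition_nonneg _)] at h1
    have h2 := isBoundedProfile_arctan_sub.bound (u x)
    rw [abs_of_nonpos (by linarith [Real.arctan_lt_pi_div_two (u x)]), neg_sub] at h2
    have h3 := Real.smoothTransition.le_one (-(u x - v x))
    have h4 := one_div_one_add_sq_le (u x)
    rw [abs_of_nonneg (by positivity)] at h4
    have h5 : deriv Real.smoothTransition (-(u x - v x)) * (Real.pi / 2 - Real.arctan (u x)) ≤
        C * 4 := mul_le_mul h1 h2 (by linarith [Real.arctan_lt_pi_div_two (u x)]) (by linarith)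
    have h6 : Real.smoothTransition (-(u x - v x)) * (1 / (1 + u x ^ 2)) ≤ 1 * 1 :=
      mul_le_mul h3 h4 (by positivity) zero_le_one
    calc b x + a x = c * (deriv Real.smoothTransition (-(u x - v x)) *
          (Real.pi / 2 - Real.arctan (u x)) + Real.smoothTransition (-(u x - v x)) *
          (1 / (1 + u x ^ 2))) := by simp only [ha, hb]; ring
      _ ≤ c * (4 * C + 1) := mul_le_mul_of_nonneg_left (by linarith) hc0.le
      _ = 1 := hcC
  have hwg := sw.hasWeakGradient isOpen_univ hp1
  simp_rw [hKeq] at hwg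
  have ham : AEStronglyMeasurable a volume := by
    have h1 : Continuous fun r : ℝ × ℝ =>
        c * Real.smoothTransition (-(r.1 - r.2)) * (1 / (1 + r.1 ^ 2)) := by
      have := Real.smoothTransition.continuous
      refine (continuous_const.mul (this.comp (by fun_prop))).mul
        (continuous_const.div (by fun_prop) fun r => by positivity)
    have h3 := h1.comp_aestronglyMeasurable (hum.prodMk hvm)
    exact h3
  have hbm : AEStronglyMeasurable b volume := by
    have h1 : Continuous fun r : ℝ × ℝ =>
        c * deriv Real.smoothTransition (-(r.1 - r.2)) * (Real.pi / 2 - Real.arctan r.1) := by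
      have h2 : Continuous (deriv Real.smoothTransition) :=
        contDiff_smoothTransition.continuous_deriv (by simp)
      exact (continuous_const.mul (h2.comp (by fun_prop))).mul
        (continuous_const.sub (Real.continuous_arctan.comp continuous_fst))
    have h3 := h1.comp_aestronglyMeasurable (hum.prodMk hvm)
    exact h3
  have hKLp : MemLp (fun x => (1 - b x - a x) • G x + b x • H x) (ENNReal.ofReal p) volume := by
    refine MemLp.add ?_ ?_
    · refine hu.2.2.1.of_le (((aestronglyMeasurable_const.sub hbm).sub ham).smul hu.2.2.1.1)
        (Eventually.of_forall fun x => ?_)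
      rw [norm_smul, Real.norm_of_nonneg (by linarith [hab x])]
      exact mul_le_of_le_one_left (norm_nonneg _) (by linarith [ha0 x, hb0 x])
    · refine hv.2.2.1.of_le (hbm.smul hv.2.2.1.1) (Eventually.of_forall fun x => ?_)
      rw [norm_smul, Real.norm_of_nonneg (hb0 x)]
      exact mul_le_of_le_one_left (norm_nonneg _) (by linarith [ha0 x, hab x])
  have hcomp : IsCompetitor p Ω (fun x => 1 * u x + -c * m x)
      (fun x => (1 - b x - a x) • G x + b x • H x) := by
    refine ⟨MemLp.add (f := fun x => 1 * u x) (g := fun x => -c * m x) (hu.1.const_mul _)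
      (hmLp.const_mul _), hwg, hKLp, ?_⟩
    filter_upwards [hu.2.2.2] with x hx
    have := mul_nonneg hc0.le (neg_nonneg.2 (hm0 x))
    linarith
  have hint := integral_le_of_energy_le hp.le hu.2.2.1 hKLp (hmu _ _ hcomp)
  have iG := integrable_seminorm_rpow (F := F) hp.le hu.2.2.1
  have iK := integrable_seminorm_rpow (F := F) hp.le hKLp
  have iaG : Integrable (fun x => a x * F (G x) ^ p) := by
    refine iG.bdd_mul (c := 1) ham (Eventually.of_forall fun x => ?_)
    rw [Real.norm_of_nonneg (ha0 x)]
    linarith [hab x, hb0 x]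
  have hle : ∀ᵐ x, F ((1 - b x - a x) • G x + b x • H x) ^ p ≤
      F (G x) ^ p - a x * F (G x) ^ p := by
    filter_upwards [hFF] with x hx
    have h1 := map_add_le_add F ((1 - b x - a x) • G x) (b x • H x)
    rw [map_smul_eq_mul, map_smul_eq_mul, Real.norm_of_nonneg (by linarith [hab x]),
      Real.norm_of_nonneg (hb0 x), ← hx] at h1
    -- As `F H = F G`, the mixture of `G` and `H` costs no more than `G` with the total weight `1 -
    -- a`.
    have h2 : F ((1 - b x - a x) • G x + b x • H x) ≤ (1 - a x) * F (G x) := by linarith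
    have h3 : 0 ≤ 1 - a x := by linarith [hab x, hb0 x]
    have h4 := Real.rpow_le_rpow (apply_nonneg F _) h2 (by linarith : 0 ≤ p)
    rw [Real.mul_rpow h3 (apply_nonneg F _)] at h4
    have h5 : (1 - a x) ^ p ≤ 1 - a x := by
      simpa using Real.rpow_le_rpow_of_exponent_ge' h3 (by linarith [ha0 x]) zero_le_one hp.le
    have h6 := mul_le_mul_of_nonneg_right h5 (Real.rpow_nonneg (apply_nonneg F (G x)) p)
    linarith
  have h1 := integral_mono_ae iK (iG.sub iaG) hle
  have h2 := integral_sub iG iaG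
  simp only [Pi.sub_apply] at h1
  rw [h2] at h1
  have hnn : ∀ x, 0 ≤ a x * F (G x) ^ p := fun x =>
    mul_nonneg (ha0 x) (Real.rpow_nonneg (apply_nonneg F _) _)
  have h3 : ∫ x, a x * F (G x) ^ p = 0 := le_antisymm (by linarith) (integral_nonneg hnn)
  have h4 := (integral_eq_zero_iff_of_nonneg hnn iaG).1 h3
  filter_upwards [h4] with x hx hlt
  have h5 : 0 < a x := mul_pos (mul_pos hc0 (Real.smoothTransition.pos_of_pos (by linarith)))
    (by positivity)
  exact (Real.rpow_eq_zero (apply_nonneg F _) (by linarith)).1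
    ((mul_eq_zero_iff_left h5.ne').1 hx)

/-- Both gradients vanish where `u ≠ v`, so `arctan(u - v)^3` is constant; being in a finite `L^q`
on a space of infinite volume, it is zero. -/
theorem IsEnergyMinimizer.ae_eq (hN : 2 ≤ N) (hp : 1 < p) (hpN : p < N)
    (hF : ∀ ξ, F ξ = 0 → ξ = 0) (hu : IsEnergyMinimizer F p Ω u) (hv : IsEnergyMinimizer F p Ω v) :
    u =ᵐ[volume] v := by
  obtain ⟨G, hu, hmu⟩ := hu
  obtain ⟨H, hv, hmv⟩ := hv
  have hp1 : 1 ≤ ENNReal.ofReal p := by simpa using ENNReal.ofReal_le_ofReal hp.le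
  have hFF := ae_eq_seminorm_of_minimizers hp hpN hu hv hmu hmv
  have h1 := ae_seminorm_eq_zero_of_lt hp hpN hu hv hmu hFF
  have h2 := ae_seminorm_eq_zero_of_lt hp hpN hv hu hmv (hFF.mono fun x hx => hx.symm)
  have hΦ := isBoundedProfile_arctan_cube.mul_comp_sub isBoundedProfile_one
  have hJ := ((hu.smoothApprox hp hpN).comp hp1 ENNReal.ofReal_ne_top
    (hv.smoothApprox hp hpN) hΦ).hasWeakGradient isOpen_univ hp1
  have hJ0 : HasWeakGradient univ (fun x => Real.arctan (u x - v x) ^ 3 * 1) fun _ => 0 := by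
    refine ⟨hJ.1, (locallyIntegrable_const _).locallyIntegrableOn _, fun ψ hψ => ?_⟩
    rw [hJ.2.2 ψ hψ, setIntegral_univ, setIntegral_univ]
    congr 1
    refine integral_congr_ae ?_
    filter_upwards [hFF, h1, h2] with x h3 h4 h5
    rcases lt_trichotomy (u x) (v x) with h | h | h
    · have e1 := hF _ (h4 h)
      have e2 := hF _ (h3 ▸ h4 h)
      simp [e1, e2]
    · simp [h]
    · have e1 := hF _ (h5 h)
      have e2 := hF _ (h3 ▸ h5 h)
      simp [e1, e2]
  obtain ⟨c, hc⟩ := hJ0.exists_ae_eq_const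
  have hq := lt_sobolev_exponent hp hpN
  have hJLp : MemLp (fun x => Real.arctan (u x - v x) ^ 3 * 1)
      (ENNReal.ofReal (p * N / (N - p))) volume := by
    have h3 := hΦ.smooth.continuous.comp_aestronglyMeasurable (hu.1.1.prodMk hv.1.1)
    refine (hu.1.sub hv.1).of_le_mul (c := 12) h3
      (Eventually.of_forall fun x => ?_)
    have := isBoundedProfile_arctan_cube.abs_sub_le (u x - v x) 0
    simpa using this
  have hc0 : c = 0 := by
    have h3 := (memLp_congr_ae (p := ENNReal.ofReal (p * N / (N - p)))
      (show (fun x => Real.arctan (u x - v x) ^ 3 * 1) =ᵐ[volume] fun _ => c from hc)).1 hJLp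
    rw [memLp_const_iff (by simpa using by linarith) ENNReal.ofReal_ne_top,
      volume_univ_eq_top hN] at h3
    simpa using h3
  filter_upwards [hc] with x hx
  rw [hc0, mul_one, pow_eq_zero_iff three_ne_zero, Real.arctan_eq_zero_iff] at hx
  exact sub_eq_zero.1 hx

end Minimizers

/-! ### Continuity of the energy and pushing into a Lipschitz set. -/

section Capacity

theorem energy_rpow_eq_eLpNorm {p : ℝ} (hp : 1 < p) (F : Seminorm ℝ (Eucl N))
    (G : Eucl N → Eucl N) :
    energy F p G ^ (1 / p) = eLpNorm (fun x => F (G x)) (ENNReal.ofReal p) volume := by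
  have hp0 : 0 < p := by linarith
  rw [eLpNorm_eq_lintegral_rpow_enorm_toReal (by simpa using hp0) ENNReal.ofReal_ne_top,
    ENNReal.toReal_ofReal hp0.le, energy]
  congr 1
  refine lintegral_congr fun x => ?_
  have h0 := apply_nonneg F (G x)
  rw [← ofReal_norm, Real.norm_of_nonneg h0, ENNReal.ofReal_rpow_of_nonneg h0 hp0.le]

theorem exists_energy_rpow_le {p : ℝ} (hp : 1 < p) (F : Seminorm ℝ (Eucl N)) :
    ∃ C : ℝ, ∀ G H : Eucl N → Eucl N, AEStronglyMeasurable G volume →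
      AEStronglyMeasurable H volume → energy F p H ^ (1 / p) ≤
        energy F p G ^ (1 / p) +
          ENNReal.ofReal C * eLpNorm (fun x => H x - G x) (ENNReal.ofReal p) volume := by
  obtain ⟨C, hC, hFC⟩ := exists_seminorm_le F
  have hp1 : 1 ≤ ENNReal.ofReal p := by simpa using ENNReal.ofReal_le_ofReal hp.le
  refine ⟨C, fun G H hG hH => ?_⟩
  rw [energy_rpow_eq_eLpNorm hp, energy_rpow_eq_eLpNorm hp]
  have hF := seminorm_continuous F
  calc eLpNorm (fun x => F (H x)) (ENNReal.ofReal p) volume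
      ≤ eLpNorm ((fun x => F (G x)) + fun x => F (H x - G x)) (ENNReal.ofReal p) volume := by
        refine eLpNorm_mono fun x => ?_
        rw [Pi.add_apply, Real.norm_of_nonneg (apply_nonneg F _),
          Real.norm_of_nonneg (add_nonneg (apply_nonneg F _) (apply_nonneg F _))]
        simpa using map_add_le_add F (G x) (H x - G x)
    _ ≤ eLpNorm (fun x => F (G x)) (ENNReal.ofReal p) volume +
          eLpNorm (fun x => F (H x - G x)) (ENNReal.ofReal p) volume :=
        eLpNorm_add_le (hF.comp_aestronglyMeasurable hG)
          (hF.comp_aestronglyMeasurable (hH.sub hG)) hp1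
    _ ≤ _ := by
        gcongr
        refine eLpNorm_le_mul_eLpNorm_of_ae_le_mul (Eventually.of_forall fun x => ?_) _
        rw [Real.norm_of_nonneg (apply_nonneg F _)]
        exact hFC _

/-- The energy is continuous along sequences of gradients converging in `L^p`. -/
theorem le_energy_of_tendsto {p : ℝ} (hp : 1 < p) {F : Seminorm ℝ (Eucl N)} {c : ℝ≥0∞}
    {G : Eucl N → Eucl N} {H : ℕ → Eucl N → Eucl N} (hG : AEStronglyMeasurable G volume)
    (hH : ∀ n, AEStronglyMeasurable (H n) volume) (hc : ∀ᶠ n in atTop, c ≤ energy F p (H n))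
    (hlim : Tendsto (fun n => eLpNorm (fun x => H n x - G x) (ENNReal.ofReal p) volume)
      atTop (𝓝 0)) : c ≤ energy F p G := by
  obtain ⟨C, hC⟩ := exists_energy_rpow_le hp F
  have hp0 : 0 < 1 / p := by positivity
  rw [← ENNReal.rpow_le_rpow_iff hp0]
  have t := (ENNReal.Tendsto.const_mul (a := ENNReal.ofReal C) hlim
    (Or.inr ENNReal.ofReal_ne_top)).const_add (energy F p G ^ (1 / p))
  rw [mul_zero, add_zero] at t
  refine ge_of_tendsto t ?_
  filter_upwards [hc] with n hn
  exact (ENNReal.rpow_le_rpow hn hp0.le).trans (hC G (H n) hG (hH n))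

/-- Continuity of the translation action on `L^q` for finite `q`. -/
theorem tendsto_eLpNorm_translate_sub {E : Type*} [NormedAddCommGroup E] {q : ℝ≥0∞} (hq : 1 ≤ q)
    (hqt : q ≠ ⊤) {f : Eucl N → E} (hf : MemLp f q volume) {t : ℕ → Eucl N}
    (ht : Tendsto t atTop (𝓝 0)) :
    Tendsto (fun n => eLpNorm (fun x => f (x + t n) - f x) q volume) atTop (𝓝 0) := by
  have : Fact (1 ≤ q) := ⟨hq⟩
  have : Fact (q ≠ ⊤) := ⟨hqt⟩
  have h1 : Tendsto (fun n => DomAddAct.mk (t n) +ᵥ hf.toLp f) atTop (𝓝 (hf.toLp f)) := by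
    have h2 : Tendsto (fun n => DomAddAct.mk (t n)) atTop (𝓝 0) :=
      (DomAddAct.continuous_mk.tendsto 0).comp ht
    have h3 := h2.vadd (tendsto_const_nhds (x := hf.toLp f))
    rwa [zero_vadd] at h3
  rw [tendsto_iff_edist_tendsto_0] at h1
  refine h1.congr fun n => ?_
  rw [DomAddAct.mk_vadd_toLp, Lp.edist_toLp_toLp]
  congr 1
  ext x
  simp [add_comm]

theorem one_le_mollify (ρ : ContDiffBump (0 : Eucl N)) {v : Eucl N → ℝ}
    (hv : LocallyIntegrable v) {Ω : Set (Eucl N)} (hΩo : IsOpen Ω)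
    (h1 : ∀ᵐ x ∂volume.restrict Ω, 1 ≤ v x) {z : Eucl N} (hz : Metric.ball z ρ.rOut ⊆ Ω) :
    1 ≤ mollify ρ v z := by
  have hae : ∀ᵐ s ∂bumpMeasure ρ, 1 ≤ v (z - s) := by
    have h2 : ∀ᵐ s : Eucl N, z - s ∈ Ω → 1 ≤ v (z - s) :=
      (quasiMeasurePreserving_sub_left volume z).ae ((ae_restrict_iff' hΩo.measurableSet).1 h1)
    have h3 : ∀ᵐ s ∂bumpMeasure ρ, z - s ∈ Ω → 1 ≤ v (z - s) :=
      (withDensity_absolutelyContinuous _ _).ae_le h2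
    filter_upwards [h3, ae_bumpMeasure_mem_ball ρ] with s hs hsb
    refine hs (hz ?_)
    rw [mem_ball_zero_iff] at hsb
    rwa [Metric.mem_ball, dist_eq_norm, sub_sub_cancel_left, norm_neg]
  rw [mollify_eq_integral_bumpMeasure]
  have h4 := integral_mono_ae (integrable_const (1 : ℝ)) (integrable_bumpMeasure ρ hv z) hae
  simpa using h4

/-- A uniform interior cone condition, up to the boundary: shifting by `t • e` gains a whole ball of
radius `t`, the mollification radius used later. -/
theorem HasLipschitzBoundary.exists_inward_direction {Ω : Set (Eucl N)} (hΩo : IsOpen Ω)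
    (hΩL : HasLipschitzBoundary Ω) {x : Eucl N} (hx : x ∈ closure Ω) :
    ∃ (e : Eucl N) (r : ℝ), 0 < r ∧ ∀ y ∈ Metric.ball x r ∩ closure Ω, ∀ t, 0 < t → t < r →
      Metric.ball (y + t • e) t ⊆ Ω := by
  by_cases hxΩ : x ∈ Ω
  · obtain ⟨r, hr, hrΩ⟩ := Metric.isOpen_iff.1 hΩo x hxΩ
    refine ⟨0, r / 2, by positivity, fun y hy t ht htr z hz => hrΩ ?_⟩
    have h1 := Metric.mem_ball.1 hy.1
    rw [smul_zero, add_zero, Metric.mem_ball] at hz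
    rw [Metric.mem_ball]
    linarith [dist_triangle z y x]
  · obtain ⟨e, γ, K, r, -, h⟩ := hΩL.exists_chart (x := x)
      (by rw [hΩo.frontier_eq]; exact ⟨hx, hxΩ⟩)
    have hr := h.pos
    have hK : (0 : ℝ) ≤ K := K.2
    -- The shift by `t L` raises the height by `(2 + K) t`, and moving within the ball of radius `t`
    -- lowers it by at most `(1 + K) t`. The radius `r / (L + 2)` below keeps everything in the
    -- chart.
    set L : ℝ := 2 + K with hL
    refine ⟨L • e, r / (L + 2), by positivity, fun y hy t ht htr z hz => ?_⟩
    have hrL : r / (L + 2) * (L + 2) = r := div_mul_cancel₀ _ (by positivity)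
    have hyr : y ∈ Metric.ball x r := by
      refine Metric.ball_subset_ball ?_ hy.1
      nlinarith [hrL, div_pos hr (by linarith : 0 < L + 2)]
    have hy0 : 0 ≤ graphHeight e γ y := by
      have h1 : y ∈ closure (Ω ∩ Metric.ball x r) := Metric.isOpen_ball.closure_inter ⟨hy.2, hyr⟩
      refine closure_minimal (t := {y | 0 ≤ graphHeight e γ y}) (fun w hw => ?_)
        (isClosed_le continuous_const (continuous_graphHeight h.lipschitz)) h1
      exact ((h.mem_iff w hw.2).1 hw.1).le
    have e1 : y + t • L • e = y - (-(t * L)) • e := by rw [neg_smul, sub_neg_eq_add, mul_smul]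
    rw [e1] at hz
    have h2 := abs_graphHeight_sub_le h.norm_eq h.lipschitz z (y - (-(t * L)) • e)
    rw [graphHeight_sub_smul h.norm_eq, ← dist_eq_norm] at h2
    have h3 := Metric.mem_ball.1 hz
    have h4 : dist (y - (-(t * L)) • e) y = t * L := by
      rw [dist_eq_norm, sub_sub_cancel_left, norm_neg, norm_smul, h.norm_eq, mul_one, norm_neg,
        Real.norm_of_nonneg (by positivity)]
    have h5 := Metric.mem_ball.1 hy.1
    have hzr : z ∈ Metric.ball x r := by
      have h6 := dist_triangle z (y - (-(t * L)) • e) x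
      have h7 := dist_triangle (y - (-(t * L)) • e) y x
      rw [Metric.mem_ball]
      nlinarith
    refine (h.mem_iff z hzr).2 ?_
    have h8 := (abs_le.1 h2).1
    have h9 : (1 + K) * dist z (y - (-(t * L)) • e) ≤ (1 + K) * t := by gcongr
    have h10 : t * L = (1 + K) * t + t := by rw [hL]; ring
    linarith

end Capacity

/-! ### The capacity bound for compactly supported competitors. -/

section CompactSupport

theorem tendsto_eLpNorm_mollify_sub_of_hasCompactSupport {E : Type*} [NormedAddCommGroup E]
    [NormedSpace ℝ E] [CompleteSpace E] {q : ℝ≥0∞} (hq : 1 ≤ q) (hqt : q ≠ ⊤) {f : Eucl N → E}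
    (hf : MemLp f q volume) (hfc : HasCompactSupport f) :
    Tendsto (fun n => eLpNorm (fun x => mollify (shrinkingBump N n) f x - f x) q volume)
      atTop (𝓝 0) := by
  obtain ⟨R, hR⟩ := hfc.isBounded.subset_ball 0
  have hf0 : ∀ x, R ≤ ‖x‖ → f x = 0 := fun x hx => by
    refine image_eq_zero_of_notMem_tsupport fun h => ?_
    have := mem_ball_zero_iff.1 (hR h)
    linarith
  refine (tendsto_eLpNorm_mollify_sub hq hqt tendsto_shrinkingBump hf (Metric.ball 0 (R + 1))
    measure_ball_lt_top.ne).congr fun n => eLpNorm_restrict_eq_of_support_subset fun x hx => ?_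
  by_contra hxR
  rw [mem_ball_zero_iff, not_lt] at hxR
  refine hx ?_
  have h1 : (shrinkingBump N n).rOut ≤ 1 := by
    change 1 / ((n : ℝ) + 1) ≤ 1
    rw [div_le_one (by positivity)]
    simp
  have h2 : mollify (shrinkingBump N n) f x = mollify (shrinkingBump N n) (fun _ => (0 : E)) x :=
    mollify_congr_of_eqOn_ball _ fun y hy => hf0 y (by
      have h3 := norm_sub_norm_le x y
      rw [Metric.mem_ball, dist_comm, dist_eq_norm] at hy
      linarith)
  change mollify (shrinkingBump N n) f x - f x = 0
  rw [h2, hf0 x (by linarith), mollify_apply]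
  simp

/-- Compare both terms with `f`: the shift preserves norms, mollification converges in `L^q`, and
translations of `f` converge as well. -/
theorem tendsto_eLpNorm_mollify_translate_sub {E : Type*} [NormedAddCommGroup E]
    [NormedSpace ℝ E] [CompleteSpace E] {q : ℝ≥0∞} (hq : 1 ≤ q) (hqt : q ≠ ⊤) {f : Eucl N → E}
    (hf : MemLp f q volume) (hfc : HasCompactSupport f) (e : Eucl N) :
    Tendsto (fun n => eLpNorm (fun x => mollify (shrinkingBump N n) f
      (x + (shrinkingBump N n).rOut • e) - mollify (shrinkingBump N n) f x) q volume)
      atTop (𝓝 0) := by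
  have hc : ∀ n, Continuous (mollify (shrinkingBump N n) f) := fun n =>
    continuous_mollify _ (hf.locallyIntegrable hq)
  have hm : ∀ n, AEStronglyMeasurable (fun x => mollify (shrinkingBump N n) f x - f x) volume :=
    fun n => (hc n).aestronglyMeasurable.sub hf.1
  have hmp : ∀ c : Eucl N, MeasurePreserving (fun x : Eucl N => x + c) volume volume := fun c =>
    measurePreserving_add_right volume c
  have h1 := tendsto_eLpNorm_mollify_sub_of_hasCompactSupport hq hqt hf hfc
  have ht : Tendsto (fun n => (shrinkingBump N n).rOut • e) atTop (𝓝 0) := by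
    simpa using tendsto_shrinkingBump.smul_const e
  have h2 := tendsto_eLpNorm_translate_sub hq hqt hf ht
  have h3 : Tendsto (fun n => eLpNorm (fun x => mollify (shrinkingBump N n) f
      (x + (shrinkingBump N n).rOut • e) - f (x + (shrinkingBump N n).rOut • e)) q volume)
      atTop (𝓝 0) :=
    h1.congr fun n => (eLpNorm_comp_measurePreserving (hm n) (hmp _)).symm
  have h4 : Tendsto (fun n => eLpNorm (fun x => f x - mollify (shrinkingBump N n) f x) q volume)
      atTop (𝓝 0) := h1.congr fun n => by
    rw [← eLpNorm_neg]
    congr 1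
    ext x
    simp
  have m3 : ∀ n, AEStronglyMeasurable (fun x => mollify (shrinkingBump N n) f
      (x + (shrinkingBump N n).rOut • e) - f (x + (shrinkingBump N n).rOut • e)) volume :=
    fun n => (hm n).comp_measurePreserving (hmp _)
  have m2 : ∀ n, AEStronglyMeasurable
      (fun x => f (x + (shrinkingBump N n).rOut • e) - f x) volume :=
    fun n => (hf.1.comp_measurePreserving (hmp _)).sub hf.1
  refine (tendsto_eLpNorm_zero_add hq (fun n => (m3 n).add (m2 n))
    (fun n => hf.1.sub (hc n).aestronglyMeasurable)
    (tendsto_eLpNorm_zero_add hq m3 m2 h3 h2) h4).congr fun n => ?_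
  congr 1
  ext x
  simp

theorem tendsto_eLpNorm_zero_sum {α E ι : Type*} [MeasurableSpace α] {μ : Measure α}
    [NormedAddCommGroup E] {q : ℝ≥0∞} (hq : 1 ≤ q) (s : Finset ι) {f : ι → ℕ → α → E}
    (hfm : ∀ i n, AEStronglyMeasurable (f i n) μ)
    (hf : ∀ i, Tendsto (fun n => eLpNorm (f i n) q μ) atTop (𝓝 0)) :
    Tendsto (fun n => eLpNorm (fun x => ∑ i ∈ s, f i n x) q μ) atTop (𝓝 0) := by
  have h1 : Tendsto (fun n => ∑ i ∈ s, eLpNorm (f i n) q μ) atTop (𝓝 0) := by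
    simpa using tendsto_finsetSum s fun i _ => hf i
  refine tendsto_of_tendsto_of_tendsto_of_le_of_le tendsto_const_nhds h1 (fun _ => zero_le)
    fun n => ?_
  have h2 := eLpNorm_sum_le (s := s) (f := fun i => f i n) (fun i _ => hfm i n) hq
  have e : (∑ i ∈ s, f i n) = fun x => ∑ i ∈ s, f i n x := by
    ext x
    simp
  rwa [e] at h2

theorem exists_partition_inward {Ω : Set (Eucl N)} (hΩo : IsOpen Ω)
    (hΩb : Bornology.IsBounded Ω) (hΩL : HasLipschitzBoundary Ω) :
    ∃ (ι : Type) (_ : Fintype ι) (χ : ι → Eucl N → ℝ) (e : ι → Eucl N) (r : ι → ℝ),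
      (∀ i, IsTestFunction univ (χ i)) ∧ (∀ i x, 0 ≤ χ i x) ∧ (∀ i, 0 < r i) ∧
      (∀ x ∈ closure Ω, ∑ i, χ i x = 1) ∧
      ∀ i, ∀ y ∈ closure Ω, χ i y ≠ 0 → ∀ t, 0 < t → t < r i →
        Metric.ball (y + t • e i) t ⊆ Ω := by
  choose! e r hr h using fun x hx => hΩL.exists_inward_direction hΩo (x := x) hx
  obtain ⟨s, hs, hsc⟩ := hΩb.isCompact_closure.elim_nhds_subcover
    (fun x => Metric.ball x (r x)) fun x hx => Metric.ball_mem_nhds x (hr x hx)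
  obtain ⟨f, hf⟩ := SmoothPartitionOfUnity.exists_isSubordinate
    (modelWithCornersSelf ℝ (Eucl N)) isClosed_closure
    (fun i : s => Metric.ball (i : Eucl N) (r i)) (fun i => Metric.isOpen_ball)
    (s := closure Ω) (by simpa [iUnion_subtype] using hsc)
  have hft : ∀ i, tsupport (f i) ⊆ Metric.ball (i : Eucl N) (r i) := hf
  refine ⟨s, inferInstance, fun i => f i, fun i => e i, fun i => r i, fun i => ⟨?_, ?_,
    subset_univ _⟩, fun i x => f.nonneg i x, fun i => hr i (hs i i.2), fun x hx => ?_,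
    fun i y hy hiy t ht htr => ?_⟩
  · exact contMDiff_iff_contDiff.1 (f i).contMDiff
  · exact Metric.isCompact_of_isClosed_isBounded isClosed_closure
      (Metric.isBounded_ball.subset (hft i))
  · rw [← f.sum_eq_one hx, finsum_eq_sum_of_fintype]
  · exact h i (hs i i.2) y ⟨hft i (subset_closure hiy), hy⟩ t ht htr

theorem hasGradientAt_comp_add {f : Eucl N → ℝ} {x c G : Eucl N}
    (h : HasGradientAt f G (x + c)) : HasGradientAt (fun y => f (y + c)) G x := by
  apply hasGradientAt_of_hasFDerivAt_inner
  refine ((HasGradientAt.hasFDerivAt_inner h).comp x ((hasFDerivAt_id x).add_const c)).congr_fderiv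
    ?_
  ext v
  simp

theorem hasGradientAt_sum {ι : Type*} (s : Finset ι) {f : ι → Eucl N → ℝ} {G : ι → Eucl N}
    {x : Eucl N} (h : ∀ i ∈ s, HasGradientAt (f i) (G i) x) :
    HasGradientAt (fun y => ∑ i ∈ s, f i y) (∑ i ∈ s, G i) x := by
  apply hasGradientAt_of_hasFDerivAt_inner
  rw [map_sum]
  exact HasFDerivAt.fun_sum fun i hi => HasGradientAt.hasFDerivAt_inner (h i hi)

theorem hasGradientAt_add {f g : Eucl N → ℝ} {x a b : Eucl N} (hf : HasGradientAt f a x)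
    (hg : HasGradientAt g b x) : HasGradientAt (fun y => f y + g y) (a + b) x := by
  apply hasGradientAt_of_hasFDerivAt_inner
  rw [map_add]
  exact (HasGradientAt.hasFDerivAt_inner hf).add (HasGradientAt.hasFDerivAt_inner hg)

theorem hasGradientAt_sub {f g : Eucl N → ℝ} {x a b : Eucl N} (hf : HasGradientAt f a x)
    (hg : HasGradientAt g b x) : HasGradientAt (fun y => f y - g y) (a - b) x := by
  apply hasGradientAt_of_hasFDerivAt_inner
  rw [map_sub]
  exact (HasGradientAt.hasFDerivAt_inner hf).sub (HasGradientAt.hasFDerivAt_inner hg)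

theorem hasCompactSupport_sum {ι : Type*} (s : Finset ι) {f : ι → Eucl N → ℝ}
    (h : ∀ i, HasCompactSupport (f i)) : HasCompactSupport fun x => ∑ i ∈ s, f i x := by
  classical
  induction s using Finset.induction_on with
  | empty =>
    simp_rw [Finset.sum_empty]
    exact HasCompactSupport.zero
  | insert i s hi ih =>
    simp_rw [Finset.sum_insert hi]
    exact (h i).add ih

/-- Mollification alone may fall below `1` at the boundary. The mollified function is therefore
shifted, piece by piece, in the inward directions; the shifts vanish in the limit and so do the
errors in the gradient. -/
theorem pCapacity_le_energy_of_hasCompactSupport {Ω : Set (Eucl N)} (hΩo : IsOpen Ω)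
    (hΩb : Bornology.IsBounded Ω) (hΩL : HasLipschitzBoundary Ω) {p : ℝ} (hp : 1 < p)
    {F : Seminorm ℝ (Eucl N)} {v : Eucl N → ℝ} {G : Eucl N → Eucl N}
    (hw : HasWeakGradient univ v G) (hv : MemLp v (ENNReal.ofReal p) volume)
    (hG : MemLp G (ENNReal.ofReal p) volume) (hvc : HasCompactSupport v)
    (hGc : HasCompactSupport G) (h1 : ∀ᵐ x ∂volume.restrict Ω, 1 ≤ v x) :
    pCapacity F p (closure Ω) ≤ energy F p G := by
  have hq : 1 ≤ ENNReal.ofReal p := by simpa using ENNReal.ofReal_le_ofReal hp.le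
  have hqt : ENNReal.ofReal p ≠ ⊤ := ENNReal.ofReal_ne_top
  obtain ⟨ι, _, χ, e, r, hχ, hχ0, hr, hsum, hin⟩ := exists_partition_inward hΩo hΩb hΩL
  set ρ := shrinkingBump N
  set t : ℕ → ℝ := fun n => (ρ n).rOut
  have ht0 : ∀ n, 0 < t n := fun n => (ρ n).rOut_pos
  have hvl := hw.locallyIntegrable.1
  have hGl := hw.locallyIntegrable.2
  set V : ℕ → Eucl N → ℝ := fun n => mollify (ρ n) v
  set K : ℕ → Eucl N → Eucl N := fun n => mollify (ρ n) G
  have hVs : ∀ n, ContDiff ℝ ∞ (V n) := fun n => contDiff_mollify _ hvl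
  have hKc : ∀ n, Continuous (K n) := fun n => continuous_mollify _ hGl
  have hVK : ∀ n x, HasGradientAt (V n) (K n x) x := fun n x => hw.hasGradientAt_mollify _ x
  -- The `χ i` sum to `1` only on the closure of `Ω`; writing the shifts as corrections to `V n`
  -- keeps `W n` meaningful elsewhere.
  set W : ℕ → Eucl N → ℝ := fun n x =>
    V n x + ∑ i, χ i x * (V n (x + t n • e i) - V n x) with hW
  set T : ι → ℕ → Eucl N → Eucl N := fun i n x => χ i x • (K n (x + t n • e i) - K n x) +
    (V n (x + t n • e i) - V n x) • gradient (χ i) x with hT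
  have hgrad : ∀ n x, gradient (W n) x = K n x + ∑ i, T i n x := fun n x =>
    (hasGradientAt_add (hVK n x) (hasGradientAt_sum _ fun i _ =>
      hasGradientAt_mul (hasGradientAt_of_contDiff (hχ i).1 x)
        (hasGradientAt_sub (hasGradientAt_comp_add (hVK n _)) (hVK n x)))).gradient
  have htrans : ∀ n i, ContDiff ℝ ∞ fun x => V n (x + t n • e i) := fun n i =>
    (hVs n).comp (contDiff_id.add contDiff_const)
  have hWs : ∀ n, ContDiff ℝ ∞ (W n) := fun n =>
    (hVs n).add (ContDiff.sum fun i _ => (hχ i).1.mul ((htrans n i).sub (hVs n)))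
  have hWt : ∀ n, IsTestFunction univ (W n) := fun n => by
    refine ⟨hWs n, ?_, subset_univ _⟩
    have h2 : HasCompactSupport (V n) :=
      (ρ n).hasCompactSupport_normed.convolution _ hvc
    exact h2.add (hasCompactSupport_sum _ fun i => (hχ i).2.1.mul_right)
  have hTm : ∀ i n, AEStronglyMeasurable (T i n) volume := fun i n => by
    have c1 : Continuous fun x => K n (x + t n • e i) :=
      (hKc n).comp (continuous_id.add continuous_const)
    exact (((hχ i).1.continuous.smul (c1.sub (hKc n))).add
      (((htrans n i).continuous.sub (hVs n).continuous).smul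
        (continuous_gradient (hχ i).1))).aestronglyMeasurable
  have hTlim : ∀ i, Tendsto (fun n => eLpNorm (T i n) (ENNReal.ofReal p) volume)
      atTop (𝓝 0) := fun i => by
    obtain ⟨C, hC⟩ := (hχ i).exists_bound
    have c1 : ∀ n, Continuous fun x => K n (x + t n • e i) := fun n =>
      (hKc n).comp (continuous_id.add continuous_const)
    refine tendsto_eLpNorm_zero_add hq
      (fun n => ((hχ i).1.continuous.smul ((c1 n).sub (hKc n))).aestronglyMeasurable)
      (fun n => (((htrans n i).continuous.sub (hVs n).continuous).smul
        (continuous_gradient (hχ i).1)).aestronglyMeasurable) ?_ ?_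
    · refine tendsto_eLpNorm_zero_of_le_mul C (fun n => Eventually.of_forall fun x => ?_)
        (tendsto_eLpNorm_mollify_translate_sub hq hqt hG hGc (e i))
      rw [norm_smul]
      exact mul_le_mul_of_nonneg_right (hC x).1 (norm_nonneg _)
    · refine tendsto_eLpNorm_zero_of_le_mul C (fun n => Eventually.of_forall fun x => ?_)
        (tendsto_eLpNorm_mollify_translate_sub hq hqt hv hvc (e i))
      rw [norm_smul, mul_comm]
      exact mul_le_mul_of_nonneg_right (hC x).2 (norm_nonneg _)
  refine le_energy_of_tendsto hp (H := fun n => gradient (W n)) hG.1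
    (fun n => (continuous_gradient (hWs n)).aestronglyMeasurable) ?_ ?_
  · have hev : ∀ᶠ n in atTop, ∀ i, t n < r i :=
      eventually_all.2 fun i => tendsto_shrinkingBump.eventually (gt_mem_nhds (hr i))
    filter_upwards [hev] with n hn
    refine iInf₂_le (W n) ⟨hWt n, fun x hx => ?_⟩
    -- On the closure of `Ω` the unshifted terms cancel and a convex combination of averages of `v`
    -- over balls inside `Ω` remains.
    have h2 : W n x = ∑ i, χ i x * V n (x + t n • e i) := by
      simp only [hW, mul_sub, Finset.sum_sub_distrib, ← Finset.sum_mul]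
      rw [hsum x hx]
      ring
    rw [h2, ← hsum x hx]
    refine Finset.sum_le_sum fun i _ => ?_
    rcases eq_or_ne (χ i x) 0 with h0 | h0
    · rw [h0, zero_mul]
    · exact le_mul_of_one_le_right (hχ0 i x)
        (one_le_mollify _ hvl hΩo h1 (hin i x hx h0 (t n) (ht0 n) (hn i)))
  · have l1 := tendsto_eLpNorm_mollify_sub_of_hasCompactSupport hq hqt hG hGc
    have l2 := tendsto_eLpNorm_zero_sum hq Finset.univ hTm hTlim
    refine (tendsto_eLpNorm_zero_add hq (fun n => (hKc n).aestronglyMeasurable.sub hG.1)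
      (fun n => Finset.aestronglyMeasurable_fun_sum _ fun i _ => hTm i n) l1 l2).congr fun n => ?_
    congr 1
    ext1 x
    rw [hgrad]
    change K n x - G x + ∑ i, T i n x = _
    abel

end CompactSupport

/-! ### Cutoff at infinity and the capacity bound for all competitors. -/

section CutoffAtInfinity

theorem tendsto_eLpNorm_cutoff_smul {E : Type*} [NormedAddCommGroup E] [NormedSpace ℝ E]
    {q : ℝ≥0∞} (hq0 : q ≠ 0) (hqt : q ≠ ⊤) {f : Eucl N → E} (hf : MemLp f q volume) {C : ℝ}
    {X : ℕ → Eucl N → ℝ} (hX : ∀ n : ℕ, IsCutoff (fun x => ‖x‖) (n + 1) C (X n)) :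
    Tendsto (fun n => eLpNorm (fun x => X n x • f x) q volume) atTop (𝓝 0) := by
  refine tendsto_eLpNorm_zero_of_dominated (b := fun x => ‖f x‖) hq0 hqt hf.norm
    (fun n => (hX n).smooth.continuous.aestronglyMeasurable.smul hf.1)
    (fun n => Eventually.of_forall fun x => ?_) (Eventually.of_forall fun x => ?_)
  · rw [norm_smul, Real.norm_of_nonneg ((hX n).nonneg x)]
    exact mul_le_of_le_one_left (norm_nonneg _) ((hX n).le_one x)
  · refine tendsto_const_nhds.congr' ?_
    filter_upwards [(tendsto_natCast_atTop_atTop (R := ℝ)).eventually_ge_atTop (4 * ‖x‖)]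
      with n hn
    rw [(hX n).eq_zero x (by linarith), zero_smul]

theorem tendsto_eLpNorm_indicator_norm_ge {q : ℝ≥0∞} (hq0 : q ≠ 0) (hqt : q ≠ ⊤)
    {f : Eucl N → ℝ} (hf : MemLp f q volume) :
    Tendsto (fun n : ℕ => eLpNorm f q (volume.restrict {x | ((n : ℝ) + 1) / 4 ≤ ‖x‖})) atTop
      (𝓝 0) := by
  have hDm : ∀ n : ℕ, MeasurableSet {x : Eucl N | ((n : ℝ) + 1) / 4 ≤ ‖x‖} := fun n =>
    (isClosed_le continuous_const continuous_norm).measurableSet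
  refine Tendsto.congr (fun n => eLpNorm_indicator_eq_eLpNorm_restrict (hDm n)) ?_
  refine tendsto_eLpNorm_zero_of_dominated
    (f := fun n : ℕ => {x : Eucl N | ((n : ℝ) + 1) / 4 ≤ ‖x‖}.indicator f) (b := fun x => ‖f x‖) hq0 hqt hf.norm
    (fun n => hf.1.indicator (hDm n)) (fun n => Eventually.of_forall fun x =>
      norm_indicator_le_norm_self _ _) (Eventually.of_forall fun x => ?_)
  refine tendsto_const_nhds.congr' ?_
  filter_upwards [(tendsto_natCast_atTop_atTop (R := ℝ)).eventually_ge_atTop (4 * ‖x‖)]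
    with n hn
  rw [indicator_of_notMem]
  simp only [mem_ofPred_eq, not_le]
  linarith

/-- At the Sobolev exponent Hölder on a ball of radius of order `n` costs a factor of that order,
which cancels the size `C / (n + 1)` of the gradient. The norm of `v` over `{(n + 1) / 4 ≤ ‖x‖}`
remains, and this tail tends to zero. -/
theorem tendsto_eLpNorm_smul_gradient_cutoff {p : ℝ} (hp : 1 < p) (hpN : p < N) {v : Eucl N → ℝ}
    (hv : MemLp v (ENNReal.ofReal (p * N / (N - p))) volume) {C : ℝ} (hC : 0 < C)
    {X : ℕ → Eucl N → ℝ} (hX : ∀ n : ℕ, IsCutoff (fun x => ‖x‖) (n + 1) C (X n)) :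
    Tendsto (fun n => eLpNorm (fun x => v x • gradient (X n) x) (ENNReal.ofReal p) volume)
      atTop (𝓝 0) := by
  have hlt := lt_sobolev_exponent hp hpN
  have hN0 : (0 : ℝ) < N := by linarith
  have hR0 : ∀ n : ℕ, (0 : ℝ) < n + 1 := fun n => by positivity
  have hexp : 1 / (ENNReal.ofReal p).toReal - 1 / (ENNReal.ofReal (p * N / (N - p))).toReal =
      1 / N := by
    rw [ENNReal.toReal_ofReal (by linarith), ENNReal.toReal_ofReal (by linarith),
      sobolev_exponent_sub hp hpN]
  have s1 := tendsto_eLpNorm_indicator_norm_ge (by simpa using by linarith)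
    ENNReal.ofReal_ne_top hv
  have hAt : ENNReal.ofReal (2 * C) * volume (Metric.ball (0 : Eucl N) 1) ^ (1 / (N : ℝ)) ≠ ⊤ :=
    ENNReal.mul_ne_top ENNReal.ofReal_ne_top
      (ENNReal.rpow_ne_top_of_nonneg (by positivity) measure_ball_lt_top.ne)
  have s2 := ENNReal.Tendsto.const_mul s1 (Or.inr hAt)
  rw [mul_zero] at s2
  refine tendsto_of_tendsto_of_tendsto_of_le_of_le tendsto_const_nhds s2 (fun _ => zero_le)
    fun n => ?_
  have hC0 : 0 ≤ C / (n + 1) := div_nonneg hC.le (hR0 n).le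
  have hDm : MeasurableSet {x : Eucl N | ((n : ℝ) + 1) / 4 ≤ ‖x‖} :=
    (isClosed_le continuous_const continuous_norm).measurableSet
  have b1 := eLpNorm_smul_le_of_eq_zero (D := univ)
    (T := {x : Eucl N | ((n : ℝ) + 1) / 4 ≤ ‖x‖} ∩ Metric.ball 0 (2 * (n + 1)))
    (hDm.inter Metric.isOpen_ball.measurableSet) (q := ENNReal.ofReal p) (m := v)
    (c := C / (n + 1)) (g := gradient (X n)) hC0 (hX n).gradient_le
    (Eventually.of_forall fun x hx => by
      by_cases hxD : ((n : ℝ) + 1) / 4 ≤ ‖x‖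
      · refine (hX n).gradient_eq_zero continuous_norm ?_
        have h3 : x ∉ Metric.ball 0 (2 * ((n : ℝ) + 1)) := fun h' => hx ⟨hxD, h'⟩
        rw [mem_ball_zero_iff, not_lt] at h3
        linarith [hR0 n]
      · exact (hX n).gradient_eq_zero_of_lt continuous_norm (not_le.1 hxD))
  rw [Measure.restrict_univ, univ_inter] at b1
  have b2 := eLpNorm_ball_le (q := ENNReal.ofReal p) (r := ENNReal.ofReal (p * N / (N - p)))
    (ENNReal.ofReal_le_ofReal hlt.le) (by rw [hexp]; positivity)
    (by rw [hexp, mul_one_div_cancel hN0.ne'])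
    (D := {x : Eucl N | ((n : ℝ) + 1) / 4 ≤ ‖x‖}) (m := v) hv.1.restrict (R := 2 * (n + 1))
    (by linarith [n.cast_nonneg (α := ℝ)])
  rw [hexp] at b2
  refine b1.trans ((mul_le_mul_right b2 _).trans_eq ?_)
  have e1 : C / ((n : ℝ) + 1) * (2 * (n + 1)) = 2 * C := by
    have := (hR0 n).ne'
    field_simp
  rw [mul_comm (_ * _) (ENNReal.ofReal _), ← mul_assoc, ← ENNReal.ofReal_mul hC0, e1]
  ring

/-- Multiplying by `1 - X n` gives compactly supported competitors whose gradients converge to `G`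
in `L^p`, and the energy is continuous along them. -/
theorem IsCompetitor.pCapacity_le_energy {Ω : Set (Eucl N)} (hΩo : IsOpen Ω)
    (hΩb : Bornology.IsBounded Ω) (hΩL : HasLipschitzBoundary Ω) {p : ℝ} (hp : 1 < p)
    (hpN : p < N) {F : Seminorm ℝ (Eucl N)} {v : Eucl N → ℝ} {G : Eucl N → Eucl N}
    (h : IsCompetitor p Ω v G) : pCapacity F p (closure Ω) ≤ energy F p G := by
  have hq : 1 ≤ ENNReal.ofReal p := by simpa using ENNReal.ofReal_le_ofReal hp.le
  obtain ⟨C, hC, hcut⟩ := exists_isCutoff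
  have hR0 : ∀ n : ℕ, (0 : ℝ) < n + 1 := fun n => by positivity
  choose X hX using fun n : ℕ => hcut N (fun x => ‖x‖) lipschitzWith_one_norm (n + 1) (hR0 n)
  have hYs : ∀ n, ContDiff ℝ ∞ fun x => 1 - X n x := fun n => contDiff_const.sub (hX n).smooth
  have hYc : ∀ n, HasCompactSupport fun x => 1 - X n x := fun n =>
    HasCompactSupport.intro (isCompact_closedBall (0 : Eucl N) (n + 1)) fun x hx => by
      rw [mem_closedBall_zero_iff, not_le] at hx
      rw [(hX n).eq_one x hx.le, sub_self]
  have hvm : AEStronglyMeasurable v volume := h.1.1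
  have hGm : AEStronglyMeasurable G volume := h.2.2.1.1
  have hXGm : ∀ n, AEStronglyMeasurable (fun x => X n x • G x) volume := fun n =>
    (hX n).smooth.continuous.aestronglyMeasurable.smul hGm
  have hvXm : ∀ n, AEStronglyMeasurable (fun x => v x • gradient (X n) x) volume := fun n =>
    hvm.smul (continuous_gradient (hX n).smooth).aestronglyMeasurable
  have hYGm : ∀ n, AEStronglyMeasurable (fun x => (1 - X n x) • G x) volume := fun n =>
    (hYs n).continuous.aestronglyMeasurable.smul hGm
  have hvYm : ∀ n, AEStronglyMeasurable (fun x => v x • gradient (fun y => 1 - X n y) x) volume :=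
    fun n => hvm.smul (continuous_gradient (hYs n)).aestronglyMeasurable
  refine le_energy_of_tendsto hp
    (H := fun n x => (1 - X n x) • G x + v x • gradient (fun y => 1 - X n y) x) hGm
    (fun n => (hYGm n).add (hvYm n)) ?_ ?_
  · obtain ⟨R, hR⟩ := hΩb.exists_norm_le
    -- For `n ≥ 4 R` the cutoff `X n` vanishes on `Ω`, so the constraint is kept.
    filter_upwards [(tendsto_natCast_atTop_atTop (R := ℝ)).eventually_ge_atTop (4 * R)] with n hn
    have hz := (h.smoothApprox hp hpN).memSobolevZero isOpen_univ hp.le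
      (κ := fun x => 1 - X n x) ⟨hYs n, hYc n, subset_univ _⟩
    have hz1 := hz.1
    have hz2 := hz.2.1
    rw [Measure.restrict_univ] at hz1 hz2
    have hgc : HasCompactSupport (gradient fun x => 1 - X n x) :=
      (hYc n).of_isClosed_subset isClosed_closure (tsupport_gradient_subset _)
    have c1 : HasCompactSupport fun x => (1 - X n x) * v x := (hYc n).mul_right
    have c2 : HasCompactSupport fun x => (1 - X n x) • G x := (hYc n).smul_right
    have c3 : HasCompactSupport fun x => v x • gradient (fun y => 1 - X n y) x :=
      hgc.mono fun x hx h0 => hx (by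
        change v x • gradient (fun y => 1 - X n y) x = 0
        rw [h0, smul_zero])
    have c4 : HasCompactSupport fun x =>
      (1 - X n x) • G x + v x • gradient (fun y => 1 - X n y) x := c2.add c3
    have hw := h.2.1.smooth_mul isOpen_univ (hYs n)
    refine pCapacity_le_energy_of_hasCompactSupport hΩo hΩb hΩL hp hw hz1 hz2 c1 c4 ?_
    filter_upwards [h.2.2.2, ae_restrict_mem hΩo.measurableSet] with x hx hxΩ
    have h1 : X n x = 0 := (hX n).eq_zero x (by linarith [hR x hxΩ])
    rwa [h1, sub_zero, one_mul]
  · have t1 := tendsto_eLpNorm_cutoff_smul (zero_lt_one.trans_le hq).ne' ENNReal.ofReal_ne_top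
      h.2.2.1 hX
    have t2 := tendsto_eLpNorm_smul_gradient_cutoff hp hpN h.1 hC hX
    refine (tendsto_eLpNorm_zero_add hq hXGm hvXm t1 t2).congr fun n => ?_
    rw [← eLpNorm_neg]
    congr 1
    ext1 x
    rw [gradient_one_sub (hX n).smooth, Pi.neg_apply, sub_smul, one_smul, smul_neg]
    abel

theorem IsCapacitaryPotential.isEnergyMinimizer {Ω : Set (Eucl N)} (hΩo : IsOpen Ω)
    (hΩb : Bornology.IsBounded Ω) (hΩL : HasLipschitzBoundary Ω) {p : ℝ} (hp : 1 < p)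
    (hpN : p < N) {F : Seminorm ℝ (Eucl N)} {u : Eucl N → ℝ}
    (h : IsCapacitaryPotential F p Ω u) : IsEnergyMinimizer F p Ω u := by
  obtain ⟨G, hG, hE⟩ := h
  exact ⟨G, hG, fun v H hv => hE.trans_le (hv.pCapacity_le_energy hΩo hΩb hΩL hp hpN)⟩

end CutoffAtInfinity

end AnisoPLaplace

end

theorem corollary1p2 (N : ℕ) (hN : 2 ≤ N)
    (F : Seminorm ℝ (EuclideanSpace ℝ (Fin N))) (hF : ∀ ξ, F ξ = 0 → ξ = 0)
    (p : ℝ) (hp : 1 < p)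
    (Ω : Set (EuclideanSpace ℝ (Fin N))) (hΩo : IsOpen Ω) (hΩne : Ω.Nonempty)
    (hΩb : Bornology.IsBounded Ω) (hΩL : AnisoPLaplace.HasLipschitzBoundary Ω) :
    (∀ φ : EuclideanSpace ℝ (Fin N) → ℝ, AnisoPLaplace.MemBoundarySobolev Ω p φ →
      (∀ u v : EuclideanSpace ℝ (Fin N) → ℝ,
        AnisoPLaplace.IsInteriorSolution F p Ω φ u → AnisoPLaplace.IsInteriorSolution F p Ω φ v →
          u =ᵐ[volume.restrict Ω] v) ∧
      (∀ u v : EuclideanSpace ℝ (Fin N) → ℝ,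
        AnisoPLaplace.IsExteriorSolution F p Ω φ u → AnisoPLaplace.IsExteriorSolution F p Ω φ v →
          u =ᵐ[volume.restrict (AnisoPLaplace.exteriorDomain Ω)] v)) ∧
    (p < N →
      (∀ u v : EuclideanSpace ℝ (Fin N) → ℝ,
        AnisoPLaplace.IsCapacitaryPotential F p Ω u → AnisoPLaplace.IsCapacitaryPotential F p Ω v →
          u =ᵐ[volume] v) ∧
      (∀ u v : EuclideanSpace ℝ (Fin N) → ℝ,
        AnisoPLaplace.IsEnergyMinimizer F p Ω u → AnisoPLaplace.IsEnergyMinimizer F p Ω v →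
          u =ᵐ[volume] v)) := by
  refine ⟨fun φ hφ => ⟨fun u v hu hv => hu.ae_eq hN hΩo hΩb hΩL hp hF hφ hv,
    fun u v hu hv => hu.ae_eq hN hΩo hΩne hΩb hΩL hp hF hφ hv⟩, fun hpN =>
    ⟨fun u v hu hv => ?_, fun u v hu hv => hu.ae_eq hN hp hpN hF hv⟩⟩
  exact (hu.isEnergyMinimizer hΩo hΩb hΩL hp hpN).ae_eq hN hp hpN hF
    (hv.isEnergyMinimizer hΩo hΩb hΩL hp hpN)
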